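/- Let $G$ be a Hausdorff topological group which is amenable (there is a left-invariant mean on the bounded right uniformly continuous real functions on $G$), and let $G$ act jointly continuously on a compact metric space $(X,d)$. Let $W(\mu,\nu)=\inf_\iota\int d\,d\iota$ (infimum over all joinings $\iota$ of $\mu,\nu$) be the Wasserstein distance on the Borel probability measures of $X$. *Følner sequences.* (Thick case.) If $G$ is locally compact and $\sigma$-compact with left Haar measure $\theta$, a Følner sequence is a sequence $\mathcal F=(F_n)$ of non-empty compact sets with $\theta(F_n)>0$ and $\theta(F_n\triangle KF_n)/\theta(F_n)\to0$ for all non-empty compact $K\subseteq G$; it is right Følner if instead $\theta_r(F_n)>0$ and $\theta_r(F_n\triangle F_nK)/\theta_r(F_n)\to0$ for a right Haar measure $\theta_r$. (Thin case.) For finite $F,E\subseteq G$ and a neighbourhood $V$ of $e$, let $\mathfrak m_V(F,E)$ be the maximal cardinality of a set $M\subseteq F$ admitting an injection $\phi:M\to E$ with $\phi(f)\in Vf$ for all $f\in M$, and let $\mathfrak m^r_V(F,E)$ be the same with $\phi(f)\in fV$. If $G$ is second countable, a Følner sequence is a sequence of non-empty finite sets $F_n$ with $\mathfrak m_V(F_n,gF_n)/|F_n|\to1$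 for all $g\in G$ and all open $V\ni e$; it is right Følner if instead $\mathfrak m_V(F_n,F_ng)/|F_n|\to1$ for all such $g,V$, or if $G$ is moreover locally compact and $\mathfrak m^r_V(F_n,F_ng)/|F_n|\to1$ for all such $g,V$. Here $\theta$ and $\theta_r$ denote the counting measure. *Averages.* For such $\mathcal F$ let $S_n^{\mathcal F}f(x)=\theta(F_n)^{-1}\int_{F_n}f(gx)\,d\theta(g)$ for $f\in C(X)$ (with $\theta_r$ for right Følner sequences), $\mathcal W_{\mathcal F}(x,y)=\limsup_n W\big((S_n^{\mathcal F})^*\delta_x,(S_n^{\mathcal F})^*\delta_y\big)$, and $\mathcal W=\sup_{\mathcal F}\mathcal W_{\mathcal F}$, the supremum over all (left) Følner sequences. The system $(X,G)$ is $\mathcal F$-weakly mean equicontinuous if $\mathcal W_{\mathcal F}$ is continuous on $X^2$, and weakly mean equicontinuous if $\mathcal W$ is. **Theorem.** Suppose that $G$ is locally compact and $\sigma$-compact and all Følner sequences are thick, or that $G$ is second countable and all Følner sequences are thin. Then the following are equivalent. (i) $(X,G)$ is weakly mean equicontinuous. (ii) For all $x\in X$, the orbit closure $\overline{Gx}$ carries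 exactly one invariant Borel probability measure $\mu_x$, it is ergodic, and the map $x\mapsto\mu_x$ is continuous for the weak* topology. (iii) For every Følner sequence $\mathcal F$ in $G$, the operators $S_n^{\mathcal F}$ on $C(X)$ converge in the strong operator topology. Moreover, if $(X,G)$ is $\mathcal F$-weakly mean equicontinuous for some Følner sequence $\mathcal F$ and there is an invariant Borel probability measure with support $X$, then (i)--(iii) hold. Finally, if $\mathcal W_{\mathcal F}$ is continuous for some right Følner sequence $\mathcal F$, then (i)--(iii) hold. -/

import Mathlib

open MeasureTheory Filter Topology
open scoped Pointwise symmDiff BoundedContinuousFunction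

noncomputable section

namespace WeakMean

section Amenability

variable (G : Type*) [Group G] [TopologicalSpace G]

/-- The space of bounded right uniformly continuous real functions on `G`, that is, of those
bounded continuous `f` with `sup_x |f (u x) - f x| → 0` as `u → 1`. -/
def rucb : Submodule ℝ (G →ᵇ ℝ) where
  carrier := {f | ∀ ε > 0, ∀ᶠ u in 𝓝 (1 : G), ∀ x, |f (u * x) - f x| < ε}
  zero_mem' := by
    intro ε hε
    simp [hε]
  add_mem' := by
    intro a b ha hb ε hε
    filter_upwards [ha (ε / 2) (half_pos hε), hb (ε / 2) (half_pos hε)] with u hu hv x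
    have h1 := abs_lt.1 (hu x)
    have h2 := abs_lt.1 (hv x)
    simp only [BoundedContinuousFunction.coe_add, Pi.add_apply]
    rw [abs_lt]
    constructor <;> linarith [h1.1, h1.2, h2.1, h2.2]
  smul_mem' := by
    intro c f hf ε hε
    have hc : 0 < |c| + 1 := by positivity
    filter_upwards [hf (ε / (|c| + 1)) (by positivity)] with u hu x
    have h1 := hu x
    rw [lt_div_iff₀ hc] at h1
    have h2 : c • f (u * x) - c • f x = c * (f (u * x) - f x) := by
      simp only [smul_eq_mul]; ring
    simp only [BoundedContinuousFunction.coe_smul]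
    rw [h2, abs_mul]
    nlinarith [abs_nonneg (f (u * x) - f x), abs_nonneg c]

/-- A topological group is amenable if the bounded right uniformly continuous functions carry a
mean (a positive normalized linear functional) that is invariant under left translations. -/
def IsAmenable : Prop :=
  ∃ m : rucb G →ₗ[ℝ] ℝ,
    (∀ f : rucb G, (∀ x, 0 ≤ f.1 x) → 0 ≤ m f) ∧
    (∀ f : rucb G, (∀ x, f.1 x = 1) → m f = 1) ∧
    (∀ (g : G) (f f' : rucb G), (∀ x, f'.1 x = f.1 (g * x)) → m f' = m f)

end Amenability

section Folner

variable {G : Type*} [Group G] [TopologicalSpace G]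

/-- (Left) thick Følner sequences; `θ` is meant to be a left Haar measure. -/
structure IsThickFolner [MeasurableSpace G] (θ : Measure G) (F : ℕ → Set G) : Prop where
  isCompact : ∀ n, IsCompact (F n)
  nonempty : ∀ n, (F n).Nonempty
  measure_pos : ∀ n, 0 < θ (F n)
  tendsto : ∀ K : Set G, IsCompact K → K.Nonempty →
    Tendsto (fun n => θ (F n ∆ (K * F n)) / θ (F n)) atTop (𝓝 0)

/-- Right thick Følner sequences; `θr` is meant to be a right Haar measure. -/
structure IsRightThickFolner [MeasurableSpace G] (θr : Measure G) (F : ℕ → Set G) : Prop where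
  isCompact : ∀ n, IsCompact (F n)
  nonempty : ∀ n, (F n).Nonempty
  measure_pos : ∀ n, 0 < θr (F n)
  tendsto : ∀ K : Set G, IsCompact K → K.Nonempty →
    Tendsto (fun n => θr (F n ∆ (F n * K)) / θr (F n)) atTop (𝓝 0)

/-- The `V`-matching number of two finite sets `F` and `E`: the maximal cardinality of a subset
`M` of `F` with an injection `φ : M → E` such that `φ f ∈ V f` for all `f ∈ M`. -/
def matchingNumber (V F E : Set G) : ℕ :=
  sSup {k : ℕ | ∃ M : Set G, M ⊆ F ∧ M.ncard = k ∧
    ∃ φ : G → G, Set.InjOn φ M ∧ Set.MapsTo φ M E ∧ ∀ f ∈ M, ∃ v ∈ V, φ f = v * f}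

/-- The mirror image of the `V`-matching number, with `φ f ∈ f V` for all `f ∈ M`. -/
def rightMatchingNumber (V F E : Set G) : ℕ :=
  sSup {k : ℕ | ∃ M : Set G, M ⊆ F ∧ M.ncard = k ∧
    ∃ φ : G → G, Set.InjOn φ M ∧ Set.MapsTo φ M E ∧ ∀ f ∈ M, ∃ v ∈ V, φ f = f * v}

/-- (Left) thin Følner sequences. -/
structure IsThinFolner (F : ℕ → Set G) : Prop where
  finite : ∀ n, (F n).Finite
  nonempty : ∀ n, (F n).Nonempty
  tendsto : ∀ (g : G) (V : Set G), IsOpen V → (1 : G) ∈ V →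
    Tendsto (fun n => (matchingNumber V (F n) ((fun h => g * h) '' F n) : ℝ) / (F n).ncard)
      atTop (𝓝 1)

/-- Right thin Følner sequences, with the displacement `φ f ∈ V f` of the matching on the left:
translates `F n * g` are compared with `F n` in the uniformity for which the functions
`g ↦ f (g • x)` of a continuous action on a compact space are uniformly continuous. -/
structure IsRightThinFolner (F : ℕ → Set G) : Prop where
  finite : ∀ n, (F n).Finite
  nonempty : ∀ n, (F n).Nonempty
  tendsto : ∀ (g : G) (V : Set G), IsOpen V → (1 : G) ∈ V →
    Tendsto (fun n => (matchingNumber V (F n) ((fun h => h * g) '' F n) : ℝ) / (F n).ncard)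
      atTop (𝓝 1)

/-- Mirrored right thin Følner sequences, with the displacement `φ f ∈ f V` on the right;
these are the sequences of inverses of the left thin Følner sequences. -/
structure IsMirroredThinFolner (F : ℕ → Set G) : Prop where
  finite : ∀ n, (F n).Finite
  nonempty : ∀ n, (F n).Nonempty
  tendsto : ∀ (g : G) (V : Set G), IsOpen V → (1 : G) ∈ V →
    Tendsto (fun n => (rightMatchingNumber V (F n) ((fun h => h * g) '' F n) : ℝ) / (F n).ncard)
      atTop (𝓝 1)

end Folner

section Wasserstein

variable {X : Type*} [MetricSpace X] [MeasurableSpace X]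

/-- The joinings of two measures. -/
def joinings (μ ν : Measure X) : Set (Measure (X × X)) :=
  {ι | IsProbabilityMeasure ι ∧ ι.map Prod.fst = μ ∧ ι.map Prod.snd = ν}

/-- The Wasserstein distance of two probability measures. -/
def wasserstein (μ ν : Measure X) : ℝ :=
  sInf ((fun ι : Measure (X × X) => ∫ p, dist p.1 p.2 ∂ι) '' joinings μ ν)

end Wasserstein

section Averages

theorem isFiniteMeasure_average {Ω : Type*} [MeasurableSpace Ω] (ρ : Measure Ω) :
    IsFiniteMeasure ((ρ Set.univ)⁻¹ • ρ) := by
  refine ⟨?_⟩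
  rw [Measure.smul_apply, smul_eq_mul]
  exact lt_of_le_of_lt (ENNReal.inv_mul_le_one _) ENNReal.one_lt_top

variable {G : Type*} [Group G] [TopologicalSpace G] [MeasurableSpace G] [BorelSpace G]
variable {X : Type*} [MetricSpace X] [CompactSpace X] [MulAction G X] [ContinuousSMul G X]

theorem integrable_orbit (ρ : Measure G) [IsFiniteMeasure ρ] (f : C(X, ℝ)) (x : X) :
    Integrable (fun g : G => f (g • x)) ρ := by
  refine Integrable.of_bound (C := ‖f‖) ?_ (ae_of_all _ fun g => f.norm_coe_le_norm _)
  exact (by fun_prop : Continuous fun g : G => f (g • x)).aestronglyMeasurable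

/-- The average over `F` with respect to `θ`, as an operator on `C(X)`:
`S f x = 1 / θ(F) * ∫_F f (g x) dθ(g)`. -/
def avgOp (X : Type*) [MetricSpace X] [CompactSpace X] [MulAction G X] [ContinuousSMul G X]
    (θ : Measure G) (F : Set G) : C(X, ℝ) →L[ℝ] C(X, ℝ) :=
  LinearMap.mkContinuous
    { toFun := fun f =>
        { toFun := fun x => ⨍ g in F, f (g • x) ∂θ
          continuous_toFun := by
            have := isFiniteMeasure_average (θ.restrict F)
            refine continuous_of_dominated (bound := fun _ => ‖f‖) ?_ ?_ ?_ ?_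
            · exact fun x => (integrable_orbit _ f x).aestronglyMeasurable
            · exact fun x => ae_of_all _ fun g => f.norm_coe_le_norm _
            · exact integrable_const _
            · exact ae_of_all _ fun g => by fun_prop }
      map_add' := by
        intro f f'
        ext x
        have := isFiniteMeasure_average (θ.restrict F)
        exact integral_add (integrable_orbit _ f x) (integrable_orbit _ f' x)
      map_smul' := by
        intro c f
        ext x
        exact integral_const_mul c _ } 1 (by
      intro f
      rw [one_mul, ContinuousMap.norm_le _ (norm_nonneg _)]
      intro x
      have := isFiniteMeasure_average (θ.restrict F)
      refine (norm_integral_le_of_norm_le_const (C := ‖f‖)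
        (ae_of_all _ fun g => f.norm_coe_le_norm (g • x))).trans ?_
      refine mul_le_of_le_one_right (norm_nonneg _) ?_
      refine ENNReal.toReal_le_of_le_ofReal zero_le_one ?_
      rw [ENNReal.ofReal_one, Measure.smul_apply, smul_eq_mul]
      exact ENNReal.inv_mul_le_one _)

theorem avgOp_apply (θ : Measure G) (F : Set G) (f : C(X, ℝ)) (x : X) :
    avgOp X θ F f x = ⨍ g in F, f (g • x) ∂θ := rfl

variable [MeasurableSpace X] [BorelSpace X]

/-- The measure `S* δ_x` on `X` for the average `S` over `F` with respect to `θ`: the image of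
the normalized restriction of `θ` to `F` under `g ↦ g x`. -/
def orbitMeasure (θ : Measure G) (F : Set G) (x : X) : Measure X :=
  ((θ F)⁻¹ • θ.restrict F).map (fun g => g • x)

theorem integral_orbitMeasure (θ : Measure G) (F : Set G) (x : X) (f : C(X, ℝ)) :
    ∫ y, f y ∂(orbitMeasure θ F x) = avgOp X θ F f x := by
  rw [orbitMeasure, integral_map]
  · rw [avgOp_apply, average, Measure.restrict_apply_univ]
  · exact (by fun_prop : Continuous fun g : G => g • x).measurable.aemeasurable
  · exact f.continuous.aestronglyMeasurable

/-- The pseudometric `𝒲_F`. -/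
def folnerW (θ : Measure G) (F : ℕ → Set G) (x y : X) : ℝ :=
  limsup (fun n => wasserstein (orbitMeasure θ (F n) x) (orbitMeasure θ (F n) y)) atTop

/-- Continuity of `𝒲_F`, that is, `F`-weak mean equicontinuity. -/
def FolnerWeaklyMeanEquicontinuous (X : Type*) [MetricSpace X] [CompactSpace X] [MulAction G X]
    [ContinuousSMul G X] [MeasurableSpace X] [BorelSpace X]
    (θ : Measure G) (F : ℕ → Set G) : Prop :=
  Continuous fun p : X × X => folnerW θ F p.1 p.2

/-- The pseudometric `𝒲`: the supremum of `𝒲_F` over the sequences `F` in a class `P`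
(in use: all thick, or all thin, Følner sequences). -/
def supW (θ : Measure G) (P : (ℕ → Set G) → Prop) (x y : X) : ℝ :=
  ⨆ F : {F : ℕ → Set G // P F}, folnerW θ F.1 x y

/-- Weak mean equicontinuity: continuity of `𝒲`. -/
def WeaklyMeanEquicontinuous (X : Type*) [MetricSpace X] [CompactSpace X] [MulAction G X]
    [ContinuousSMul G X] [MeasurableSpace X] [BorelSpace X]
    (θ : Measure G) (P : (ℕ → Set G) → Prop) : Prop :=
  Continuous fun p : X × X => supW θ P p.1 p.2

/-- Along every sequence in the class `P`, the averages converge in the strong operator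
topology of the bounded operators on `C(X)`. -/
def AveragesConverge (X : Type*) [MetricSpace X] [CompactSpace X] [MulAction G X]
    [ContinuousSMul G X] (θ : Measure G) (P : (ℕ → Set G) → Prop) : Prop :=
  ∀ F : ℕ → Set G, P F → ∃ S : C(X, ℝ) →L[ℝ] C(X, ℝ),
    ∀ f : C(X, ℝ), Tendsto (fun n => avgOp X θ (F n) f) atTop (𝓝 (S f))

end Averages

section UniqueErgodicity

variable (G : Type*) [Group G] (X : Type*) [MetricSpace X] [MulAction G X] [MeasurableSpace X]
  [BorelSpace X]

/-- `μ` is the one and only invariant Borel probability measure on the set `Y`; measures on `Y`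
are identified with the measures on `X` that give full mass to `Y`. -/
def IsUniqueInvariantOn (Y : Set X) (μ : ProbabilityMeasure X) : Prop :=
  (SMulInvariantMeasure G X (μ : Measure X) ∧ (μ : Measure X) Y = 1) ∧
  ∀ ν : ProbabilityMeasure X, SMulInvariantMeasure G X (ν : Measure X) →
    (ν : Measure X) Y = 1 → ν = μ

/-- Every orbit closure is uniquely ergodic, with an ergodic measure that depends continuously
(for the weak topology) on the point. -/
def ContinuouslyUniquelyErgodic : Prop :=
  ∃ μ : X → ProbabilityMeasure X, Continuous μ ∧ ∀ x : X,
    IsUniqueInvariantOn G X (closure (MulAction.orbit G x)) (μ x) ∧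
    ErgodicSMul G X (μ x : Measure X)

/-- There is an invariant Borel probability measure of full support. -/
def HasFullySupportedInvariantMeasure : Prop :=
  ∃ μ : ProbabilityMeasure X, SMulInvariantMeasure G X (μ : Measure X) ∧
    (μ : Measure X).support = Set.univ

end UniqueErgodicity

end WeakMean

end

set_option linter.unusedSectionVars false
set_option linter.unusedVariables false

noncomputable section

namespace WeakMean

/-! ### Riesz representation: positive normalized functionals as measures -/

section Functionals

/-! Everything passes through (ii). By `continuouslyUniquelyErgodic_of_tendsto`, (ii) holds as soon
as the averages along one single sequence converge pointwise to continuous `G`-invariant functions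
`φ f`: an invariant measure `ν` on the closure of `Gx` gives all averages of `f` the same integral,
and `φ f` is constant there, so `∫ f dν = φ f x`. Amenability enters to produce such a `ν`, and
again to produce Følner sequences.

(i) → (ii): by the mean ergodic theorem (`AsymptoticallyInvariant.exists_tendsto_toLp`) the averages
converge in `L²(ν)`. Small `𝒲_F` forces asymptotic equicontinuity, which upgrades this to
convergence at every point of the support of `ν`. If the support is all of `X`, a single sequence
suffices. Otherwise a point of the support lying in the closure of `Gx` is compared with a point of
`Gx`; since `𝒲` controls all Følner sequences at once, right translates of `F` may be used to carry
the comparison along the orbit.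

(ii) → (iii): limits of averages are invariant measures, so uniqueness identifies them; uniformity
follows by evaluating at points where the error is maximal
(`ContinuouslyUniquelyErgodic.tendsto_avgOp`). (iii) → (ii): interleaving `F n` with `F n * g` shows
that the limits are invariant. (ii) → (i): the empirical measures converge to `μ x`, hence `𝒲_F x y
= W (μ x, μ y)`, and `W` is weakly continuous by Kantorovich–Rubinstein duality
(`continuous_wasserstein`).

For right Følner sequences, averages at `g • x` and at `x` agree asymptotically, so asymptotic
equicontinuity makes them agree on orbit closures, and integrating against `ν` gives convergence.
With displacements on the right of the group element, this agreement itself uses equicontinuity,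
through smoothing by a bump function on the group.

Nonemptiness of the two Følner classes is a separate matter. Day's separation argument gives
finitely supported almost invariant probability measures. Convolution turns them into almost
invariant densities, whose superlevel sets give thick sets. Rational weights together with Hall's
marriage theorem give thin sets in the non-discrete case, and in the discrete case the thick sets
for counting measure serve. -/

theorem exists_probabilityMeasure_of_functional {X : Type*} [TopologicalSpace X] [T2Space X]
    [CompactSpace X] [MeasurableSpace X] [BorelSpace X] (Λ : C(X, ℝ) →ₗ[ℝ] ℝ)
    (hpos : ∀ f, 0 ≤ f → 0 ≤ Λ f) (hone : Λ 1 = 1) :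
    ∃ ν : ProbabilityMeasure X, ∀ f : C(X, ℝ), ∫ x, f x ∂(ν : Measure X) = Λ f := by
  let Λ' : CompactlySupportedContinuousMap X ℝ →ₚ[ℝ] ℝ := PositiveLinearMap.mk₀
    { toFun := fun f => Λ f.toContinuousMap
      map_add' := fun f g => Λ.map_add f.toContinuousMap g.toContinuousMap
      map_smul' := fun c f => Λ.map_smul c f.toContinuousMap }
    (fun f hf => hpos f.toContinuousMap fun x => hf x)
  have key : ∀ f : C(X, ℝ), ∫ x, f x ∂(RealRMK.rieszMeasure Λ') = Λ f := fun f =>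
    RealRMK.integral_rieszMeasure Λ' ⟨f, HasCompactSupport.of_compactSpace _⟩
  have hprob : IsProbabilityMeasure (RealRMK.rieszMeasure Λ') := by
    have h1 := key 1
    simp only [ContinuousMap.one_apply, integral_const, smul_eq_mul, mul_one, hone] at h1
    refine ⟨?_⟩
    rw [measureReal_def, ENNReal.toReal_eq_one_iff] at h1
    exact h1
  exact ⟨⟨_, hprob⟩, key⟩

theorem measure_ext_of_integral_continuousMap {X : Type*} [MetricSpace X] [CompactSpace X]
    [MeasurableSpace X] [BorelSpace X] {μ ν : Measure X} [IsFiniteMeasure μ] [IsFiniteMeasure ν]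
    (h : ∀ f : C(X, ℝ), ∫ x, f x ∂μ = ∫ x, f x ∂ν) : μ = ν :=
  ext_of_forall_integral_eq_of_IsFiniteMeasure fun f => h f.toContinuousMap

end Functionals

/-! ### Translations of continuous functions and invariant measures -/

section Translation

variable {G : Type*} [Group G] [TopologicalSpace G]
variable {X : Type*} [MetricSpace X] [CompactSpace X] [MulAction G X] [ContinuousSMul G X]

/-- The translate `x ↦ f (g x)` of a continuous function. -/
def translate (g : G) (f : C(X, ℝ)) : C(X, ℝ) :=
  ⟨fun x => f (g • x), f.continuous.comp (continuous_const_smul g)⟩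

@[simp] theorem translate_apply (g : G) (f : C(X, ℝ)) (x : X) : translate g f x = f (g • x) := rfl

/-- Currying of the jointly continuous map `(g, x) ↦ f (g • x)`: the compact-open topology on `C(X,
ℝ)` is the norm topology because `X` is compact. -/
theorem continuous_translate (f : C(X, ℝ)) : Continuous fun g : G => translate g f :=
  ContinuousMap.continuous_of_continuous_uncurry _
    (f.continuous.comp continuous_smul : Continuous fun p : G × X => f (p.1 • p.2))

theorem norm_translate_le (g : G) (f : C(X, ℝ)) : ‖translate g f‖ ≤ ‖f‖ :=
  (ContinuousMap.norm_le _ (norm_nonneg _)).2 fun _ => f.norm_coe_le_norm _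

/-- Small group elements move the values of a continuous function uniformly little. -/
theorem eventually_forall_abs_smul_sub_lt (f : C(X, ℝ)) {ε : ℝ} (hε : 0 < ε) :
    ∀ᶠ u in 𝓝 (1 : G), ∀ x, |f (u • x) - f x| < ε := by
  have h := (continuous_translate (G := G) f).tendsto 1
  have h1 : translate (1 : G) f = f := by ext x; simp
  rw [h1, Metric.tendsto_nhds] at h
  filter_upwards [h ε hε] with u hu x
  rw [dist_eq_norm] at hu
  exact ((translate u f - f).norm_coe_le_norm x).trans_lt hu

variable [MeasurableSpace X] [BorelSpace X]

theorem integral_translate {ν : Measure X} [SMulInvariantMeasure G X ν] (g : G) (f : C(X, ℝ)) :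
    ∫ x, translate g f x ∂ν = ∫ x, f x ∂ν :=
  (measurePreserving_smul g ν).integral_comp
    (Homeomorph.smul g).measurableEmbedding _

theorem smulInvariantMeasure_of_integral {ν : Measure X} [IsFiniteMeasure ν]
    (h : ∀ (g : G) (f : C(X, ℝ)), ∫ x, translate g f x ∂ν = ∫ x, f x ∂ν) :
    SMulInvariantMeasure G X ν := by
  refine ⟨fun g s hs => ?_⟩
  have hm : Measurable fun x : X => g • x := (continuous_const_smul g).measurable
  have : ν.map (fun x => g • x) = ν := by
    have := Measure.isFiniteMeasure_map ν (fun x : X => g • x)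
    refine measure_ext_of_integral_continuousMap fun f => ?_
    rw [integral_map hm.aemeasurable f.continuous.aestronglyMeasurable]
    exact h g f
  conv_rhs => rw [← this, Measure.map_apply hm hs]

theorem exists_invariant_of_functional (Λ : C(X, ℝ) →ₗ[ℝ] ℝ)
    (hpos : ∀ f, 0 ≤ f → 0 ≤ Λ f) (hone : Λ 1 = 1)
    (hinv : ∀ (g : G) (f : C(X, ℝ)), Λ (translate g f) = Λ f) :
    ∃ ν : ProbabilityMeasure X, SMulInvariantMeasure G X (ν : Measure X) ∧
      ∀ f : C(X, ℝ), ∫ x, f x ∂(ν : Measure X) = Λ f := by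
  obtain ⟨ν, hν⟩ := exists_probabilityMeasure_of_functional Λ hpos hone
  exact ⟨ν, smulInvariantMeasure_of_integral fun g f => by rw [hν, hν, hinv], hν⟩

theorem integrable_continuousMap (ν : Measure X) [IsFiniteMeasure ν] (f : C(X, ℝ)) :
    Integrable (fun x => f x) ν :=
  f.continuous.integrable_of_hasCompactSupport (HasCompactSupport.of_compactSpace _)

/-- A probability measure has full mass on a closed set if it annihilates the distance to it. -/
theorem measure_eq_one_of_integral_infDist (ν : ProbabilityMeasure X) {Y : Set X}
    (hY : IsClosed Y) (hne : Y.Nonempty)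
    (h : ∫ x, Metric.infDist x Y ∂(ν : Measure X) = 0) : (ν : Measure X) Y = 1 := by
  have hc : Continuous fun x : X => Metric.infDist x Y := Metric.continuous_infDist_pt Y
  rw [integral_eq_zero_iff_of_nonneg (fun x => Metric.infDist_nonneg)
    (integrable_continuousMap (ν : Measure X) ⟨_, hc⟩)] at h
  refine (prob_compl_eq_zero_iff hY.measurableSet).1 ?_
  refine measure_mono_null (fun x hx => ?_) (ae_iff.1 h)
  intro h0
  exact hx ((hY.mem_iff_infDist_zero hne).2 h0)

end Translation

/-! ### Invariant measures on orbit closures, and ergodicity -/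

section InvariantMeasure

variable {G : Type*} [Group G] [TopologicalSpace G] [IsTopologicalGroup G]
variable {X : Type*} [MetricSpace X] [CompactSpace X] [MulAction G X] [ContinuousSMul G X]

/-- The function `g ↦ f (g x)` on the group. -/
def orbitFun (x : X) (f : C(X, ℝ)) : rucb G :=
  ⟨BoundedContinuousFunction.ofNormedAddCommGroup (fun g : G => f (g • x))
    (f.continuous.comp (continuous_id.smul continuous_const)) ‖f‖ fun g => f.norm_coe_le_norm _, by
    intro ε hε
    filter_upwards [eventually_forall_abs_smul_sub_lt f hε] with u hu y
    simpa [mul_smul] using hu (y • x)⟩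

variable [MeasurableSpace X] [BorelSpace X]

/-- Orbit closures of an amenable group carry invariant probability measures. -/
theorem exists_invariant_on_orbitClosure (hG : IsAmenable G) (x : X) :
    ∃ ν : ProbabilityMeasure X, SMulInvariantMeasure G X (ν : Measure X) ∧
      (ν : Measure X) (closure (MulAction.orbit G x)) = 1 := by
  obtain ⟨m, hpos, hone, hinv⟩ := hG
  let Λ : C(X, ℝ) →ₗ[ℝ] ℝ := m ∘ₗ
    { toFun := fun f => orbitFun x f
      map_add' := fun f g => rfl
      map_smul' := fun c f => rfl }
  obtain ⟨ν, hν, hinteg⟩ := exists_invariant_of_functional (G := G) Λ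
    (fun f hf => hpos _ fun g => hf _) (hone _ fun g => rfl)
    (fun g f => hinv g _ _ fun y => by
      change f (g • y • x) = f ((g * y) • x)
      rw [mul_smul])
  refine ⟨ν, hν, measure_eq_one_of_integral_infDist ν isClosed_closure
    ⟨x, subset_closure (MulAction.mem_orbit_self x)⟩ ?_⟩
  have hc := Metric.continuous_infDist_pt (closure (MulAction.orbit G x))
  refine (hinteg ⟨_, hc⟩).trans ?_
  -- The mean only sees values along the orbit, where the distance to the orbit closure vanishes;
  -- hence the measure sits on that closure.
  have : orbitFun x (⟨_, hc⟩ : C(X, ℝ)) = (0 : rucb G) := by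
    ext g
    exact Metric.infDist_zero_of_mem (subset_closure (MulAction.mem_orbit x g))
  change m (orbitFun x _) = 0
  rw [this, map_zero]

variable (G) in
/-- The unique invariant measure on a set is ergodic. -/
theorem IsUniqueInvariantOn.ergodicSMul {Y : Set X} (hY : MeasurableSet Y)
    {μ : ProbabilityMeasure X}
    (h : IsUniqueInvariantOn G X Y μ) : ErgodicSMul G X (μ : Measure X) := by
  have hinv := h.1.1
  refine { toSMulInvariantMeasure := hinv, aeconst_of_forall_preimage_smul_ae_eq := ?_ }
  intro s hs hsi
  by_cases h0 : (μ : Measure X) s = 0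
  · rw [eventuallyConst_set']
    exact Or.inl (ae_eq_empty.2 h0)
  · rw [eventuallyConst_set']
    right
    -- Conditioning on an almost invariant set of positive measure gives another invariant measure
    -- on `Y`; by uniqueness it equals `μ`, so the set has full measure.
    have hp : IsProbabilityMeasure (ProbabilityTheory.cond (μ : Measure X) s) :=
      ProbabilityTheory.cond_isProbabilityMeasure h0
    have := h.2 ⟨_, hp⟩ ⟨fun g t ht => ?_⟩ ?_
    · have h1 : ProbabilityTheory.cond (μ : Measure X) s s = (μ : Measure X) s := by
        rw [← congrArg (fun ν : ProbabilityMeasure X => (ν : Measure X) s) this]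
        rfl
      rw [ProbabilityTheory.cond_apply_self h0 (measure_ne_top _ _)] at h1
      rw [ae_eq_univ]
      exact (prob_compl_eq_zero_iff hs).2 h1.symm
    · have hm : Measurable fun x : X => g • x := (continuous_const_smul g).measurable
      change ProbabilityTheory.cond (μ : Measure X) s _ = ProbabilityTheory.cond (μ : Measure X) s _
      rw [ProbabilityTheory.cond_apply hs, ProbabilityTheory.cond_apply hs]
      congr 1
      have e1 : (s ∩ (fun x => g • x) ⁻¹' t : Set X) =ᵐ[(μ : Measure X)]
          ((fun x => g • x) ⁻¹' (s ∩ t) : Set X) :=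
        (hsi g).symm.inter (ae_eq_refl _)
      rw [measure_congr e1]
      exact hinv.measure_preimage_smul g (hs.inter ht)
    · change ProbabilityTheory.cond (μ : Measure X) s _ = 1
      rw [ProbabilityTheory.cond_apply hs, measure_inter_conull]
      · exact ENNReal.inv_mul_cancel h0 (measure_ne_top _ _)
      · exact (prob_compl_eq_zero_iff hY).2 h.1.2

end InvariantMeasure

/-! ### Averaging operators and a criterion for unique ergodicity -/

section Averaging

variable {G : Type*} [Group G] [TopologicalSpace G] [MeasurableSpace G] [BorelSpace G]
variable {X : Type*} [MetricSpace X] [CompactSpace X] [MulAction G X] [ContinuousSMul G X]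

theorem isProbabilityMeasure_average {θ : Measure G} {F : Set G} (h0 : θ F ≠ 0) (h1 : θ F ≠ ⊤) :
    IsProbabilityMeasure ((θ F)⁻¹ • θ.restrict F) := by
  refine ⟨?_⟩
  rw [Measure.smul_apply, Measure.restrict_apply_univ, smul_eq_mul, ENNReal.inv_mul_cancel h0 h1]

theorem integrable_translate (ρ : Measure G) [IsFiniteMeasure ρ] (f : C(X, ℝ)) :
    Integrable (fun g : G => translate g f) ρ :=
  Integrable.of_bound (continuous_translate f).aestronglyMeasurable ‖f‖
    (ae_of_all _ fun g => norm_translate_le g f)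

/-- A Bochner integral with values in `C(X, ℝ)`, so that averages commute with continuous linear
maps: integration against an invariant measure, and the passage to `L²`. -/
theorem avgOp_eq_integral (θ : Measure G) (F : Set G) (f : C(X, ℝ)) :
    avgOp X θ F f = ∫ g, translate g f ∂((θ F)⁻¹ • θ.restrict F) := by
  have := isFiniteMeasure_average (θ.restrict F)
  rw [Measure.restrict_apply_univ] at this
  ext x
  rw [ContinuousMap.integral_apply (integrable_translate _ f), avgOp_apply, average,
    Measure.restrict_apply_univ]
  rfl

theorem norm_avgOp_le (θ : Measure G) (F : Set G) (f : C(X, ℝ)) : ‖avgOp X θ F f‖ ≤ ‖f‖ := by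
  refine ((avgOp X θ F).le_of_opNorm_le ?_ f).trans_eq (one_mul _)
  exact LinearMap.mkContinuous_norm_le _ zero_le_one _

theorem abs_avgOp_le (θ : Measure G) (F : Set G) (f : C(X, ℝ)) (x : X) :
    |avgOp X θ F f x| ≤ ‖f‖ :=
  ((avgOp X θ F f).norm_coe_le_norm x).trans (norm_avgOp_le θ F f)

theorem avgOp_mono (θ : Measure G) (F : Set G) {f : C(X, ℝ)} (hf : 0 ≤ f) :
    0 ≤ avgOp X θ F f := fun x => by
  change 0 ≤ avgOp X θ F f x
  rw [avgOp_apply]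
  exact integral_nonneg fun g => hf _

/-- The averages of a function that is constant on an orbit. -/
theorem avgOp_of_const {θ : Measure G} {F : Set G} (h0 : θ F ≠ 0) (h1 : θ F ≠ ⊤) (f : C(X, ℝ))
    {x : X} {c : ℝ} (hc : ∀ g : G, f (g • x) = c) : avgOp X θ F f x = c := by
  rw [avgOp_apply]
  simp only [hc]
  exact setAverage_const h0 h1 c

variable [MeasurableSpace X] [BorelSpace X]

theorem integral_avgOp {θ : Measure G} {F : Set G} (h0 : θ F ≠ 0) (h1 : θ F ≠ ⊤)
    (ν : Measure X) [IsFiniteMeasure ν] [SMulInvariantMeasure G X ν] (f : C(X, ℝ)) :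
    ∫ x, avgOp X θ F f x ∂ν = ∫ x, f x ∂ν := by
  have := isProbabilityMeasure_average h0 h1
  let I : C(X, ℝ) →L[ℝ] ℝ := LinearMap.mkContinuous
    { toFun := fun f => ∫ x, f x ∂ν
      map_add' := fun f g => integral_add (integrable_continuousMap ν f)
        (integrable_continuousMap ν g)
      map_smul' := fun c f => integral_const_mul c _ } (ν.real Set.univ) (fun f => by
        rw [mul_comm]
        exact norm_integral_le_of_norm_le_const (ae_of_all _ fun x => f.norm_coe_le_norm x))
  change I _ = I f
  rw [avgOp_eq_integral, ← I.integral_comp_comm (integrable_translate _ f)]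
  have : ∀ g : G, I (translate g f) = I f := fun g => integral_translate g f
  simp [this]

/-- Dominated convergence for averages and invariant measures. -/
theorem tendsto_integral_of_tendsto_avgOp (θ : Measure G) (F : ℕ → Set G) (ν : Measure X)
    [IsFiniteMeasure ν] (f : C(X, ℝ)) {φ : X → ℝ}
    (h : ∀ᵐ x ∂ν, Tendsto (fun n => avgOp X θ (F n) f x) atTop (𝓝 (φ x))) :
    Tendsto (fun n => ∫ x, avgOp X θ (F n) f x ∂ν) atTop (𝓝 (∫ x, φ x ∂ν)) :=
  tendsto_integral_of_dominated_convergence (fun _ => ‖f‖)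
    (fun n => (avgOp X θ (F n) f).continuous.aestronglyMeasurable) (integrable_const _)
    (fun n => ae_of_all _ fun x => abs_avgOp_le θ (F n) f x) h

/-- If the averages along some sequence converge pointwise to continuous invariant functions,
then orbit closures are uniquely ergodic with continuously varying measures. -/
theorem continuouslyUniquelyErgodic_of_tendsto [IsTopologicalGroup G] (hG : IsAmenable G)
    {θ : Measure G} {F : ℕ → Set G} (h0 : ∀ n, θ (F n) ≠ 0) (h1 : ∀ n, θ (F n) ≠ ⊤)
    (h : ∀ f : C(X, ℝ), ∃ φ : C(X, ℝ), (∀ (g : G) x, φ (g • x) = φ x) ∧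
      ∀ x, Tendsto (fun n => avgOp X θ (F n) f x) atTop (𝓝 (φ x))) :
    ContinuouslyUniquelyErgodic G X := by
  choose φ hφ hlim using h
  have hclos : ∀ (f : C(X, ℝ)) (x : X), ∀ y ∈ closure (MulAction.orbit G x), φ f y = φ f x := by
    intro f x
    refine closure_minimal ?_ (isClosed_eq (φ f).continuous continuous_const)
    rintro _ ⟨g, rfl⟩
    exact hφ f g x
  -- Any invariant measure on the orbit closure of `x` integrates `f` to `φ f x`. This yields
  -- uniqueness and, since `φ f` is continuous, continuity of `x ↦ μ x`.
  have key : ∀ (x : X) (ν : ProbabilityMeasure X), SMulInvariantMeasure G X (ν : Measure X) →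
      (ν : Measure X) (closure (MulAction.orbit G x)) = 1 →
      ∀ f : C(X, ℝ), ∫ y, f y ∂(ν : Measure X) = φ f x := by
    intro x ν hν hx f
    have t := tendsto_integral_of_tendsto_avgOp θ F (ν : Measure X) f (ae_of_all _ (hlim f))
    simp only [integral_avgOp (h0 _) (h1 _)] at t
    have e := tendsto_nhds_unique tendsto_const_nhds t
    rw [e]
    have hae : ∀ᵐ y ∂(ν : Measure X), φ f y = φ f x := by
      have : ∀ᵐ y ∂(ν : Measure X), y ∈ closure (MulAction.orbit G x) :=
        (mem_ae_iff_prob_eq_one isClosed_closure.measurableSet).2 hx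
      exact this.mono (hclos f x)
    rw [integral_congr_ae hae]
    simp
  choose μ hμ hμ1 using fun x : X => exists_invariant_on_orbitClosure hG x
  have huniq : ∀ x, IsUniqueInvariantOn G X (closure (MulAction.orbit G x)) (μ x) := by
    refine fun x => ⟨⟨hμ x, hμ1 x⟩, fun ν hν hν1 => ?_⟩
    refine Subtype.ext (measure_ext_of_integral_continuousMap (μ := (ν : Measure X))
      (ν := (μ x : Measure X)) fun f => ?_)
    exact (key x ν hν hν1 f).trans (key x (μ x) (hμ x) (hμ1 x) f).symm
  refine ⟨μ, ?_, fun x => ⟨huniq x, (huniq x).ergodicSMul G isClosed_closure.measurableSet⟩⟩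
  rw [continuous_iff_continuousAt]
  intro x
  refine ProbabilityMeasure.tendsto_iff_forall_integral_tendsto.2 fun f => ?_
  have e : ∀ y, ∫ z, f z ∂(μ y : Measure X) = φ f.toContinuousMap y := fun y =>
    key y (μ y) (hμ y) (hμ1 y) f.toContinuousMap
  simp only [e]
  exact (φ f.toContinuousMap).continuous.tendsto x

end Averaging

/-! ### Limits of asymptotically invariant averages -/

section AsymptoticInvariance

variable {G : Type*} [Group G] [TopologicalSpace G] [MeasurableSpace G] [BorelSpace G]

/-- The averages along `F` are asymptotically invariant operators on `C(X)`. -/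
def AsymptoticallyInvariant (X : Type*) [MetricSpace X] [CompactSpace X] [MulAction G X]
    [ContinuousSMul G X] (θ : Measure G) (F : ℕ → Set G) : Prop :=
  ∀ (g : G) (f : C(X, ℝ)),
    Tendsto (fun n => avgOp X θ (F n) (translate g f) - avgOp X θ (F n) f) atTop (𝓝 0)

/-- The averages along `F` are asymptotically equicontinuous. -/
def AsymptoticallyEquicontinuous (X : Type*) [MetricSpace X] [CompactSpace X] [MulAction G X]
    [ContinuousSMul G X] (θ : Measure G) (F : ℕ → Set G) : Prop :=
  ∀ (f : C(X, ℝ)), ∀ ε > 0, ∀ x : X, ∀ᶠ y in 𝓝 x, ∀ᶠ n in atTop,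
    |avgOp X θ (F n) f y - avgOp X θ (F n) f x| < ε

variable {X : Type*} [MetricSpace X] [CompactSpace X] [MulAction G X] [ContinuousSMul G X]

/-- Pointwise limits of asymptotically equicontinuous averages are continuous. -/
theorem AsymptoticallyEquicontinuous.continuous_of_tendsto {θ : Measure G} {F : ℕ → Set G}
    (h : AsymptoticallyEquicontinuous X θ F) {f : C(X, ℝ)} {φ : X → ℝ}
    (hφ : ∀ x, Tendsto (fun n => avgOp X θ (F n) f x) atTop (𝓝 (φ x))) : Continuous φ := by
  rw [continuous_iff_continuousAt]
  intro x
  rw [ContinuousAt, Metric.tendsto_nhds]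
  intro ε hε
  filter_upwards [h f (ε / 2) (half_pos hε) x] with y hy
  rw [Real.dist_eq]
  have := le_of_tendsto ((hφ y).sub (hφ x)).abs (hy.mono fun n hn => hn.le)
  linarith

variable [MeasurableSpace X] [BorelSpace X]

/-- Limits along ultrafilters of asymptotically invariant averages are integrals with respect
to invariant measures. -/
theorem AsymptoticallyInvariant.exists_limit_measure {θ : Measure G} {F : ℕ → Set G}
    (h0 : ∀ n, θ (F n) ≠ 0) (h1 : ∀ n, θ (F n) ≠ ⊤) (hF : AsymptoticallyInvariant X θ F)
    (U : Ultrafilter ℕ) (hU : (U : Filter ℕ) ≤ atTop) (x : ℕ → X) :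
    ∃ ν : ProbabilityMeasure X, SMulInvariantMeasure G X (ν : Measure X) ∧
      ∀ f : C(X, ℝ), Tendsto (fun n => avgOp X θ (F n) f (x n)) U
        (𝓝 (∫ y, f y ∂(ν : Measure X))) := by
  have hex : ∀ f : C(X, ℝ), ∃ a, Tendsto (fun n => avgOp X θ (F n) f (x n)) U (𝓝 a) := by
    intro f
    -- An ultrafilter picks a limit in `[-‖f‖, ‖f‖]` for all `f` simultaneously, so that linearity,
    -- positivity and invariance pass to the limit without extracting subsequences.
    obtain ⟨a, -, ha⟩ := (isCompact_Icc (a := -‖f‖) (b := ‖f‖)).ultrafilter_le_nhds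
      (U.map fun n => avgOp X θ (F n) f (x n)) (by
        rw [le_principal_iff]
        exact Filter.mem_map.2 (Filter.univ_mem' fun n =>
          abs_le.1 (abs_avgOp_le θ (F n) f (x n))))
    exact ⟨a, ha⟩
  choose Λ hΛ using hex
  let L : C(X, ℝ) →ₗ[ℝ] ℝ :=
    { toFun := Λ
      map_add' := fun f g => tendsto_nhds_unique (hΛ (f + g)) (by
        simpa using (hΛ f).add (hΛ g))
      map_smul' := fun c f => tendsto_nhds_unique (hΛ (c • f)) (by
        simpa using (hΛ f).const_mul c) }
  have hpos : ∀ f : C(X, ℝ), 0 ≤ f → 0 ≤ L f := fun f hf =>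
    ge_of_tendsto (f := fun n => avgOp X θ (F n) f (x n)) (hΛ f)
      (Eventually.of_forall fun n => avgOp_mono θ (F n) hf (x n))
  have hone : L 1 = 1 := tendsto_nhds_unique (hΛ 1) (by
    simp only [avgOp_of_const (h0 _) (h1 _) (1 : C(X, ℝ)) fun g => rfl]
    exact tendsto_const_nhds)
  have hinv : ∀ (g : G) (f : C(X, ℝ)), L (translate g f) = L f := by
    intro g f
    have t := (hΛ (translate g f)).sub (hΛ f)
    have t0 : Tendsto (fun n => avgOp X θ (F n) (translate g f) (x n) - avgOp X θ (F n) f (x n)) U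
        (𝓝 0) := by
      refine squeeze_zero_norm (fun n => ?_) ((tendsto_norm_zero.comp (hF g f)).mono_left hU)
      exact (avgOp X θ (F n) (translate g f) - avgOp X θ (F n) f).norm_coe_le_norm (x n)
    exact sub_eq_zero.1 (tendsto_nhds_unique t t0)
  obtain ⟨ν, hν, hinteg⟩ := exists_invariant_of_functional L hpos hone hinv
  exact ⟨ν, hν, fun f => by rw [hinteg f]; exact hΛ f⟩

/-- Under continuous unique ergodicity, asymptotically invariant averages converge. -/
theorem ContinuouslyUniquelyErgodic.tendsto_avgOp {μ : X → ProbabilityMeasure X}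
    (hμ : Continuous μ)
    (hu : ∀ x, IsUniqueInvariantOn G X (closure (MulAction.orbit G x)) (μ x))
    {θ : Measure G} {F : ℕ → Set G}
    (h0 : ∀ n, θ (F n) ≠ 0) (h1 : ∀ n, θ (F n) ≠ ⊤) (hF : AsymptoticallyInvariant X θ F) :
    ∃ S : C(X, ℝ) →L[ℝ] C(X, ℝ), (∀ f x, S f x = ∫ y, f y ∂(μ x : Measure X)) ∧
      ∀ f : C(X, ℝ), Tendsto (fun n => avgOp X θ (F n) f) atTop (𝓝 (S f)) := by
  have hcont : ∀ f : C(X, ℝ), Continuous fun x => ∫ y, f y ∂(μ x : Measure X) := by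
    intro f
    rw [continuous_iff_continuousAt]
    intro x
    exact ProbabilityMeasure.tendsto_iff_forall_integral_tendsto.1 (hμ.tendsto x)
      (BoundedContinuousFunction.mkOfCompact f)
  let S : C(X, ℝ) →L[ℝ] C(X, ℝ) := LinearMap.mkContinuous
    { toFun := fun f => ⟨_, hcont f⟩
      map_add' := fun f g => by
        ext x
        exact integral_add (integrable_continuousMap _ f) (integrable_continuousMap _ g)
      map_smul' := fun c f => by
        ext x
        exact integral_const_mul c _ } 1 (fun f => by
      rw [one_mul, ContinuousMap.norm_le _ (norm_nonneg _)]
      intro x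
      refine (norm_integral_le_of_norm_le_const (C := ‖f‖)
        (ae_of_all _ fun y => f.norm_coe_le_norm y)).trans_eq ?_
      simp)
  have hS : ∀ f x, S f x = ∫ y, f y ∂(μ x : Measure X) := fun f x => rfl
  -- The points `g • x` and `x` have the same orbit closure, hence the same unique measure.
  have hSinv : ∀ f (g : G) x, S f (g • x) = S f x := by
    intro f g x
    have : μ (g • x) = μ x := by
      have h := (hu (g • x)).1
      rw [MulAction.orbit_smul] at h
      exact (hu x).2 _ h.1 h.2
    rw [hS, hS, this]
  have hpt : ∀ f x, Tendsto (fun n => avgOp X θ (F n) f x) atTop (𝓝 (S f x)) := by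
    intro f x
    rw [tendsto_iff_ultrafilter]
    intro U hU
    obtain ⟨ν, hν, hlim⟩ := hF.exists_limit_measure h0 h1 U hU fun _ => x
    have : ν = μ x := by
      refine (hu x).2 ν hν (measure_eq_one_of_integral_infDist ν isClosed_closure
        ⟨x, subset_closure (MulAction.mem_orbit_self x)⟩ ?_)
      have hc := Metric.continuous_infDist_pt (closure (MulAction.orbit G x))
      refine tendsto_nhds_unique (hlim ⟨_, hc⟩) ?_
      simp only [avgOp_of_const (h0 _) (h1 _) (⟨_, hc⟩ : C(X, ℝ)) fun g : G =>
        Metric.infDist_zero_of_mem (subset_closure (MulAction.mem_orbit x g))]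
      exact tendsto_const_nhds
    rw [hS, ← this]
    exact hlim f
  have hinteg : ∀ (ν : ProbabilityMeasure X), SMulInvariantMeasure G X (ν : Measure X) → ∀ f,
      ∫ x, S f x ∂(ν : Measure X) = ∫ x, f x ∂(ν : Measure X) := by
    intro ν hν f
    have t := tendsto_integral_of_tendsto_avgOp θ F (ν : Measure X) f (ae_of_all _ (hpt f))
    simp only [integral_avgOp (h0 _) (h1 _)] at t
    exact tendsto_nhds_unique t tendsto_const_nhds
  refine ⟨S, hS, fun f => ?_⟩
  rcases isEmpty_or_nonempty X with hX | hX
  · have : ∀ n, avgOp X θ (F n) f = S f := fun n => by ext x; exact (hX.false x).elim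
    simp only [this]
    exact tendsto_const_nhds
  rw [tendsto_iff_norm_sub_tendsto_zero]
  -- Uniform convergence is tested at points `x n` of maximal error. Along an ultrafilter the
  -- averages at `x n` tend to an invariant `ν`. Since `S f` is constant on orbits, its average at
  -- `x n` is `S f (x n)`, and `∫ S f dν = ∫ f dν` makes the error vanish.
  have hmax : ∀ n, ∃ x, ‖avgOp X θ (F n) f - S f‖ = ‖(avgOp X θ (F n) f - S f) x‖ := by
    intro n
    obtain ⟨x, -, hx⟩ := isCompact_univ.exists_isMaxOn (Set.univ_nonempty (α := X))
      (avgOp X θ (F n) f - S f).continuous.norm.continuousOn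
    refine ⟨x, le_antisymm ?_ ((avgOp X θ (F n) f - S f).norm_coe_le_norm x)⟩
    exact (ContinuousMap.norm_le _ (norm_nonneg _)).2 fun y => hx (Set.mem_univ y)
  choose x hx using hmax
  simp only [hx]
  rw [tendsto_iff_ultrafilter]
  intro U hU
  obtain ⟨ν, hν, hlim⟩ := hF.exists_limit_measure h0 h1 U hU x
  have t := (hlim f).sub (hlim (S f))
  rw [hinteg ν hν, sub_self] at t
  refine (tendsto_zero_iff_norm_tendsto_zero.1 t).congr fun n => ?_
  rw [avgOp_of_const (h0 n) (h1 n) (S f) fun g => hSinv f g (x n)]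
  rfl

end AsymptoticInvariance

/-! ### The mean ergodic theorem, and convergence on supports -/

section MeanErgodic

/-- Near `x` the values at `y` are close to those at `x` from some time on, depending on `y`. As `x`
lies in the support, one time `N` works for a set of positive measure. Convergence in measure then
provides a point of that set at which `a n` and `b m` are both close to `ξ`. This avoids passing to
almost everywhere convergent subsequences. -/
theorem exists_forall_abs_sub_lt_of_tendstoInMeasure {X : Type*} [TopologicalSpace X]
    [MeasurableSpace X] {ν : Measure X} {a b : ℕ → X → ℝ} {ξ : X → ℝ} {x : X}
    (hx : x ∈ ν.support) (ha : TendstoInMeasure ν a atTop ξ) (hb : TendstoInMeasure ν b atTop ξ)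
    (hax : ∀ ε > 0, ∀ᶠ y in 𝓝 x, ∀ᶠ n in atTop, |a n y - a n x| < ε)
    (hbx : ∀ ε > 0, ∀ᶠ y in 𝓝 x, ∀ᶠ n in atTop, |b n y - b n x| < ε) {ε : ℝ} (hε : 0 < ε) :
    ∃ N, ∀ n ≥ N, ∀ m ≥ N, |a n x - b m x| < ε := by
  have hδ : 0 < ε / 4 := by positivity
  let O : ℕ → Set X := fun N =>
    {y | ∀ n ≥ N, |a n y - a n x| < ε / 4 ∧ |b n y - b n x| < ε / 4}
  have hO : 0 < ν (⋃ N, O N) := by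
    refine (Measure.mem_support_iff_forall x).1 hx _ ?_
    filter_upwards [hax _ hδ, hbx _ hδ] with y h1 h2
    obtain ⟨N, hN⟩ := eventually_atTop.1 (h1.and h2)
    exact Set.mem_iUnion.2 ⟨N, hN⟩
  obtain ⟨N, hN⟩ : ∃ N, 0 < ν (O N) := by
    by_contra! h
    exact hO.ne' (measure_iUnion_null fun N => nonpos_iff_eq_zero.1 (h N))
  -- Two exceptional sets, each of measure below half of that of `O N`, cannot cover `O N`.
  have hh : 0 < ν (O N) / 2 := ENNReal.half_pos hN.ne'
  rw [tendstoInMeasure_iff_dist] at ha hb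
  obtain ⟨N', hN'⟩ := eventually_atTop.1
    (((ha _ hδ).eventually (gt_mem_nhds hh)).and ((hb _ hδ).eventually (gt_mem_nhds hh)))
  refine ⟨max N N', fun n hn m hm => ?_⟩
  obtain ⟨y, hyO, hy⟩ : ∃ y ∈ O N, ¬ (y ∈ {y | ε / 4 ≤ dist (a n y) (ξ y)} ∪
      {y | ε / 4 ≤ dist (b m y) (ξ y)}) := by
    by_contra! h
    have h1 := (measure_mono (μ := ν) h).trans (measure_union_le _ _)
    have h2 := ENNReal.add_lt_add (hN' n (le_of_max_le_right hn)).1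
      (hN' m (le_of_max_le_right hm)).2
    rw [ENNReal.add_halves] at h2
    exact absurd h1 (not_le.2 h2)
  simp only [Set.mem_union, Set.mem_ofPred_eq, not_or, not_le, Real.dist_eq] at hy
  have h1 := abs_lt.1 (hyO n (le_of_max_le_left hn)).1
  have h2 := abs_lt.1 (hyO m (le_of_max_le_left hm)).2
  have h3 := abs_lt.1 hy.1
  have h4 := abs_lt.1 hy.2
  rw [abs_lt]
  constructor <;> linarith [h1.1, h1.2, h2.1, h2.2, h3.1, h3.2, h4.1, h4.2]

variable {G : Type*} [Group G] [TopologicalSpace G] [MeasurableSpace G] [BorelSpace G]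
variable {X : Type*} [MetricSpace X] [CompactSpace X] [MulAction G X] [ContinuousSMul G X]
variable [MeasurableSpace X] [BorelSpace X]

theorem norm_toLp_translate (ν : Measure X) [IsFiniteMeasure ν] [SMulInvariantMeasure G X ν]
    (g : G) (f : C(X, ℝ)) :
    ‖ContinuousMap.toLp 2 ν ℝ (translate g f)‖ = ‖ContinuousMap.toLp 2 ν ℝ f‖ := by
  have h : ∀ φ : C(X, ℝ), ‖ContinuousMap.toLp 2 ν ℝ φ‖ ^ 2 = ∫ x, (φ * φ) x ∂ν := by
    intro φ
    rw [← real_inner_self_eq_norm_sq, ContinuousMap.inner_toLp]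
    simp
  have h2 : ‖ContinuousMap.toLp 2 ν ℝ (translate g f)‖ ^ 2 = ‖ContinuousMap.toLp 2 ν ℝ f‖ ^ 2 := by
    rw [h, h]
    exact integral_translate g (f * f)
  exact (pow_left_inj₀ (norm_nonneg _) (norm_nonneg _) two_ne_zero).1 h2

/-- The mean ergodic theorem for asymptotically invariant averages of continuous functions. -/
theorem AsymptoticallyInvariant.exists_tendsto_toLp {θ : Measure G} {F : ℕ → Set G}
    (h0 : ∀ n, θ (F n) ≠ 0) (h1 : ∀ n, θ (F n) ≠ ⊤) (hF : AsymptoticallyInvariant X θ F)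
    (ν : Measure X) [IsFiniteMeasure ν] [SMulInvariantMeasure G X ν] (f : C(X, ℝ)) :
    ∃ ξ : Lp ℝ 2 ν, ∀ g : G, Tendsto
      (fun n => ContinuousMap.toLp 2 ν ℝ (translate g (avgOp X θ (F n) f))) atTop (𝓝 ξ) := by
  let T : C(X, ℝ) →L[ℝ] Lp ℝ 2 ν := ContinuousMap.toLp 2 ν ℝ
  -- The coboundaries of continuous functions. The limit `ξ` is the component of `T f` orthogonal to
  -- their closure.
  let K₀ : Submodule ℝ (Lp ℝ 2 ν) :=
    Submodule.span ℝ (Set.range fun p : G × C(X, ℝ) => T (translate p.1 p.2 - p.2))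
  let K := K₀.topologicalClosure
  have hK : IsClosed (K : Set (Lp ℝ 2 ν)) := K₀.isClosed_topologicalClosure
  have : CompleteSpace K := hK.completeSpace_coe
  let ξ := T f - K.starProjection (T f)
  have hξ : ξ ∈ Kᗮ := K.sub_starProjection_mem_orthogonal (T f)
  -- Orthogonality to coboundaries replaces an action on `L²`: translating `φ` changes neither `‖T
  -- φ‖` nor the inner product with `ξ`, hence not the distance to `ξ`; so averaging does not
  -- increase that distance.
  have hnorm : ∀ (g : G) φ, ‖T (translate g φ) - ξ‖ = ‖T φ - ξ‖ := by
    intro g φ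
    have hin : inner ℝ (T (translate g φ)) ξ = inner ℝ (T φ) ξ := by
      have := hξ _ (K₀.le_topologicalClosure (Submodule.subset_span ⟨(g, φ), rfl⟩))
      simp only [map_sub] at this
      rw [inner_sub_left] at this
      exact sub_eq_zero.1 this
    refine (pow_left_inj₀ (norm_nonneg _) (norm_nonneg _) two_ne_zero).1 ?_
    rw [norm_sub_sq_real, norm_sub_sq_real (T φ), hin, norm_toLp_translate]
  have hcontr : ∀ n φ, ‖T (avgOp X θ (F n) φ) - ξ‖ ≤ ‖T φ - ξ‖ := by
    intro n φ
    have := isProbabilityMeasure_average (h0 n) (h1 n)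
    have hi := T.integrable_comp (integrable_translate ((θ (F n))⁻¹ • θ.restrict (F n)) φ)
    have e : T (avgOp X θ (F n) φ) - ξ =
        ∫ g, (T (translate g φ) - ξ) ∂((θ (F n))⁻¹ • θ.restrict (F n)) := by
      rw [integral_sub hi (integrable_const _), avgOp_eq_integral,
        ← T.integral_comp_comm (integrable_translate _ φ)]
      simp
    rw [e]
    refine (norm_integral_le_integral_norm _).trans_eq ?_
    simp [hnorm]
  have hcob : ∀ k ∈ K₀, ∃ c : C(X, ℝ), T c = k ∧
      Tendsto (fun n => avgOp X θ (F n) c) atTop (𝓝 0) := by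
    intro k hk
    induction hk using Submodule.span_induction with
    | mem k hk =>
      obtain ⟨⟨g, φ⟩, rfl⟩ := hk
      exact ⟨_, rfl, by simpa only [map_sub] using hF g φ⟩
    | zero => exact ⟨0, map_zero _, by simp⟩
    | add k l _ _ hk hl =>
      obtain ⟨c, rfl, hc⟩ := hk
      obtain ⟨d, rfl, hd⟩ := hl
      exact ⟨c + d, map_add _ _ _, by simpa using hc.add hd⟩
    | smul a k _ hk =>
      obtain ⟨c, rfl, hc⟩ := hk
      exact ⟨a • c, map_smul _ _ _, by simpa using hc.const_smul a⟩
  refine ⟨ξ, fun g => ?_⟩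
  rw [tendsto_iff_norm_sub_tendsto_zero]
  change Tendsto (fun n => ‖T (translate g (avgOp X θ (F n) f)) - ξ‖) atTop (𝓝 0)
  simp only [hnorm]
  rw [Metric.tendsto_atTop']
  intro ε hε
  -- Split `f = (f - c) + c` with `T c` a coboundary near the projection of `T f`: averages of `c`
  -- tend to zero in norm, and those of `f - c` stay within `ε / 2` of `ξ` by contraction.
  obtain ⟨k, hk, hkε⟩ := Metric.mem_closure_iff.1
    (show K.starProjection (T f) ∈ closure (K₀ : Set (Lp ℝ 2 ν)) from
      K.starProjection_apply_mem (T f)) (ε / 2) (half_pos hε)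
  obtain ⟨c, rfl, hc⟩ := hcob k hk
  have hTc : Tendsto (fun n => ‖T (avgOp X θ (F n) c)‖) atTop (𝓝 0) := by
    simpa using ((T.continuous.tendsto 0).comp hc).norm
  obtain ⟨N, hN⟩ := eventually_atTop.1 (hTc.eventually (gt_mem_nhds (half_pos hε)))
  refine ⟨N, fun n hn => ?_⟩
  rw [Real.dist_eq, sub_zero, abs_of_nonneg (norm_nonneg _)]
  have e : T (avgOp X θ (F n) f) - ξ =
      (T (avgOp X θ (F n) (f - c)) - ξ) + T (avgOp X θ (F n) c) := by
    simp only [map_sub]; abel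
  have e2 : T (f - c) - ξ = K.starProjection (T f) - T c := by
    simp only [map_sub, ξ]; abel
  rw [e]
  refine (norm_add_le _ _).trans_lt ?_
  have := hcontr n (f - c)
  rw [e2] at this
  rw [dist_eq_norm] at hkε
  linarith [hN n hn.le]

/-- Asymptotically invariant and asymptotically equicontinuous averages converge on the support
of an invariant measure, with invariant limits. -/
theorem AsymptoticallyInvariant.exists_tendsto_of_mem_support {θ : Measure G} {F : ℕ → Set G}
    (h0 : ∀ n, θ (F n) ≠ 0) (h1 : ∀ n, θ (F n) ≠ ⊤) (hF : AsymptoticallyInvariant X θ F)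
    (hE : AsymptoticallyEquicontinuous X θ F)
    (ν : Measure X) [IsFiniteMeasure ν] [SMulInvariantMeasure G X ν] (f : C(X, ℝ))
    {x : X} (hx : x ∈ ν.support) :
    ∃ c : ℝ, ∀ g : G, Tendsto (fun n => avgOp X θ (F n) f (g • x)) atTop (𝓝 c) := by
  obtain ⟨ξ, hξ⟩ := hF.exists_tendsto_toLp h0 h1 ν f
  have hmeas : ∀ g : G, TendstoInMeasure ν (fun n y => avgOp X θ (F n) f (g • y)) atTop ξ := by
    intro g
    refine (tendstoInMeasure_of_tendsto_Lp (hξ g)).congr_left fun n => ?_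
    exact ContinuousMap.coeFn_toLp ν _
  have hae : ∀ g : G, ∀ ε > 0, ∀ᶠ y in 𝓝 x, ∀ᶠ n in atTop,
      |avgOp X θ (F n) f (g • y) - avgOp X θ (F n) f (g • x)| < ε := fun g ε hε =>
    ((continuous_const_smul g).tendsto x).eventually (hE f ε hε (g • x))
  have key : ∀ g h : G, ∀ ε > 0, ∃ N, ∀ n ≥ N, ∀ m ≥ N,
      |avgOp X θ (F n) f (g • x) - avgOp X θ (F m) f (h • x)| < ε := fun g h ε hε =>
    exists_forall_abs_sub_lt_of_tendstoInMeasure hx (hmeas g) (hmeas h) (hae g) (hae h) hε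
  have hC : CauchySeq fun n => avgOp X θ (F n) f ((1 : G) • x) := by
    refine Metric.cauchySeq_iff.2 fun ε hε => ?_
    obtain ⟨N, hN⟩ := key 1 1 ε hε
    exact ⟨N, fun m hm n hn => hN m hm n hn⟩
  obtain ⟨c, hc⟩ := cauchySeq_tendsto_of_complete hC
  refine ⟨c, fun g => ?_⟩
  have : Tendsto (fun n => avgOp X θ (F n) f (g • x) - avgOp X θ (F n) f ((1 : G) • x)) atTop
      (𝓝 0) := by
    refine Metric.tendsto_atTop.2 fun ε hε => ?_
    obtain ⟨N, hN⟩ := key g 1 ε hε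
    exact ⟨N, fun n hn => by simpa [Real.dist_eq] using hN n hn n hn⟩
  simpa using this.add hc

end MeanErgodic

/-! ### Elementary properties of the Wasserstein distance -/

section WassersteinBasic

variable {X : Type*} [MetricSpace X] [CompactSpace X] [MeasurableSpace X] [BorelSpace X]

theorem integrable_dist_of_finite (ι : Measure (X × X)) [IsFiniteMeasure ι] :
    Integrable (fun p : X × X => dist p.1 p.2) ι :=
  continuous_dist.integrable_of_hasCompactSupport (HasCompactSupport.of_compactSpace _)

theorem prod_mem_joinings (μ ν : Measure X) [IsProbabilityMeasure μ] [IsProbabilityMeasure ν] :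
    μ.prod ν ∈ joinings μ ν :=
  ⟨inferInstance, by simp [Measure.map_fst_prod], by simp [Measure.map_snd_prod]⟩

theorem bddBelow_joining_costs (μ ν : Measure X) :
    BddBelow ((fun ι : Measure (X × X) => ∫ p, dist p.1 p.2 ∂ι) '' joinings μ ν) :=
  ⟨0, by rintro _ ⟨ι, -, rfl⟩; exact integral_nonneg fun p => dist_nonneg⟩

theorem wasserstein_le {μ ν : Measure X} {ι : Measure (X × X)} (h : ι ∈ joinings μ ν) :
    wasserstein μ ν ≤ ∫ p, dist p.1 p.2 ∂ι :=
  csInf_le (bddBelow_joining_costs μ ν) ⟨ι, h, rfl⟩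

theorem wasserstein_nonneg (μ ν : Measure X) : 0 ≤ wasserstein μ ν :=
  Real.sInf_nonneg (by rintro _ ⟨ι, -, rfl⟩; exact integral_nonneg fun p => dist_nonneg)

theorem wasserstein_le_diam (μ ν : Measure X) [IsProbabilityMeasure μ] [IsProbabilityMeasure ν] :
    wasserstein μ ν ≤ Metric.diam (Set.univ : Set X) := by
  refine (wasserstein_le (prod_mem_joinings μ ν)).trans ?_
  refine (integral_mono (integrable_dist_of_finite _) (integrable_const _) fun p =>
    Metric.dist_le_diam_of_mem isCompact_univ.isBounded (Set.mem_univ p.1)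
      (Set.mem_univ p.2)).trans_eq ?_
  simp

theorem wasserstein_self (μ : Measure X) [IsProbabilityMeasure μ] : wasserstein μ μ = 0 := by
  refine le_antisymm ?_ (wasserstein_nonneg μ μ)
  have hm : Measurable fun x : X => (x, x) := by fun_prop
  have hι : μ.map (fun x => (x, x)) ∈ joinings μ μ := by
    refine ⟨Measure.isProbabilityMeasure_map hm.aemeasurable, ?_, ?_⟩
    · rw [Measure.map_map measurable_fst hm]; exact Measure.map_id
    · rw [Measure.map_map measurable_snd hm]; exact Measure.map_id
  refine (wasserstein_le hι).trans_eq ?_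
  rw [integral_map hm.aemeasurable continuous_dist.aestronglyMeasurable]
  simp

theorem integral_sub_integral_of_joining {μ ν : Measure X} {ι : Measure (X × X)}
    (hι : ι ∈ joinings μ ν) (f : C(X, ℝ)) :
    ∫ x, f x ∂μ - ∫ x, f x ∂ν = ∫ p, (f p.1 - f p.2) ∂ι := by
  obtain ⟨hp, rfl, rfl⟩ := hι
  rw [integral_map measurable_fst.aemeasurable f.continuous.aestronglyMeasurable,
    integral_map measurable_snd.aemeasurable f.continuous.aestronglyMeasurable, integral_sub]
  · exact (f.continuous.comp continuous_fst).integrable_of_hasCompactSupport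
      (HasCompactSupport.of_compactSpace _)
  · exact (f.continuous.comp continuous_snd).integrable_of_hasCompactSupport
      (HasCompactSupport.of_compactSpace _)

/-- Integrals of a fixed continuous function are uniformly continuous for the Wasserstein
distance. -/
theorem exists_abs_integral_sub_le (f : C(X, ℝ)) {ε : ℝ} (hε : 0 < ε) :
    ∃ C > 0, ∀ (μ ν : Measure X) [IsProbabilityMeasure μ] [IsProbabilityMeasure ν],
      |∫ x, f x ∂μ - ∫ x, f x ∂ν| ≤ ε + C * wasserstein μ ν := by
  obtain ⟨δ, hδ, h⟩ := Metric.uniformContinuous_iff.1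
    (CompactSpace.uniformContinuous_of_continuous f.continuous) ε hε
  -- At distance at least `δ` the trivial bound `2 * ‖f‖` is at most `2 * ‖f‖ / δ` times the
  -- distance; the summand `1` only makes the constant positive.
  have hC : 0 < 2 * ‖f‖ / δ + 1 := by positivity
  have hpt : ∀ x y, |f x - f y| ≤ ε + (2 * ‖f‖ / δ + 1) * dist x y := by
    intro x y
    rcases lt_or_ge (dist x y) δ with hd | hd
    · have := (h hd).le
      rw [Real.dist_eq] at this
      have : 0 ≤ (2 * ‖f‖ / δ + 1) * dist x y := by positivity
      linarith
    · have h1 : |f x - f y| ≤ 2 * ‖f‖ := by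
        refine (abs_sub _ _).trans ?_
        have h1 := f.norm_coe_le_norm x
        have h2 := f.norm_coe_le_norm y
        rw [Real.norm_eq_abs] at h1 h2
        linarith
      have h2 : 2 * ‖f‖ ≤ 2 * ‖f‖ / δ * dist x y := by
        rw [div_mul_eq_mul_div, le_div_iff₀ hδ]
        exact mul_le_mul_of_nonneg_left hd (by positivity)
      have h3 : 0 ≤ dist x y := dist_nonneg
      nlinarith
  refine ⟨_, hC, fun μ ν _ _ => ?_⟩
  rw [← sub_le_iff_le_add', ← div_le_iff₀' hC]
  refine le_csInf ⟨_, _, prod_mem_joinings μ ν, rfl⟩ ?_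
  rintro _ ⟨ι, hι, rfl⟩
  have := hι.1
  simp only
  rw [div_le_iff₀' hC, sub_le_iff_le_add', integral_sub_integral_of_joining hι f]
  refine abs_integral_le_integral_abs.trans ?_
  refine (integral_mono_of_nonneg (ae_of_all _ fun p => abs_nonneg _)
    ((integrable_const ε).add ((integrable_dist_of_finite ι).const_mul _))
    (ae_of_all _ fun p => hpt p.1 p.2)).trans_eq ?_
  simp only [Pi.add_apply]
  rw [integral_add (integrable_const ε) ((integrable_dist_of_finite ι).const_mul _),
    integral_const_mul]
  simp

end WassersteinBasic

theorem eventually_lt_of_continuous_of_self {X : Type*} [TopologicalSpace X] (w : X → X → ℝ)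
    (hw : Continuous fun p : X × X => w p.1 p.2) {x : X} (hx : w x x = 0) {δ : ℝ} (hδ : 0 < δ) :
    ∀ᶠ y in 𝓝 x, w y x < δ := by
  have ht : Tendsto (fun y => w y x) (𝓝 x) (𝓝 (w x x)) :=
    (hw.tendsto (x, x)).comp ((by fun_prop : Continuous fun y : X => (y, x)).tendsto x)
  rw [hx] at ht
  exact ht.eventually (gt_mem_nhds hδ)

/-! ### From weak mean equicontinuity or convergence to unique ergodicity -/

section Classes

variable {G : Type*} [Group G] [TopologicalSpace G] [MeasurableSpace G] [BorelSpace G]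
variable {X : Type*} [MetricSpace X] [CompactSpace X] [MulAction G X] [ContinuousSMul G X]
variable [MeasurableSpace X] [BorelSpace X]

theorem isProbabilityMeasure_orbitMeasure {θ : Measure G} {F : Set G} (h0 : θ F ≠ 0)
    (h1 : θ F ≠ ⊤) (x : X) : IsProbabilityMeasure (orbitMeasure θ F x) := by
  have := isProbabilityMeasure_average h0 h1
  exact Measure.isProbabilityMeasure_map
    (by fun_prop : Continuous fun g : G => g • x).measurable.aemeasurable

variable {θ : Measure G} {F : ℕ → Set G}

theorem isBoundedUnder_wasserstein_orbitMeasure (h0 : ∀ n, θ (F n) ≠ 0) (h1 : ∀ n, θ (F n) ≠ ⊤)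
    (x y : X) : IsBoundedUnder (· ≤ ·) atTop fun n =>
      wasserstein (orbitMeasure θ (F n) x) (orbitMeasure θ (F n) y) := by
  refine isBoundedUnder_of ⟨Metric.diam (Set.univ : Set X), fun n => ?_⟩
  have := isProbabilityMeasure_orbitMeasure (h0 n) (h1 n) x
  have := isProbabilityMeasure_orbitMeasure (h0 n) (h1 n) y
  exact wasserstein_le_diam _ _

theorem folnerW_le_diam (h0 : ∀ n, θ (F n) ≠ 0) (h1 : ∀ n, θ (F n) ≠ ⊤)
    (x y : X) : folnerW θ F x y ≤ Metric.diam (Set.univ : Set X) := by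
  refine limsup_le_of_le ?_ (Eventually.of_forall fun n => ?_)
  · exact (isBoundedUnder_of ⟨0, fun n => wasserstein_nonneg _ _⟩ :
      IsBoundedUnder (· ≥ ·) _ _).isCoboundedUnder_le
  · have := isProbabilityMeasure_orbitMeasure (h0 n) (h1 n) x
    have := isProbabilityMeasure_orbitMeasure (h0 n) (h1 n) y
    exact wasserstein_le_diam _ _

theorem folnerW_self (h0 : ∀ n, θ (F n) ≠ 0) (h1 : ∀ n, θ (F n) ≠ ⊤) (x : X) :
    folnerW θ F x x = 0 := by
  have : ∀ n, wasserstein (orbitMeasure θ (F n) x) (orbitMeasure θ (F n) x) = 0 := fun n =>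
    have := isProbabilityMeasure_orbitMeasure (h0 n) (h1 n) x
    wasserstein_self _
  simp [folnerW, this]

/-- The threshold `δ` depends on `f` and `ε` alone. Its independence of `F` is what lets continuity
of `𝒲` act on all sequences of the class at once. -/
theorem exists_forall_eventually_of_folnerW_lt (f : C(X, ℝ)) {ε : ℝ} (hε : 0 < ε) :
    ∃ δ > 0, ∀ F : ℕ → Set G, (∀ n, θ (F n) ≠ 0) → (∀ n, θ (F n) ≠ ⊤) → ∀ x y : X,
      folnerW θ F x y < δ →
      ∀ᶠ n in atTop, |avgOp X θ (F n) f x - avgOp X θ (F n) f y| < ε := by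
  obtain ⟨C, hC, h⟩ := exists_abs_integral_sub_le f (half_pos hε)
  refine ⟨ε / 2 / C, by positivity, fun F h0 h1 x y hxy => ?_⟩
  filter_upwards [eventually_lt_of_limsup_lt hxy
    (isBoundedUnder_wasserstein_orbitMeasure h0 h1 x y)] with n hn
  have := isProbabilityMeasure_orbitMeasure (h0 n) (h1 n) x
  have := isProbabilityMeasure_orbitMeasure (h0 n) (h1 n) y
  have h2 := h (orbitMeasure θ (F n) x) (orbitMeasure θ (F n) y)
  rw [integral_orbitMeasure, integral_orbitMeasure] at h2
  rw [lt_div_iff₀' hC] at hn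
  linarith

theorem FolnerWeaklyMeanEquicontinuous.asymptoticallyEquicontinuous
    (h0 : ∀ n, θ (F n) ≠ 0) (h1 : ∀ n, θ (F n) ≠ ⊤)
    (h : FolnerWeaklyMeanEquicontinuous X θ F) : AsymptoticallyEquicontinuous X θ F := by
  intro f ε hε x
  obtain ⟨δ, hδ, hf⟩ := exists_forall_eventually_of_folnerW_lt (θ := θ) f hε
  filter_upwards [eventually_lt_of_continuous_of_self (folnerW θ F) h (folnerW_self h0 h1 x) hδ] with y hy
  exact hf F h0 h1 y x hy

/-- What the theory needs to know about a class of averaging sequences. -/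
structure IsAveragingClass (X : Type*) [MetricSpace X] [CompactSpace X] [MulAction G X]
    [ContinuousSMul G X] (θ : Measure G) (P : (ℕ → Set G) → Prop) : Prop where
  ne_zero : ∀ F, P F → ∀ n, θ (F n) ≠ 0
  ne_top : ∀ F, P F → ∀ n, θ (F n) ≠ ⊤
  asymptoticallyInvariant : ∀ F, P F → AsymptoticallyInvariant X θ F
  translate : ∀ F, P F → ∀ c : ℕ → G, P fun n => (fun h => h * c n) '' F n
  avgOp_translate : ∀ F, P F → ∀ n (c : G) (f : C(X, ℝ)) x,
    avgOp X θ ((fun h => h * c) '' F n) f x = avgOp X θ (F n) f (c • x)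
  nonempty : ∃ F, P F

variable {P : (ℕ → Set G) → Prop}

/-- The uniform bound by the diameter is needed because a real supremum over an unbounded family
takes the default value `0`. -/
theorem folnerW_le_supW (hP : IsAveragingClass X θ P) (hF : P F) (x y : X) :
    folnerW θ F x y ≤ supW θ P x y :=
  le_ciSup (f := fun F : {F : ℕ → Set G // P F} => folnerW θ F.1 x y)
    ⟨Metric.diam (Set.univ : Set X), by
      rintro _ ⟨F, rfl⟩
      exact folnerW_le_diam (hP.ne_zero _ F.2) (hP.ne_top _ F.2) x y⟩ ⟨F, hF⟩

theorem supW_self (hP : IsAveragingClass X θ P) (x : X) : supW θ P x x = 0 := by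
  have : ∀ F : {F : ℕ → Set G // P F}, folnerW θ F.1 x x = 0 := fun F =>
    folnerW_self (hP.ne_zero _ F.2) (hP.ne_top _ F.2) x
  simp [supW, this]

/-- The neighbourhood of `x` is chosen before `F`; only the time from which the estimate holds may
depend on `F`. -/
theorem WeaklyMeanEquicontinuous.eventually_forall (hP : IsAveragingClass X θ P)
    (h : WeaklyMeanEquicontinuous X θ P) (f : C(X, ℝ)) {ε : ℝ} (hε : 0 < ε) (x : X) :
    ∀ᶠ y in 𝓝 x, ∀ F, P F → ∀ᶠ n in atTop,
      |avgOp X θ (F n) f y - avgOp X θ (F n) f x| < ε := by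
  obtain ⟨δ, hδ, hf⟩ := exists_forall_eventually_of_folnerW_lt (θ := θ) f hε
  filter_upwards [eventually_lt_of_continuous_of_self (supW θ P) h (supW_self hP x) hδ] with y hy F hF
  exact hf F (hP.ne_zero F hF) (hP.ne_top F hF) y x ((folnerW_le_supW hP hF y x).trans_lt hy)

theorem support_subset_of_measure_eq_one {ν : ProbabilityMeasure X} {Y : Set X} (hY : IsClosed Y)
    (h : (ν : Measure X) Y = 1) : (ν : Measure X).support ⊆ Y :=
  Measure.support_subset_of_isClosed hY ((mem_ae_iff_prob_eq_one hY.measurableSet).2 h)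

/-- The mean ergodic theorem gives convergence only on supports of invariant measures. A point `z`
of such a support lies in the orbit closure of `x`, and equicontinuity at `z`, uniform over the
class, transfers convergence to the whole orbit of `x`. -/
theorem WeaklyMeanEquicontinuous.continuouslyUniquelyErgodic [IsTopologicalGroup G]
    (hG : IsAmenable G) (hP : IsAveragingClass X θ P)
    (h : WeaklyMeanEquicontinuous X θ P) : ContinuouslyUniquelyErgodic G X := by
  obtain ⟨F, hF⟩ := hP.nonempty
  have h0 := hP.ne_zero F hF
  have h1 := hP.ne_top F hF
  have hE : AsymptoticallyEquicontinuous X θ F := fun f ε hε x =>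
    (h.eventually_forall hP f hε x).mono fun y hy => hy F hF
  have key : ∀ (f : C(X, ℝ)) (x : X), ∃ c, ∀ g : G,
      Tendsto (fun n => avgOp X θ (F n) f (g • x)) atTop (𝓝 c) := by
    intro f x
    obtain ⟨ν, hν, hνx⟩ := exists_invariant_on_orbitClosure hG x
    obtain ⟨z, hz⟩ := Measure.nonempty_support (μ := (ν : Measure X))
      (IsProbabilityMeasure.ne_zero _)
    have hzx := support_subset_of_measure_eq_one isClosed_closure hνx hz
    obtain ⟨c, hc⟩ := (hP.asymptoticallyInvariant F hF).exists_tendsto_of_mem_support h0 h1 hE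
      (ν : Measure X) f hz
    refine ⟨c, fun g => Metric.tendsto_atTop'.2 fun ε hε => ?_⟩
    obtain ⟨_, hy, k, rfl⟩ := mem_closure_iff_nhds.1 hzx _
      (h.eventually_forall hP f (half_pos hε) z)
    -- The points `k • x` and `z` are compared along the sequence translated by `g * k⁻¹`, that is,
    -- `g • x` and `(g * k⁻¹) • z` along `F`. The averages at the latter tend to `c`, whatever the
    -- group element.
    have h2 := hy _ (hP.translate F hF fun _ => g * k⁻¹)
    simp only [hP.avgOp_translate F hF, mul_smul, inv_smul_smul] at h2
    have h3 := hc (g * k⁻¹)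
    simp only [mul_smul] at h3
    rw [Metric.tendsto_nhds] at h3
    obtain ⟨N, hN⟩ := eventually_atTop.1 (h2.and (h3 _ (half_pos hε)))
    refine ⟨N, fun n hn => ?_⟩
    obtain ⟨h4, h5⟩ := hN n hn.le
    rw [← Real.dist_eq] at h4
    exact (dist_triangle _ _ _).trans_lt (by linarith)
  refine continuouslyUniquelyErgodic_of_tendsto hG h0 h1 fun f => ?_
  choose φ hφ using key f
  have hφ1 : ∀ x, Tendsto (fun n => avgOp X θ (F n) f x) atTop (𝓝 (φ x)) := fun x => by
    simpa using hφ x 1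
  exact ⟨⟨φ, hE.continuous_of_tendsto hφ1⟩,
    fun g x => tendsto_nhds_unique (hφ1 (g • x)) (hφ x g), hφ1⟩

/-- Full support makes every point a support point, so no transfer along orbits is needed and one
sequence is enough. -/
theorem FolnerWeaklyMeanEquicontinuous.continuouslyUniquelyErgodic [IsTopologicalGroup G]
    (hG : IsAmenable G) (h0 : ∀ n, θ (F n) ≠ 0) (h1 : ∀ n, θ (F n) ≠ ⊤)
    (hF : AsymptoticallyInvariant X θ F) (h : FolnerWeaklyMeanEquicontinuous X θ F)
    (hX : HasFullySupportedInvariantMeasure G X) : ContinuouslyUniquelyErgodic G X := by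
  obtain ⟨ν, hν, hsupp⟩ := hX
  have hE := h.asymptoticallyEquicontinuous h0 h1
  refine continuouslyUniquelyErgodic_of_tendsto hG h0 h1 fun f => ?_
  have key := fun x : X => hF.exists_tendsto_of_mem_support h0 h1 hE (ν : Measure X) f
    (x := x) (by rw [hsupp]; trivial)
  choose φ hφ using key
  have hφ1 : ∀ x, Tendsto (fun n => avgOp X θ (F n) f x) atTop (𝓝 (φ x)) := fun x => by
    simpa using hφ x 1
  exact ⟨⟨φ, hE.continuous_of_tendsto hφ1⟩,
    fun g x => tendsto_nhds_unique (hφ1 (g • x)) (hφ x g), hφ1⟩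

/-- If translating the point does not change the averages asymptotically, then asymptotic
equicontinuity implies continuous unique ergodicity. -/
theorem AsymptoticallyEquicontinuous.continuouslyUniquelyErgodic [IsTopologicalGroup G]
    (hG : IsAmenable G) (h0 : ∀ n, θ (F n) ≠ 0) (h1 : ∀ n, θ (F n) ≠ ⊤)
    (hE : AsymptoticallyEquicontinuous X θ F)
    (hF : ∀ (f : C(X, ℝ)) (g : G) x, Tendsto
      (fun n => avgOp X θ (F n) f (g • x) - avgOp X θ (F n) f x) atTop (𝓝 0)) :
    ContinuouslyUniquelyErgodic G X := by
  refine continuouslyUniquelyErgodic_of_tendsto hG h0 h1 fun f => ?_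
  -- Asymptotic agreement along the orbit extends to its closure by equicontinuity at the limit
  -- point `y`.
  have hcl : ∀ x, ∀ y ∈ closure (MulAction.orbit G x), Tendsto
      (fun n => avgOp X θ (F n) f y - avgOp X θ (F n) f x) atTop (𝓝 0) := by
    intro x y hy
    refine Metric.tendsto_atTop'.2 fun ε hε => ?_
    obtain ⟨_, hz, g, rfl⟩ := mem_closure_iff_nhds.1 hy _ (hE f (ε / 2) (half_pos hε) y)
    have h2 := Metric.tendsto_nhds.1 (hF f g x) _ (half_pos hε)
    obtain ⟨N, hN⟩ := eventually_atTop.1 (hz.and h2)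
    refine ⟨N, fun n hn => ?_⟩
    obtain ⟨h3, h4⟩ := hN n hn.le
    rw [Real.dist_eq, sub_zero] at h4 ⊢
    have h3 := abs_lt.1 h3
    have h4 := abs_lt.1 h4
    simp only at h3 h4
    rw [abs_lt]
    constructor <;> linarith [h3.1, h3.2, h4.1, h4.2]
  have key : ∀ x, ∃ c, Tendsto (fun n => avgOp X θ (F n) f x) atTop (𝓝 c) := by
    intro x
    obtain ⟨ν, hν, hνx⟩ := exists_invariant_on_orbitClosure hG x
    refine ⟨∫ y, f y ∂(ν : Measure X), ?_⟩
    have hae : ∀ᵐ y ∂(ν : Measure X), y ∈ closure (MulAction.orbit G x) :=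
      (mem_ae_iff_prob_eq_one isClosed_closure.measurableSet).2 hνx
    -- Integrating the agreement over `ν` replaces the average at `y` by the constant `∫ f dν`,
    -- which is therefore the limit of the averages at `x`.
    have t : Tendsto (fun n => ∫ y, (avgOp X θ (F n) f y - avgOp X θ (F n) f x) ∂(ν : Measure X))
        atTop (𝓝 (∫ y, (0 : ℝ) ∂(ν : Measure X))) := by
      refine tendsto_integral_of_dominated_convergence (fun _ => ‖f‖ + ‖f‖)
        (fun n => ((avgOp X θ (F n) f).continuous.sub continuous_const).aestronglyMeasurable)
        (integrable_const _) (fun n => ae_of_all _ fun y => ?_) (hae.mono (hcl x))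
      exact (abs_sub _ _).trans (add_le_add (abs_avgOp_le _ _ _ _) (abs_avgOp_le _ _ _ _))
    have e : ∀ n, ∫ y, (avgOp X θ (F n) f y - avgOp X θ (F n) f x) ∂(ν : Measure X) =
        ∫ y, f y ∂(ν : Measure X) - avgOp X θ (F n) f x := by
      intro n
      rw [integral_sub (integrable_continuousMap _ _) (integrable_const _),
        integral_avgOp (h0 n) (h1 n)]
      simp
    simp only [e, integral_zero] at t
    simpa using (tendsto_const_nhds (x := ∫ y, f y ∂(ν : Measure X))).sub t
  choose φ hφ using key
  refine ⟨⟨φ, hE.continuous_of_tendsto hφ⟩, fun g x => ?_, hφ⟩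
  exact sub_eq_zero.1 (tendsto_nhds_unique ((hφ (g • x)).sub (hφ x)) (hF f g x))

/-- Translating `F n` by `g` for odd `n` only gives a sequence of the class whose averages at `x`
are those of `F` at `x` and at `g • x` alternately. Its convergence forces the two limits to
coincide. -/
theorem AveragesConverge.continuouslyUniquelyErgodic [IsTopologicalGroup G]
    (hG : IsAmenable G) (hP : IsAveragingClass X θ P) (h : AveragesConverge X θ P) :
    ContinuouslyUniquelyErgodic G X := by
  obtain ⟨F, hF⟩ := hP.nonempty
  obtain ⟨S, hS⟩ := h F hF
  have hpt : ∀ {S : C(X, ℝ) →L[ℝ] C(X, ℝ)} {F : ℕ → Set G} {f : C(X, ℝ)},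
      Tendsto (fun n => avgOp X θ (F n) f) atTop (𝓝 (S f)) → ∀ x,
      Tendsto (fun n => avgOp X θ (F n) f x) atTop (𝓝 (S f x)) := fun h x =>
    ((continuous_eval_const x).tendsto _).comp h
  refine continuouslyUniquelyErgodic_of_tendsto hG (hP.ne_zero F hF) (hP.ne_top F hF)
    fun f => ⟨S f, fun g x => ?_, hpt (hS f)⟩
  obtain ⟨T, hT⟩ := h _ (hP.translate F hF fun n => if Even n then 1 else g)
  have t := hpt (hT f) x
  simp only [hP.avgOp_translate F hF] at t
  have he : Tendsto (fun n : ℕ => 2 * n) atTop atTop :=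
    tendsto_atTop_mono (fun n => by simp only [id]; omega) tendsto_id
  have ho : Tendsto (fun n : ℕ => 2 * n + 1) atTop atTop :=
    tendsto_atTop_mono (fun n => by simp only [id]; omega) tendsto_id
  have t1 := tendsto_nhds_unique (t.comp he) (by
    have := (hpt (hS f) x).comp he
    simpa [Function.comp_def] using this)
  have t2 := tendsto_nhds_unique (t.comp ho) (by
    have := (hpt (hS f) (g • x)).comp ho
    simpa [Function.comp_def] using this)
  rw [← t1, ← t2]

theorem ContinuouslyUniquelyErgodic.averagesConverge (hP : IsAveragingClass X θ P)
    (h : ContinuouslyUniquelyErgodic G X) : AveragesConverge X θ P := by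
  obtain ⟨μ, hμ, hu⟩ := h
  intro F hF
  obtain ⟨S, -, hS⟩ := ContinuouslyUniquelyErgodic.tendsto_avgOp hμ (fun x => (hu x).1)
    (hP.ne_zero F hF) (hP.ne_top F hF) (hP.asymptoticallyInvariant F hF)
  exact ⟨S, hS⟩

end Classes

/-! ### Kantorovich–Rubinstein duality and weak continuity of the Wasserstein distance -/

section Duality

variable {X : Type*} [MetricSpace X] [CompactSpace X] [MeasurableSpace X] [BorelSpace X]

/-- Weak duality in the Kantorovich problem, for nonnegative potentials. -/
theorem integral_add_nonneg_of_forall_lipschitz {μ ν : Measure X} [IsProbabilityMeasure μ]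
    [IsProbabilityMeasure ν] {κ : ℝ}
    (hκ : ∀ u : C(X, ℝ), LipschitzWith 1 u → ∫ x, u x ∂μ - ∫ x, u x ∂ν ≤ κ)
    {φ ψ : C(X, ℝ)} {t : ℝ} (ht : 0 ≤ t) (h : ∀ x y, 0 ≤ φ x + ψ y + t * dist x y) :
    0 ≤ ∫ x, φ x ∂μ + ∫ x, ψ x ∂ν + t * κ := by
  have hX : Nonempty X := nonempty_of_isProbabilityMeasure μ
  -- For `t = 0` integrate in both variables. For `t > 0` the inf-convolution of `ψ / t` with the
  -- distance is 1-Lipschitz and lies between `-φ / t` and `ψ / t`, so the hypothesis on Lipschitz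
  -- functions applies to it.
  rcases ht.eq_or_lt with rfl | ht
  · have h1 : ∀ y, 0 ≤ ∫ x, φ x ∂μ + ψ y := by
      intro y
      have : 0 ≤ ∫ x, (φ x + ψ y) ∂μ := integral_nonneg fun x => by simpa using h x y
      rw [integral_add (integrable_continuousMap μ φ) (integrable_const _)] at this
      simpa using this
    have : 0 ≤ ∫ y, (∫ x, φ x ∂μ + ψ y) ∂ν := integral_nonneg h1
    rw [integral_add (integrable_const _) (integrable_continuousMap ν ψ)] at this
    simpa using this
  · have hbdd : ∀ x, BddBelow (Set.range fun y => ψ y / t + dist x y) := by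
      refine fun x => ⟨-‖ψ‖ / t, ?_⟩
      rintro _ ⟨y, rfl⟩
      have h1 : -‖ψ‖ / t ≤ ψ y / t := by
        gcongr
        exact (abs_le.1 (ψ.norm_coe_le_norm y)).1
      linarith [dist_nonneg (x := x) (y := y)]
    let u₀ : X → ℝ := fun x => ⨅ y, (ψ y / t + dist x y)
    have hlip : LipschitzWith 1 u₀ := by
      refine LipschitzWith.of_le_add fun x x' => ?_
      rw [← sub_le_iff_le_add]
      refine le_ciInf fun y => ?_
      have := ciInf_le (hbdd x) y
      have h3 := dist_triangle x x' y
      change u₀ x ≤ _ at this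
      linarith
    let u : C(X, ℝ) := ⟨u₀, hlip.continuous⟩
    have hu1 : ∀ x, -(φ x / t) ≤ u x := by
      refine fun x => le_ciInf fun y => ?_
      have := div_nonneg (h x y) ht.le
      rw [add_div, add_div, mul_div_cancel_left₀ _ ht.ne'] at this
      linarith
    have hu2 : ∀ y, u y ≤ ψ y / t := fun y => by
      have := ciInf_le (hbdd y) y
      simp only [dist_self, add_zero] at this
      exact this
    have h1 : -((∫ x, φ x ∂μ) / t) ≤ ∫ x, u x ∂μ := by
      rw [← integral_div, ← integral_neg]
      exact integral_mono ((integrable_continuousMap μ φ).div_const t).neg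
        (integrable_continuousMap μ u) hu1
    have h2 : ∫ x, u x ∂ν ≤ (∫ x, ψ x ∂ν) / t := by
      rw [← integral_div]
      exact integral_mono (integrable_continuousMap ν u)
        ((integrable_continuousMap ν ψ).div_const t) hu2
    have h3 := hκ u hlip
    have h4 : 0 ≤ (∫ x, φ x ∂μ) / t + (∫ x, ψ x ∂ν) / t + κ := by linarith
    have h5 := mul_nonneg ht.le h4
    have h6 : t * ((∫ x, φ x ∂μ) / t + (∫ x, ψ x ∂ν) / t + κ) =
        ∫ x, φ x ∂μ + ∫ x, ψ x ∂ν + t * κ := by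
      field_simp
    rwa [h6] at h5

/-- The hard half of Kantorovich–Rubinstein duality. -/
theorem wasserstein_le_of_forall_lipschitz (μ ν : Measure X) [IsProbabilityMeasure μ]
    [IsProbabilityMeasure ν] {κ : ℝ}
    (hκ : ∀ u : C(X, ℝ), LipschitzWith 1 u → ∫ x, u x ∂μ - ∫ x, u x ∂ν ≤ κ) :
    wasserstein μ ν ≤ κ := by
  -- Costs of dominating `h` by marginal potentials plus a multiple of the distance, priced at `κ`.
  -- The infimum `N` is sublinear, and a linear functional below `N` automatically is positive, has
  -- marginals `μ` and `ν`, and gives the distance a value of at most `κ`.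
  let A : C(X × X, ℝ) → Set ℝ := fun h => {r | ∃ (φ ψ : C(X, ℝ)) (t : ℝ), 0 ≤ t ∧
    (∀ x y, h (x, y) ≤ φ x + ψ y + t * dist x y) ∧ r = ∫ x, φ x ∂μ + ∫ x, ψ x ∂ν + t * κ}
  have hbdd : ∀ h, BddBelow (A h) := by
    refine fun h => ⟨-‖h‖, ?_⟩
    rintro r ⟨φ, ψ, t, ht, hle, rfl⟩
    have := integral_add_nonneg_of_forall_lipschitz hκ (φ := φ)
      (ψ := ψ + ContinuousMap.const X ‖h‖) ht (fun x y => by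
        have h1 := hle x y
        have h2 := (abs_le.1 (h.norm_coe_le_norm (x, y))).1
        simp only [ContinuousMap.add_apply, ContinuousMap.const_apply]
        linarith)
    simp only [ContinuousMap.add_apply, ContinuousMap.const_apply] at this
    rw [integral_add (integrable_continuousMap ν ψ) (integrable_const _)] at this
    simp only [integral_const, probReal_univ, smul_eq_mul, one_mul] at this
    linarith
  have hne : ∀ h, (A h).Nonempty := fun h =>
    ⟨_, ContinuousMap.const X ‖h‖, 0, 0, le_rfl, fun x y => by
      simpa using (abs_le.1 (h.norm_coe_le_norm (x, y))).2, rfl⟩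
  let N : C(X × X, ℝ) → ℝ := fun h => sInf (A h)
  have hN : ∀ h (φ ψ : C(X, ℝ)) (t : ℝ), 0 ≤ t →
      (∀ x y, h (x, y) ≤ φ x + ψ y + t * dist x y) →
      N h ≤ ∫ x, φ x ∂μ + ∫ x, ψ x ∂ν + t * κ := fun h φ ψ t ht hle =>
    csInf_le (hbdd h) ⟨φ, ψ, t, ht, hle, rfl⟩
  have hsmul : ∀ c : ℝ, 0 < c → ∀ h, N (c • h) ≤ c * N h := by
    intro c hc h
    rw [← div_le_iff₀' hc]
    refine le_csInf (hne h) ?_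
    rintro r ⟨φ, ψ, t, ht, hle, rfl⟩
    rw [div_le_iff₀' hc]
    refine (hN (c • h) (c • φ) (c • ψ) (c * t) (by positivity) fun x y => ?_).trans_eq ?_
    · have := mul_le_mul_of_nonneg_left (hle x y) hc.le
      simp only [ContinuousMap.smul_apply, smul_eq_mul]
      linarith
    · simp only [ContinuousMap.smul_apply, smul_eq_mul, integral_const_mul]
      ring
  have hsmul' : ∀ c : ℝ, 0 < c → ∀ h, N (c • h) = c * N h := by
    intro c hc h
    refine le_antisymm (hsmul c hc h) ?_
    have := hsmul c⁻¹ (by positivity) (c • h)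
    rw [smul_smul, inv_mul_cancel₀ hc.ne', one_smul, ← div_eq_inv_mul, le_div_iff₀' hc] at this
    exact this
  have hadd : ∀ h k, N (h + k) ≤ N h + N k := by
    intro h k
    rw [← sub_le_iff_le_add]
    refine le_csInf (hne h) ?_
    rintro r ⟨φ, ψ, t, ht, hle, rfl⟩
    rw [sub_le_comm]
    refine le_csInf (hne k) ?_
    rintro r ⟨φ', ψ', t', ht', hle', rfl⟩
    rw [sub_le_iff_le_add]
    refine (hN (h + k) (φ + φ') (ψ + ψ') (t + t') (by positivity) fun x y => ?_).trans_eq ?_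
    · have h1 := hle x y
      have h2 := hle' x y
      simp only [ContinuousMap.add_apply]
      linarith
    · simp only [ContinuousMap.add_apply]
      rw [integral_add (integrable_continuousMap μ φ) (integrable_continuousMap μ φ'),
        integral_add (integrable_continuousMap ν ψ) (integrable_continuousMap ν ψ')]
      ring
  have hzero : 0 ≤ N 0 := by
    refine le_csInf (hne 0) ?_
    rintro r ⟨φ, ψ, t, ht, hle, rfl⟩
    exact integral_add_nonneg_of_forall_lipschitz hκ ht hle
  -- Hahn–Banach from the zero subspace; the only thing to check there is `0 ≤ N 0`, which is weak
  -- duality.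
  obtain ⟨L, -, hL⟩ := exists_extension_of_le_sublinear (⊥ : C(X × X, ℝ) →ₗ.[ℝ] ℝ) N hsmul' hadd
    (by
      rintro ⟨x, hx⟩
      have hx0 : x = 0 := hx
      subst hx0
      have : (⟨0, hx⟩ : (⊥ : C(X × X, ℝ) →ₗ.[ℝ] ℝ).domain) = 0 := rfl
      rw [this, LinearPMap.map_zero]
      exact hzero)
  have hLpos : ∀ h, 0 ≤ h → 0 ≤ L h := by
    intro h hh
    have h1 := (hL (-h)).trans (hN (-h) 0 0 0 le_rfl fun x y => by simpa using hh (x, y))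
    simp only [map_neg, ContinuousMap.zero_apply, integral_zero, zero_mul, add_zero] at h1
    linarith
  let J : C(X, ℝ) → C(X, ℝ) → C(X × X, ℝ) := fun φ ψ =>
    φ.comp ContinuousMap.fst + ψ.comp ContinuousMap.snd
  have hJ : ∀ φ ψ, L (J φ ψ) = ∫ x, φ x ∂μ + ∫ x, ψ x ∂ν := by
    have hle : ∀ φ ψ, L (J φ ψ) ≤ ∫ x, φ x ∂μ + ∫ x, ψ x ∂ν := by
      intro φ ψ
      refine (hL _).trans ((hN _ φ ψ 0 le_rfl fun x y => ?_).trans_eq (by simp))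
      simp [J]
    intro φ ψ
    refine le_antisymm (hle φ ψ) ?_
    have h1 := hle (-φ) (-ψ)
    have h2 : J (-φ) (-ψ) = -J φ ψ := by
      ext p
      simp [J]
      ring
    rw [h2, map_neg] at h1
    simp only [ContinuousMap.neg_apply, integral_neg] at h1
    linarith
  obtain ⟨ι, hι⟩ := exists_probabilityMeasure_of_functional L hLpos (by
    have : (1 : C(X × X, ℝ)) = J 1 0 := by ext p; simp [J]
    rw [this, hJ]
    simp)
  have hmem : (ι : Measure (X × X)) ∈ joinings μ ν := by
    refine ⟨inferInstance, ?_, ?_⟩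
    · have := Measure.isProbabilityMeasure_map (μ := (ι : Measure (X × X)))
        measurable_fst.aemeasurable
      refine measure_ext_of_integral_continuousMap fun f => ?_
      rw [integral_map measurable_fst.aemeasurable f.continuous.aestronglyMeasurable]
      have := (hι (J f 0)).trans (hJ f 0)
      simpa [J] using this
    · have := Measure.isProbabilityMeasure_map (μ := (ι : Measure (X × X)))
        measurable_snd.aemeasurable
      refine measure_ext_of_integral_continuousMap fun f => ?_
      rw [integral_map measurable_snd.aemeasurable f.continuous.aestronglyMeasurable]
      have := (hι (J 0 f)).trans (hJ 0 f)
      simpa [J] using this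
  refine (wasserstein_le hmem).trans ?_
  have h1 := hι ⟨fun p => dist p.1 p.2, continuous_dist⟩
  simp only [ContinuousMap.coe_mk] at h1
  rw [h1]
  refine (hL _).trans ((hN _ 0 0 1 zero_le_one fun x y => ?_).trans_eq (by simp))
  simp

/-- The normalized Lipschitz functions. -/
def lipschitzFunctions (x₀ : X) : Set (X →ᵇ ℝ) := {f | LipschitzWith 1 f ∧ f x₀ = 0}

/-- By Arzelà–Ascoli: vanishing at `x₀` bounds the functions by the diameter. This normalization is
harmless in the duality, since differences of integrals of probability measures ignore constants. -/
theorem isCompact_lipschitzFunctions (x₀ : X) : IsCompact (lipschitzFunctions x₀) := by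
  refine BoundedContinuousFunction.arzela_ascoli₂
    (Set.Icc (-Metric.diam (Set.univ : Set X)) (Metric.diam (Set.univ : Set X))) isCompact_Icc
    _ ?_ ?_ ?_
  · have : lipschitzFunctions x₀ =
        (⋂ (x) (y), {f : X →ᵇ ℝ | dist (f x) (f y) ≤ dist x y}) ∩ {f | f x₀ = 0} := by
      ext f
      simp [lipschitzFunctions, lipschitzWith_iff_dist_le_mul]
    rw [this]
    refine (isClosed_iInter fun x => isClosed_iInter fun y => ?_).inter ?_
    · exact isClosed_le ((continuous_eval_const x).dist (continuous_eval_const y)) continuous_const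
    · exact isClosed_eq (continuous_eval_const x₀) continuous_const
  · intro f x hf
    have h1 := hf.1.dist_le_mul x x₀
    have h2 := Metric.dist_le_diam_of_mem isCompact_univ.isBounded (Set.mem_univ x)
      (Set.mem_univ x₀)
    rw [hf.2, Real.dist_eq, sub_zero, NNReal.coe_one, one_mul] at h1
    exact abs_le.1 (h1.trans h2)
  · refine Metric.equicontinuous_of_continuity_modulus (fun r => r) tendsto_id _ ?_
    intro x y f
    simpa using f.2.1.dist_le_mul x y

theorem integral_sub_le_wasserstein (μ ν : Measure X) [IsProbabilityMeasure μ]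
    [IsProbabilityMeasure ν] {f : C(X, ℝ)} (hf : LipschitzWith 1 f) :
    ∫ x, f x ∂μ - ∫ x, f x ∂ν ≤ wasserstein μ ν := by
  refine le_csInf ⟨_, _, prod_mem_joinings μ ν, rfl⟩ ?_
  rintro _ ⟨ι, hι, rfl⟩
  have := hι.1
  rw [integral_sub_integral_of_joining hι]
  refine integral_mono ?_ (integrable_dist_of_finite ι) fun p => ?_
  · exact (by fun_prop : Continuous fun p : X × X => f p.1 - f p.2).integrable_of_hasCompactSupport
      (HasCompactSupport.of_compactSpace _)
  · have := hf.dist_le_mul p.1 p.2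
    rw [Real.dist_eq, NNReal.coe_one, one_mul] at this
    exact (le_abs_self _).trans this

/-- Kantorovich–Rubinstein duality. -/
theorem wasserstein_eq_sSup (x₀ : X) (μ ν : ProbabilityMeasure X) :
    wasserstein (μ : Measure X) (ν : Measure X) =
      sSup ((fun f : X →ᵇ ℝ => ∫ x, f x ∂(μ : Measure X) - ∫ x, f x ∂(ν : Measure X)) ''
        lipschitzFunctions x₀) := by
  have hub : ∀ f ∈ lipschitzFunctions x₀, ∫ x, f x ∂(μ : Measure X) - ∫ x, f x ∂(ν : Measure X) ≤
      wasserstein (μ : Measure X) (ν : Measure X) := fun f hf =>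
    integral_sub_le_wasserstein _ _ (f := f.toContinuousMap) hf.1
  refine le_antisymm ?_ (csSup_le (Set.Nonempty.image _ ⟨0, ?_, rfl⟩) ?_)
  · refine wasserstein_le_of_forall_lipschitz _ _ fun u hu => ?_
    refine le_csSup ⟨_, by rintro _ ⟨f, hf, rfl⟩; exact hub f hf⟩
      ⟨BoundedContinuousFunction.mkOfCompact (u - ContinuousMap.const X (u x₀)), ⟨?_, ?_⟩, ?_⟩
    · refine LipschitzWith.of_dist_le_mul fun x y => ?_
      simpa [Real.dist_eq] using hu.dist_le_mul x y
    · simp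
    · simp only [BoundedContinuousFunction.mkOfCompact_apply, ContinuousMap.sub_apply,
        ContinuousMap.const_apply]
      rw [integral_sub (integrable_continuousMap _ u) (integrable_const _),
        integral_sub (integrable_continuousMap _ u) (integrable_const _)]
      simp
  · exact LipschitzWith.const' 0
  · rintro _ ⟨f, hf, rfl⟩
    exact hub f hf

/-- Weak convergence handles a fixed integrand, and changing the integrand costs at most its
sup-norm, uniformly over probability measures. -/
theorem continuous_integral_probabilityMeasure :
    Continuous fun p : ProbabilityMeasure X × (X →ᵇ ℝ) => ∫ x, p.2 x ∂(p.1 : Measure X) := by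
  rw [continuous_iff_continuousAt]
  rintro ⟨μ, f⟩
  have h1 : Tendsto (fun p : ProbabilityMeasure X × (X →ᵇ ℝ) => ∫ x, f x ∂(p.1 : Measure X))
      (𝓝 (μ, f)) (𝓝 (∫ x, f x ∂(μ : Measure X))) :=
    (ProbabilityMeasure.tendsto_iff_forall_integral_tendsto.1 (tendsto_id (x := 𝓝 μ)) f).comp
      (continuous_fst.tendsto (μ, f))
  have h2 : Tendsto (fun p : ProbabilityMeasure X × (X →ᵇ ℝ) =>
      ∫ x, p.2 x ∂(p.1 : Measure X) - ∫ x, f x ∂(p.1 : Measure X)) (𝓝 (μ, f)) (𝓝 0) := by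
    have h3 : Tendsto (fun p : ProbabilityMeasure X × (X →ᵇ ℝ) => ‖p.2 - f‖) (𝓝 (μ, f)) (𝓝 0) := by
      have : Continuous fun p : ProbabilityMeasure X × (X →ᵇ ℝ) => ‖p.2 - f‖ := by fun_prop
      simpa using this.tendsto (μ, f)
    refine squeeze_zero_norm (fun p => ?_) h3
    rw [← integral_sub (p.2.integrable _) (f.integrable _)]
    refine (norm_integral_le_of_norm_le_const (C := ‖p.2 - f‖)
      (ae_of_all _ fun x => (p.2 - f).norm_coe_le_norm x)).trans_eq ?_
    simp
  simpa [ContinuousAt] using h2.add h1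

/-- By duality, a supremum over a compact set of jointly continuous functions. -/
theorem continuous_wasserstein :
    Continuous fun p : ProbabilityMeasure X × ProbabilityMeasure X =>
      wasserstein (p.1 : Measure X) (p.2 : Measure X) := by
  rcases isEmpty_or_nonempty X with hX | ⟨⟨x₀⟩⟩
  · refine continuous_iff_continuousAt.2 fun p => ?_
    exact (hX.false (nonempty_of_isProbabilityMeasure (p.1 : Measure X)).some).elim
  simp only [wasserstein_eq_sSup x₀]
  refine (isCompact_lipschitzFunctions x₀).continuous_sSup ?_
  exact (continuous_integral_probabilityMeasure.comp
      (by fun_prop : Continuous fun q : (ProbabilityMeasure X × ProbabilityMeasure X) × (X →ᵇ ℝ) =>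
        (q.1.1, q.2))).sub
    (continuous_integral_probabilityMeasure.comp
      (by fun_prop : Continuous fun q : (ProbabilityMeasure X × ProbabilityMeasure X) × (X →ᵇ ℝ) =>
        (q.1.2, q.2)))

end Duality

/-! ### The equivalence for an abstract averaging class -/

section Equivalence

variable {G : Type*} [Group G] [TopologicalSpace G] [MeasurableSpace G] [BorelSpace G]
variable {X : Type*} [MetricSpace X] [CompactSpace X] [MulAction G X] [ContinuousSMul G X]
variable [MeasurableSpace X] [BorelSpace X] {θ : Measure G} {P : (ℕ → Set G) → Prop}

/-- The empirical measures along any `F` converge weakly to `μ x`, so `𝒲_F` is the distance of `μ x`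
and `μ y` for every `F`, and the supremum is over a constant family. -/
theorem ContinuouslyUniquelyErgodic.weaklyMeanEquicontinuous (hP : IsAveragingClass X θ P)
    (h : ContinuouslyUniquelyErgodic G X) : WeaklyMeanEquicontinuous X θ P := by
  obtain ⟨μ, hμ, hu⟩ := h
  have key : ∀ F, P F → ∀ x y,
      folnerW θ F x y = wasserstein (μ x : Measure X) (μ y : Measure X) := by
    intro F hF x y
    obtain ⟨S, hS, hlim⟩ := ContinuouslyUniquelyErgodic.tendsto_avgOp hμ (fun x => (hu x).1)
      (hP.ne_zero F hF) (hP.ne_top F hF) (hP.asymptoticallyInvariant F hF)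
    let m : X → ℕ → ProbabilityMeasure X := fun x n =>
      ⟨orbitMeasure θ (F n) x,
        isProbabilityMeasure_orbitMeasure (hP.ne_zero F hF n) (hP.ne_top F hF n) x⟩
    have hm : ∀ x, Tendsto (m x) atTop (𝓝 (μ x)) := by
      intro x
      refine ProbabilityMeasure.tendsto_iff_forall_integral_tendsto.2 fun f => ?_
      have h1 := ((continuous_eval_const x).tendsto _).comp (hlim f.toContinuousMap)
      rw [hS] at h1
      refine h1.congr fun n => ?_
      exact (integral_orbitMeasure θ (F n) x f.toContinuousMap).symm
    exact ((continuous_wasserstein.tendsto (μ x, μ y)).comp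
      ((hm x).prodMk_nhds (hm y))).limsup_eq
  have hsup : ∀ x y, supW θ P x y = wasserstein (μ x : Measure X) (μ y : Measure X) := by
    intro x y
    obtain ⟨F, hF⟩ := hP.nonempty
    have : Nonempty {F : ℕ → Set G // P F} := ⟨⟨F, hF⟩⟩
    have h1 : ∀ F : {F : ℕ → Set G // P F}, folnerW θ F.1 x y =
        wasserstein (μ x : Measure X) (μ y : Measure X) := fun F => key F.1 F.2 x y
    simp only [supW, h1]
    exact ciSup_const
  unfold WeaklyMeanEquicontinuous
  simp only [hsup]
  exact continuous_wasserstein.comp ((hμ.comp continuous_fst).prodMk (hμ.comp continuous_snd))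

theorem ContinuouslyUniquelyErgodic.all (hP : IsAveragingClass X θ P)
    (h : ContinuouslyUniquelyErgodic G X) :
    WeaklyMeanEquicontinuous X θ P ∧ ContinuouslyUniquelyErgodic G X ∧ AveragesConverge X θ P :=
  ⟨h.weaklyMeanEquicontinuous hP, h, h.averagesConverge hP⟩

theorem IsAveragingClass.tfae [IsTopologicalGroup G] (hG : IsAmenable G)
    (hP : IsAveragingClass X θ P) :
    List.TFAE [WeaklyMeanEquicontinuous X θ P, ContinuouslyUniquelyErgodic G X,
      AveragesConverge X θ P] := by
  tfae_have 1 → 2 := fun h => h.continuouslyUniquelyErgodic hG hP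
  tfae_have 2 → 3 := fun h => h.averagesConverge hP
  tfae_have 3 → 2 := fun h => h.continuouslyUniquelyErgodic hG hP
  tfae_have 2 → 1 := fun h => h.weaklyMeanEquicontinuous hP
  tfae_finish

end Equivalence

/-! ### Day's argument: finitely supported almost invariant probability measures -/

section Day

variable {G : Type*} [Group G] [TopologicalSpace G] [IsTopologicalGroup G]

/-- The element of `rucb G` given by a bounded right uniformly continuous function. -/
def rucbOf (F : G → ℝ) (C : ℝ) (hC : ∀ x, |F x| ≤ C)
    (hF : ∀ ε > 0, ∀ᶠ u in 𝓝 (1 : G), ∀ x, |F (u * x) - F x| < ε) : rucb G :=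
  ⟨BoundedContinuousFunction.ofNormedAddCommGroup F (by
    rw [continuous_iff_continuousAt]
    intro x
    refine Metric.tendsto_nhds.2 fun ε hε => ?_
    have h1 : Tendsto (fun y : G => y * x⁻¹) (𝓝 x) (𝓝 1) := by
      have : Continuous fun y : G => y * x⁻¹ := by fun_prop
      simpa using this.tendsto x
    filter_upwards [h1.eventually (hF ε hε)] with y hy
    simpa [Real.dist_eq] using hy x) C hC, hF⟩

/-- Left translation on `rucb G`. -/
def leftTranslate (g : G) (f : rucb G) : rucb G :=
  rucbOf (fun x => f.1 (g * x)) ‖f.1‖ (fun x => f.1.norm_coe_le_norm _) (by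
    intro ε hε
    have h1 : Tendsto (fun u : G => g * u * g⁻¹) (𝓝 1) (𝓝 1) := by
      have : Continuous fun u : G => g * u * g⁻¹ := by fun_prop
      simpa using this.tendsto 1
    filter_upwards [h1.eventually (f.2 ε hε)] with u hu x
    simpa [mul_assoc] using hu (g * x))

/-- Amenability yields finitely supported probability measures that are almost invariant,
uniformly on a given bounded and uniformly equicontinuous family of functions. -/
theorem IsAmenable.exists_almost_invariant (hG : IsAmenable G) {I : Type*} (f : I → G → ℝ) {C : ℝ}
    (hC : ∀ i x, |f i x| ≤ C)
    (hf : ∀ ε > 0, ∀ᶠ u in 𝓝 (1 : G), ∀ i x, |f i (u * x) - f i x| < ε)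
    (E : Finset G) {ε : ℝ} (hε : 0 < ε) :
    ∃ (ι : Type) (t : Finset ι) (w : ι → ℝ) (p : ι → G), (∀ j ∈ t, 0 ≤ w j) ∧ ∑ j ∈ t, w j = 1 ∧
      ∀ g ∈ E, ∀ i, |∑ j ∈ t, w j * (f i (g * p j) - f i (p j))| ≤ ε := by
  classical
  -- The discrete topology makes `I →ᵇ ℝ` the space of all bounded families, whose norm encodes
  -- uniformity in `i`.
  let tI : TopologicalSpace I := ⊥
  have : DiscreteTopology I := ⟨rfl⟩
  let b : G → (I →ᵇ ℝ) := fun x => BoundedContinuousFunction.ofNormedAddCommGroup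
    (fun i => f i x) continuous_of_discreteTopology C fun i => hC i x
  let a : G → (E → (I →ᵇ ℝ)) := fun x g => b (g * x) - b x
  by_cases h0 : (0 : E → (I →ᵇ ℝ)) ∈ closure (convexHull ℝ (Set.range a))
  · obtain ⟨v, hv, hvε⟩ := Metric.mem_closure_iff.1 h0 ε hε
    rw [convexHull_eq] at hv
    obtain ⟨ι, t, w, z, hw, hw1, hz, rfl⟩ := hv
    choose! p hp using hz
    refine ⟨ι, t, w, p, hw, hw1, fun g hg i => ?_⟩
    rw [Finset.centerMass_eq_of_sum_1 _ _ hw1, dist_zero_left] at hvε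
    have h1 : ‖(∑ j ∈ t, w j • z j) ⟨g, hg⟩‖ ≤ ε :=
      (norm_le_pi_norm _ _).trans hvε.le
    have h2 := ((∑ j ∈ t, w j • z j : E → (I →ᵇ ℝ)) ⟨g, hg⟩).norm_coe_le_norm i
    refine le_trans (le_of_eq ?_) (h2.trans h1)
    rw [Real.norm_eq_abs]
    congr 1
    rw [Finset.sum_apply, BoundedContinuousFunction.sum_apply]
    refine Finset.sum_congr rfl fun j hj => ?_
    rw [← hp j hj]
    rfl
  · exfalso
    obtain ⟨ℓ, u, hu0, hu⟩ := geometric_hahn_banach_point_closed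
      (convex_convexHull ℝ (Set.range a)).closure isClosed_closure h0
    rw [map_zero] at hu0
    have hlow : ∀ x, u < ℓ (a x) := fun x =>
      hu _ (subset_closure (subset_convexHull ℝ _ ⟨x, rfl⟩))
    have hnonneg : 0 ≤ C := by
      by_contra hCneg
      have : a 1 = 0 := by
        funext g
        ext i
        exact (hCneg ((abs_nonneg _).trans (hC i 1))).elim
      have h1 := hlow 1
      rw [this, map_zero] at h1
      exact absurd h1 (not_lt.2 hu0.le)
    have hsingle : ∀ (g : E) (v : I →ᵇ ℝ), |ℓ (Pi.single g v)| ≤ ‖ℓ‖ * ‖v‖ := by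
      intro g v
      refine (ℓ.le_opNorm _).trans ?_
      rw [Pi.norm_single]
    -- If zero is separated from the displacements `a x` by `ℓ`, the components of `ℓ` along the
    -- orbit `x ↦ b x` are right uniformly continuous. The sum of their displacements under `g ∈ E`
    -- exceeds a constant `u > 0`, although an invariant mean gives it the value zero.
    let F : E → rucb G := fun g => rucbOf (fun x => ℓ (Pi.single g (b x))) (‖ℓ‖ * C)
      (fun x => (hsingle g _).trans (mul_le_mul_of_nonneg_left
        (BoundedContinuousFunction.norm_ofNormedAddCommGroup_le _ hnonneg _)
        ℓ.opNorm_nonneg))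
      (by
        intro ε hε
        have hδ : 0 < ε / (‖ℓ‖ + 1) := by positivity
        filter_upwards [hf _ hδ] with u hu x
        rw [← map_sub, ← Pi.single_sub]
        refine (hsingle g _).trans_lt ?_
        have h1 : ‖b (u * x) - b x‖ ≤ ε / (‖ℓ‖ + 1) :=
          (BoundedContinuousFunction.norm_le hδ.le).2 fun i => (hu i x).le
        calc ‖ℓ‖ * ‖b (u * x) - b x‖ ≤ ‖ℓ‖ * (ε / (‖ℓ‖ + 1)) := by gcongr
          _ < (‖ℓ‖ + 1) * (ε / (‖ℓ‖ + 1)) := by gcongr; linarith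
          _ = ε := by field_simp)
    obtain ⟨m, hpos, hone, hinv⟩ := hG
    have hsub : ∀ A B : rucb G, m (A - B) = m A - m B := by
      intro A B
      have h1 : m ((A - B) + B) = m (A - B) + m B := m.map_add _ _
      have h2 : (A - B) + B = A := by ext x; simp
      rw [h2] at h1
      linarith
    let o : rucb G := rucbOf (fun _ => 1) 1 (by simp) (fun ε hε => by simp [hε])
    have h1 := hpos (∑ g : E, (leftTranslate g.1 (F g) - F g) - u • o) (by
      intro x
      have h2 : ℓ (a x) = ∑ g : E, (ℓ (Pi.single g (b (g * x))) - ℓ (Pi.single g (b x))) := by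
        conv_lhs => rw [← Finset.univ_sum_single (a x)]
        rw [map_sum]
        refine Finset.sum_congr rfl fun g _ => ?_
        rw [← map_sub, ← Pi.single_sub]
      have h3 : (∑ g : E, (leftTranslate g.1 (F g) - F g) - u • o).1 x = ℓ (a x) - u := by
        rw [h2]
        simp only [Submodule.coe_sub, Submodule.coe_sum, Submodule.coe_smul,
          BoundedContinuousFunction.coe_sub, Pi.sub_apply, BoundedContinuousFunction.sum_apply,
          BoundedContinuousFunction.coe_smul]
        congr 1
        change u * 1 = u
        rw [mul_one]
      rw [h3]
      linarith [hlow x])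
    rw [hsub, map_sum, m.map_smul, hone o fun x => rfl] at h1
    have h2 : ∀ g : E, m (leftTranslate g.1 (F g) - F g) = 0 := fun g => by
      rw [hsub, hinv g.1 (F g) _ fun x => rfl, sub_self]
    simp only [h2, Finset.sum_const_zero, smul_eq_mul, mul_one] at h1
    linarith

/-- A version of `IsAmenable.exists_almost_invariant` for compact sets of translations. -/
theorem IsAmenable.exists_almost_invariant_of_isCompact (hG : IsAmenable G) {I : Type*}
    (f : I → G → ℝ) {C : ℝ} (hC : ∀ i x, |f i x| ≤ C)
    (hf : ∀ ε > 0, ∀ᶠ u in 𝓝 (1 : G), ∀ i x, |f i (u * x) - f i x| < ε)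
    {K : Set G} (hK : IsCompact K) {ε : ℝ} (hε : 0 < ε) :
    ∃ (ι : Type) (t : Finset ι) (w : ι → ℝ) (p : ι → G), (∀ j ∈ t, 0 ≤ w j) ∧ ∑ j ∈ t, w j = 1 ∧
      ∀ g ∈ K, ∀ i, |∑ j ∈ t, w j * (f i (g * p j) - f i (p j))| ≤ ε := by
  have hU := hf (ε / 2) (half_pos hε)
  obtain ⟨E, -, hE⟩ := hK.elim_nhds_subcover
    (fun k => {x | ∀ i y, |f i (x * k⁻¹ * y) - f i y| < ε / 2}) (fun k _ => by
      have h1 : Tendsto (fun x : G => x * k⁻¹) (𝓝 k) (𝓝 1) := by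
        have : Continuous fun x : G => x * k⁻¹ := by fun_prop
        simpa using this.tendsto k
      exact h1.eventually hU)
  obtain ⟨ι, t, w, p, hw, hw1, h⟩ := hG.exists_almost_invariant f hC hf E (half_pos hε)
  refine ⟨ι, t, w, p, hw, hw1, fun g hg i => ?_⟩
  obtain ⟨k, hk, hgk⟩ := Set.mem_iUnion₂.1 (hE hg)
  have e : ∑ j ∈ t, w j * (f i (g * p j) - f i (p j)) =
      ∑ j ∈ t, w j * (f i (k * p j) - f i (p j)) +
      ∑ j ∈ t, w j * (f i (g * p j) - f i (k * p j)) := by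
    rw [← Finset.sum_add_distrib]
    exact Finset.sum_congr rfl fun j _ => by ring
  have h2 : |∑ j ∈ t, w j * (f i (g * p j) - f i (k * p j))| ≤ ε / 2 := by
    refine (Finset.abs_sum_le_sum_abs _ _).trans ?_
    calc ∑ j ∈ t, |w j * (f i (g * p j) - f i (k * p j))| ≤ ∑ j ∈ t, w j * (ε / 2) := by
          refine Finset.sum_le_sum fun j hj => ?_
          rw [abs_mul, abs_of_nonneg (hw j hj)]
          refine mul_le_mul_of_nonneg_left ?_ (hw j hj)
          have := hgk i (k * p j)
          simp only [mul_assoc, inv_mul_cancel_left] at this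
          exact this.le
      _ = ε / 2 := by rw [← Finset.sum_mul, hw1, one_mul]
  rw [e]
  exact (abs_add_le _ _).trans (by linarith [h k hk i])

end Day

/-! ### Approximate identities and smearing on locally compact groups -/

section Smoothing

variable {G : Type*} [Group G] [TopologicalSpace G] [IsTopologicalGroup G] [T2Space G]
  [LocallyCompactSpace G] [MeasurableSpace G] [BorelSpace G]
variable {θ : Measure G} [θ.IsHaarMeasure]

/-- A nonnegative bump function near `1` with integral one. -/
theorem exists_bump (θ : Measure G) [θ.IsHaarMeasure] {U : Set G} (hU : U ∈ 𝓝 (1 : G)) :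
    ∃ φ : G → ℝ, Continuous φ ∧ HasCompactSupport φ ∧ (∀ x, 0 ≤ φ x) ∧ ∫ x, φ x ∂θ = 1 ∧
      ∀ x, φ x ≠ 0 → x ∈ U := by
  obtain ⟨χ, h1, h0, hc, hr⟩ := exists_continuous_one_zero_of_isCompact
    (isCompact_singleton (x := (1 : G))) isOpen_interior.isClosed_compl
    (Set.disjoint_compl_right_iff_subset.2
      (Set.singleton_subset_iff.2 (mem_interior_iff_mem_nhds.2 hU)))
  have hpos : 0 < ∫ x, χ x ∂θ :=
    χ.continuous.integral_pos_of_hasCompactSupport_nonneg_nonzero hc (fun x => (hr x).1)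
      (x := 1) (by rw [h1 rfl]; simp)
  refine ⟨fun x => (∫ x, χ x ∂θ)⁻¹ * χ x, χ.continuous.const_mul _, hc.mul_left, fun x =>
    mul_nonneg (inv_nonneg.2 hpos.le) (hr x).1, ?_, fun x hx => ?_⟩
  · rw [integral_const_mul, inv_mul_cancel₀ hpos.ne']
  · by_contra hxU
    have : x ∈ (interior U)ᶜ := fun h => hxU (interior_subset h)
    exact hx (by simp [h0 this])

theorem integral_mul_right_eq_modular (θ : Measure G) [θ.IsHaarMeasure] {f : G → ℝ}
    (hf : Continuous f) (hc : HasCompactSupport f) (x : G) :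
    ∫ y, f (y * x) ∂θ = Measure.modularCharacterFun x * ∫ y, f y ∂θ := by
  rw [Measure.modularCharacterFun_eq_haarScalarFactor θ x]
  have h := Measure.integral_isMulLeftInvariant_eq_smul_of_hasCompactSupport
    (θ.map (fun y => y * x)) θ hf hc
  rw [integral_smul_nnreal_measure, integral_map (by fun_prop) hf.aestronglyMeasurable] at h
  exact h

/-- Integrals of continuous families vanish in the limit if the limit function vanishes and the
supports stay in a compact set. -/
theorem tendsto_integral_abs_zero {k : G → G → ℝ} (hk : Continuous (Function.uncurry k))
    {N S : Set G} (hN : N ∈ 𝓝 (1 : G)) (hS : IsCompact S) (h0 : ∀ v ∈ N, ∀ u ∉ S, k v u = 0)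
    (h1 : ∀ u, k 1 u = 0) : Tendsto (fun v => ∫ u, |k v u| ∂θ) (𝓝 1) (𝓝 0) := by
  have hc : ContinuousOn (fun v => ∫ u, |k v u| ∂θ) N :=
    continuousOn_integral_of_compact_support (f := fun v u => |k v u|) hS hk.abs.continuousOn
      fun v u hv hu => by simp [h0 v hv u hu]
  have := (hc.continuousAt hN).tendsto
  simpa [h1] using this

theorem tendsto_integral_abs_right_translate_sub {φ : G → ℝ} (hφ : Continuous φ)
    (hc : HasCompactSupport φ) :
    Tendsto (fun v => ∫ u, |φ (u * v⁻¹) - φ u| ∂θ) (𝓝 1) (𝓝 0) := by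
  obtain ⟨N, hNc, hN⟩ := exists_compact_mem_nhds (1 : G)
  refine tendsto_integral_abs_zero (k := fun v u => φ (u * v⁻¹) - φ u)
    (by simp only [Function.uncurry_def]; fun_prop) hN (hc.isCompact.mul hNc |>.union hc.isCompact)
    (fun v hv u hu => ?_) (by simp)
  have h1 : φ u = 0 := image_eq_zero_of_notMem_tsupport fun h => hu (Or.inr h)
  have h2 : φ (u * v⁻¹) = 0 := image_eq_zero_of_notMem_tsupport fun h =>
    hu (Or.inl ⟨_, h, v, hv, by simp⟩)
  rw [h1, h2, sub_zero]

theorem tendsto_integral_abs_left_translate_sub {φ : G → ℝ} (hφ : Continuous φ)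
    (hc : HasCompactSupport φ) :
    Tendsto (fun v => ∫ u, |φ (v⁻¹ * u) - φ u| ∂θ) (𝓝 1) (𝓝 0) := by
  obtain ⟨N, hNc, hN⟩ := exists_compact_mem_nhds (1 : G)
  refine tendsto_integral_abs_zero (k := fun v u => φ (v⁻¹ * u) - φ u)
    (by simp only [Function.uncurry_def]; fun_prop) hN (hNc.mul hc.isCompact |>.union hc.isCompact)
    (fun v hv u hu => ?_) (by simp)
  have h1 : φ u = 0 := image_eq_zero_of_notMem_tsupport fun h => hu (Or.inr h)
  have h2 : φ (v⁻¹ * u) = 0 := image_eq_zero_of_notMem_tsupport fun h =>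
    hu (Or.inl ⟨v, hv, _, h, by simp⟩)
  rw [h1, h2, sub_zero]

/-- For `φ` of integral one, the modular function at `v` minus `1` is the integral of `φ (u * v) - φ
u`, which tends to zero by continuity of right translation in `L¹`. -/
theorem tendsto_modularCharacterFun_one :
    Tendsto (fun v : G => (Measure.modularCharacterFun v : ℝ)) (𝓝 1) (𝓝 1) := by
  obtain ⟨φ, hφ, hc, -, h1, -⟩ := exists_bump (Measure.haar : Measure G) (univ_mem (f := 𝓝 (1 : G)))
  have h2 : Tendsto (fun v : G => (Measure.modularCharacterFun v : ℝ) - 1) (𝓝 1) (𝓝 0) := by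
    have h3 := ((tendsto_integral_abs_right_translate_sub (θ := Measure.haar) hφ hc).comp
      ((continuous_inv (G := G)).tendsto 1 |>.trans (by rw [inv_one])))
    refine squeeze_zero_norm (fun v => ?_) h3
    have h4 := integral_mul_right_eq_modular Measure.haar hφ hc v
    rw [h1, mul_one] at h4
    have h5 : (Measure.modularCharacterFun v : ℝ) - 1 =
        ∫ u, (φ (u * v) - φ u) ∂Measure.haar := by
      rw [integral_sub, h4, h1]
      · exact (hφ.comp (continuous_mul_const v)).integrable_of_hasCompactSupport
          (hc.comp_homeomorph (Homeomorph.mulRight v))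
      · exact hφ.integrable_of_hasCompactSupport hc
    rw [h5]
    refine (norm_integral_le_integral_norm _).trans_eq ?_
    simp
  simpa using h2.add_const 1

/-- The function `x ↦ ∫ h (u x) φ u dθ(u)`. -/
def smear (θ : Measure G) (φ h : G → ℝ) (x : G) : ℝ := ∫ u, h (u * x) * φ u ∂θ

theorem smear_eq_modular {φ h : G → ℝ} (hφ : Continuous φ) (hc : HasCompactSupport φ)
    (hh : Continuous h) (x : G) :
    smear θ φ h x = Measure.modularCharacterFun x * ∫ y, h y * φ (y * x⁻¹) ∂θ := by
  rw [← integral_mul_right_eq_modular θ (f := fun y => h y * φ (y * x⁻¹)) (by fun_prop)]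
  · simp [smear]
  · exact (hc.comp_homeomorph (Homeomorph.mulRight x⁻¹)).mul_left

theorem integrable_mul_of_hasCompactSupport {φ k : G → ℝ} (hφ : Continuous φ)
    (hc : HasCompactSupport φ) (hk : Continuous k) : Integrable (fun u => k u * φ u) θ :=
  (hk.mul hφ).integrable_of_hasCompactSupport hc.mul_left

theorem abs_integral_mul_le {φ k : G → ℝ} (hφ : Continuous φ) (hc : HasCompactSupport φ)
    (hk1 : ∀ x, |k x| ≤ 1) : |∫ u, k u * φ u ∂θ| ≤ ∫ u, |φ u| ∂θ := by
  rw [← Real.norm_eq_abs]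
  refine norm_integral_le_of_norm_le (hφ.abs.integrable_of_hasCompactSupport hc.abs)
    (ae_of_all _ fun u => ?_)
  rw [norm_mul]
  exact mul_le_of_le_one_left (norm_nonneg _) (hk1 u)

/-- A displacement `v` of the argument is moved onto `φ` at the price of the modular function. The
bound does not involve `h`, so all smeared functions together form a family to which Day's argument
applies. -/
theorem eventually_abs_smear_sub_lt {φ : G → ℝ} (hφ : Continuous φ) (hc : HasCompactSupport φ)
    {ε : ℝ} (hε : 0 < ε) : ∀ᶠ v in 𝓝 (1 : G), ∀ h : G → ℝ, Continuous h → (∀ x, |h x| ≤ 1) →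
      ∀ x, |smear θ φ h (v * x) - smear θ φ h x| < ε := by
  have h1 : Tendsto (fun v : G => (Measure.modularCharacterFun v : ℝ) *
      ∫ u, |φ (u * v⁻¹) - φ u| ∂θ + |(Measure.modularCharacterFun v : ℝ) - 1| * ∫ u, |φ u| ∂θ)
      (𝓝 1) (𝓝 0) := by
    have := (tendsto_modularCharacterFun_one.mul
      (tendsto_integral_abs_right_translate_sub (θ := θ) hφ hc)).add
      (((tendsto_modularCharacterFun_one (G := G)).sub_const 1).abs.mul_const (∫ u, |φ u| ∂θ))
    simpa using this
  filter_upwards [h1.eventually (gt_mem_nhds hε)] with v hv h hh hh1 x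
  refine lt_of_le_of_lt ?_ hv
  have hcv : HasCompactSupport fun u => φ (u * v⁻¹) :=
    hc.comp_homeomorph (Homeomorph.mulRight v⁻¹)
  have hφv : Continuous fun u => φ (u * v⁻¹) := by fun_prop
  have hhx : Continuous fun u => h (u * x) := by fun_prop
  have e1 : smear θ φ h (v * x) =
      Measure.modularCharacterFun v * ∫ u, h (u * x) * φ (u * v⁻¹) ∂θ := by
    rw [← integral_mul_right_eq_modular θ (f := fun u => h (u * x) * φ (u * v⁻¹)) (by fun_prop)
      hcv.mul_left]
    simp [smear, mul_assoc]
  have e2 : smear θ φ h (v * x) - smear θ φ h x = Measure.modularCharacterFun v *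
      ∫ u, h (u * x) * (φ (u * v⁻¹) - φ u) ∂θ +
      ((Measure.modularCharacterFun v : ℝ) - 1) * ∫ u, h (u * x) * φ u ∂θ := by
    rw [e1]
    simp only [mul_sub]
    rw [integral_sub (integrable_mul_of_hasCompactSupport hφv hcv hhx)
      (integrable_mul_of_hasCompactSupport hφ hc hhx)]
    simp only [smear]
    ring
  rw [e2]
  refine (abs_add_le _ _).trans (add_le_add ?_ ?_)
  · rw [abs_mul, abs_of_nonneg (NNReal.coe_nonneg _)]
    exact mul_le_mul_of_nonneg_left (abs_integral_mul_le (hφv.sub hφ) (hcv.sub hc)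
      fun u => hh1 _) (NNReal.coe_nonneg _)
  · rw [abs_mul]
    exact mul_le_mul_of_nonneg_left (abs_integral_mul_le hφ hc fun u => hh1 _) (abs_nonneg _)

theorem continuous_smear {φ h : G → ℝ} (hφ : Continuous φ) (hc : HasCompactSupport φ)
    (hh : Continuous h) : Continuous (smear θ φ h) := by
  rw [← continuousOn_univ]
  refine continuousOn_integral_of_compact_support (f := fun x u => h (u * x) * φ u) hc.isCompact
    (by simp only [Function.uncurry_def]; fun_prop) fun x u _ hu => ?_
  rw [image_eq_zero_of_notMem_tsupport hu, mul_zero]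

/-- Smearing with `ψ` is close to smearing with `φ` and averaging against `ψ`, for `φ` an
approximate identity. -/
theorem abs_smear_sub_integral_smear_le {φ ψ h : G → ℝ} (hφ : Continuous φ)
    (hφc : HasCompactSupport φ) (hφ0 : ∀ x, 0 ≤ φ x) (hφ1 : ∫ x, φ x ∂θ = 1) (hψ : Continuous ψ)
    (hψc : HasCompactSupport ψ) (hh : Continuous h) (hh1 : ∀ x, |h x| ≤ 1) {ε : ℝ}
    (hε : ∀ u, φ u ≠ 0 → ∫ g, |ψ (u⁻¹ * g) - ψ g| ∂θ ≤ ε) (x : G) :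
    |smear θ ψ h x - ∫ g, smear θ φ h (g * x) * ψ g ∂θ| ≤ ε := by
  have hhx : Continuous fun g => h (g * x) := by fun_prop
  let q : G → ℝ := fun u => ∫ g, h (u * (g * x)) * ψ g ∂θ
  have hq : Continuous q := by
    rw [← continuousOn_univ]
    refine continuousOn_integral_of_compact_support (f := fun u g => h (u * (g * x)) * ψ g)
      hψc.isCompact (by simp only [Function.uncurry_def]; fun_prop) fun x u _ hu => ?_
    rw [image_eq_zero_of_notMem_tsupport hu, mul_zero]
  have e1 : ∫ g, smear θ φ h (g * x) * ψ g ∂θ = ∫ u, q u * φ u ∂θ := by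
    simp only [smear, q, ← integral_mul_const]
    rw [integral_integral_swap_of_hasCompactSupport
      (f := fun g u => h (u * (g * x)) * φ u * ψ g)]
    · refine integral_congr_ae (ae_of_all _ fun u => integral_congr_ae (ae_of_all _ fun g => ?_))
      simp only
      ring
    · simp only [Function.uncurry_def]
      fun_prop
    · refine HasCompactSupport.intro (hψc.isCompact.prod hφc.isCompact) ?_
      rintro ⟨g, u⟩ hgu
      simp only [Function.uncurry_apply_pair]
      by_cases hg : g ∈ tsupport ψ
      · rw [image_eq_zero_of_notMem_tsupport (f := φ) (fun hu => hgu ⟨hg, hu⟩)]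
        ring
      · rw [image_eq_zero_of_notMem_tsupport (f := ψ) hg]
        ring
  have e2 : ∀ u, q u = ∫ g, h (g * x) * ψ (u⁻¹ * g) ∂θ := by
    intro u
    rw [← integral_mul_left_eq_self (fun g => h (g * x) * ψ (u⁻¹ * g)) u]
    simp [q, mul_assoc]
  have e3 : smear θ ψ h x - ∫ g, smear θ φ h (g * x) * ψ g ∂θ =
      ∫ u, (smear θ ψ h x - q u) * φ u ∂θ := by
    rw [e1]
    simp only [sub_mul]
    rw [integral_sub ((hφ.integrable_of_hasCompactSupport hφc).const_mul _)
      (integrable_mul_of_hasCompactSupport hφ hφc hq), integral_const_mul, hφ1, mul_one]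
  rw [e3]
  have hb : ∀ u, ‖(smear θ ψ h x - q u) * φ u‖ ≤ ε * φ u := by
    intro u
    by_cases hu : φ u = 0
    · simp [hu]
    rw [norm_mul, Real.norm_of_nonneg (hφ0 u)]
    refine mul_le_mul_of_nonneg_right (le_trans ?_ (hε u hu)) (hφ0 u)
    have hcu : HasCompactSupport fun g => ψ (u⁻¹ * g) :=
      hψc.comp_homeomorph (Homeomorph.mulLeft u⁻¹)
    have hψu : Continuous fun g => ψ (u⁻¹ * g) := by fun_prop
    have e4 : q u - smear θ ψ h x = ∫ g, h (g * x) * (ψ (u⁻¹ * g) - ψ g) ∂θ := by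
      rw [e2]
      simp only [mul_sub]
      rw [integral_sub (integrable_mul_of_hasCompactSupport hψu hcu hhx)
        (integrable_mul_of_hasCompactSupport hψ hψc hhx)]
      rfl
    rw [norm_sub_rev, e4]
    exact abs_integral_mul_le (hψu.sub hψ) (hcu.sub hψc) fun g => hh1 _
  refine (norm_integral_le_of_norm_le ((hφ.integrable_of_hasCompactSupport hφc).const_mul ε)
    (ae_of_all _ hb)).trans_eq ?_
  rw [integral_const_mul, hφ1, mul_one]

/-- An `L¹`-bound from testing against bounded continuous functions. -/
theorem integral_abs_le_of_forall {D : G → ℝ} (hD : Continuous D) (hc : HasCompactSupport D)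
    {ε : ℝ} (h : ∀ h : G → ℝ, Continuous h → (∀ x, |h x| ≤ 1) → ∫ y, h y * D y ∂θ ≤ ε) :
    ∫ y, |D y| ∂θ ≤ ε := by
  have hfin : θ (tsupport D) ≠ ⊤ := hc.isCompact.measure_lt_top.ne
  have key : ∀ δ > 0, ∫ y, |D y| ∂θ ≤ ε + δ * θ.real (tsupport D) := by
    intro δ hδ
    have hpos : ∀ y, 0 < |D y| + δ := fun y => by positivity
    -- A continuous substitute for the sign of `D`; it loses at most `δ` at each point of the
    -- support.
    have hk : Continuous fun y => D y / (|D y| + δ) :=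
      hD.div (hD.abs.add continuous_const) fun y => (hpos y).ne'
    have h1 := h (fun y => D y / (|D y| + δ)) hk (fun y => by
      rw [abs_div, abs_of_pos (hpos y), div_le_one (hpos y)]
      linarith)
    have h2 : ∫ y, |D y| ∂θ - ∫ y, D y / (|D y| + δ) * D y ∂θ ≤
        ∫ y, (tsupport D).indicator (fun _ => δ) y ∂θ := by
      rw [← integral_sub (hD.abs.integrable_of_hasCompactSupport hc.abs)
        (integrable_mul_of_hasCompactSupport hD hc hk)]
      refine integral_mono ((hD.abs.integrable_of_hasCompactSupport hc.abs).sub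
        (integrable_mul_of_hasCompactSupport hD hc hk))
        ((integrable_indicator_iff (isClosed_tsupport D).measurableSet).2
          (integrableOn_const hfin)) fun y => ?_
      by_cases hy : y ∈ tsupport D
      · simp only [Set.indicator_of_mem hy]
        rw [div_mul_eq_mul_div, ← abs_mul_abs_self, sub_le_iff_le_add, ← sub_le_iff_le_add',
          le_div_iff₀ (hpos y)]
        nlinarith [abs_nonneg (D y)]
      · simp [Set.indicator_of_notMem hy, image_eq_zero_of_notMem_tsupport hy]
    rw [integral_indicator (isClosed_tsupport D).measurableSet, setIntegral_const,
      smul_eq_mul] at h2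
    linarith
  refine le_of_forall_pos_le_add fun η hη => ?_
  refine (key (η / (θ.real (tsupport D) + 1)) (by positivity)).trans ?_
  gcongr
  rw [div_mul_eq_mul_div, div_le_iff₀ (by positivity)]
  nlinarith [measureReal_nonneg (μ := θ) (s := tsupport D)]

end Smoothing

/-! ### Reiter densities and almost invariant compact sets -/

section Reiter

variable {G : Type*} [Group G] [TopologicalSpace G] [IsTopologicalGroup G] [T2Space G]
  [LocallyCompactSpace G] [MeasurableSpace G] [BorelSpace G]
variable {θ : Measure G} [θ.IsHaarMeasure]

/-- The density of the convolution of `ψ θ` with the measure `∑ j ∈ t, w j • δ (p j)`. -/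
def convDensity {ι : Type} (t : Finset ι) (w : ι → ℝ) (p : ι → G) (ψ : G → ℝ) (y : G) : ℝ :=
  ∑ j ∈ t, w j * Measure.modularCharacterFun (p j) * ψ (y * (p j)⁻¹)

variable {ι : Type} {t : Finset ι} {w : ι → ℝ} {p : ι → G} {ψ : G → ℝ}

theorem continuous_convDensity (hψ : Continuous ψ) : Continuous (convDensity t w p ψ) := by
  unfold convDensity
  fun_prop

theorem hasCompactSupport_convDensity (hc : HasCompactSupport ψ) :
    HasCompactSupport (convDensity t w p ψ) := by
  refine HasCompactSupport.intro (t.isCompact_biUnion fun j _ =>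
    hc.isCompact.image (continuous_mul_const (p j))) fun y hy => ?_
  refine Finset.sum_eq_zero fun j hj => ?_
  rw [image_eq_zero_of_notMem_tsupport (f := ψ), mul_zero]
  exact fun h => hy (Set.mem_biUnion hj ⟨_, h, by simp⟩)

theorem integral_mul_convDensity (hψ : Continuous ψ) (hc : HasCompactSupport ψ) {h : G → ℝ}
    (hh : Continuous h) :
    ∫ y, h y * convDensity t w p ψ y ∂θ = ∑ j ∈ t, w j * smear θ ψ h (p j) := by
  simp only [convDensity, Finset.mul_sum]
  rw [integral_finsetSum]
  · refine Finset.sum_congr rfl fun j _ => ?_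
    rw [smear_eq_modular hψ hc hh, ← mul_assoc, ← integral_const_mul]
    refine integral_congr_ae (ae_of_all _ fun y => ?_)
    simp only
    ring
  · intro j _
    refine integrable_mul_of_hasCompactSupport (by fun_prop) ?_ hh
    exact (hc.comp_homeomorph (Homeomorph.mulRight (p j)⁻¹)).mul_left

theorem integral_convDensity (hψ : Continuous ψ) (hc : HasCompactSupport ψ)
    (hw : ∑ j ∈ t, w j = 1) : ∫ y, convDensity t w p ψ y ∂θ = ∫ y, ψ y ∂θ := by
  have h := integral_mul_convDensity (θ := θ) (t := t) (w := w) (p := p) hψ hc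
    (h := fun _ => 1) continuous_const
  simpa [smear, ← Finset.sum_mul, hw] using h

/-- Reiter's property: amenability yields densities that are almost invariant in `L¹`. -/
theorem IsAmenable.exists_reiter (hG : IsAmenable G) (hψ : Continuous ψ)
    (hc : HasCompactSupport ψ) (E : Finset G) {ε : ℝ} (hε : 0 < ε) :
    ∃ (ι : Type) (t : Finset ι) (w : ι → ℝ) (p : ι → G), (∀ j ∈ t, 0 ≤ w j) ∧ ∑ j ∈ t, w j = 1 ∧
      ∀ k ∈ E, ∫ y, |convDensity t w p ψ (k⁻¹ * y) - convDensity t w p ψ y| ∂θ ≤ ε := by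
  classical
  let I₀ : ℝ := ∫ g, |ψ g| ∂θ
  have hI₀ : 0 ≤ I₀ := integral_nonneg fun g => abs_nonneg _
  let η : ℝ := ε / (2 * (1 + I₀))
  have hη : 0 < η := by positivity
  let ψk : G → G → ℝ := fun k g => ψ (k⁻¹ * g)
  have hψk : ∀ k, Continuous (ψk k) := fun k => by fun_prop
  have hck : ∀ k, HasCompactSupport (ψk k) := fun k =>
    hc.comp_homeomorph (Homeomorph.mulLeft k⁻¹)
  have hU : {u : G | ∀ k ∈ insert 1 E, ∫ g, |ψk k (u⁻¹ * g) - ψk k g| ∂θ ≤ η} ∈ 𝓝 (1 : G) := by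
    refine (Finset.eventually_all _).2 fun k _ => ?_
    filter_upwards [(tendsto_integral_abs_left_translate_sub (θ := θ) (hψk k) (hck k)).eventually
      (gt_mem_nhds hη)] with u hu
    exact hu.le
  obtain ⟨φ, hφ, hφc, hφ0, hφ1, hφU⟩ := exists_bump θ hU
  let K : Set G := ⋃ k ∈ insert 1 E, (fun g => k * g) '' tsupport ψ
  have hK : IsCompact K := (insert 1 E).isCompact_biUnion fun k _ =>
    hc.isCompact.image (continuous_const_mul k)
  have hsupp : ∀ k ∈ insert 1 E, ∀ g, ψk k g ≠ 0 → g ∈ K := by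
    intro k hk g hg
    exact Set.mem_biUnion hk ⟨k⁻¹ * g, subset_tsupport _ hg, by simp⟩
  obtain ⟨ι, t, w, p, hw, hw1, hinv⟩ := hG.exists_almost_invariant_of_isCompact
    (I := {h : G → ℝ // Continuous h ∧ ∀ x, |h x| ≤ 1}) (fun h => smear θ φ h.1)
    (C := ∫ u, |φ u| ∂θ) (fun h x => abs_integral_mul_le hφ hφc fun u => h.2.2 _)
    (fun ε hε => (eventually_abs_smear_sub_lt (θ := θ) hφ hφc hε).mono
      fun u hu h x => hu h.1 h.2.1 h.2.2 x) hK hη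
  refine ⟨ι, t, w, p, hw, hw1, ?_⟩
  -- Smearing with a left translate of `ψ` amounts, up to `η`, to averaging translates of `smear θ φ
  -- h` by elements of `K`; Day's weights barely see these. Hence the translates for `k` and for `1`
  -- are both close to the same number, which depends on `ψ` only through its integral.
  have key : ∀ k ∈ insert 1 E, ∀ h : G → ℝ, Continuous h → (∀ x, |h x| ≤ 1) →
      |∑ j ∈ t, w j * smear θ (ψk k) h (p j) -
        (∑ j ∈ t, w j * smear θ φ h (p j)) * ∫ g, ψ g ∂θ| ≤ η + η * I₀ := by
    intro k hk h hh hh1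
    have hcont : ∀ x, Continuous fun g => smear θ φ h (g * x) := fun x =>
      (continuous_smear hφ hφc hh).comp (continuous_mul_const x)
    have h1 : |∑ j ∈ t, w j * smear θ (ψk k) h (p j) -
        ∑ j ∈ t, w j * ∫ g, smear θ φ h (g * p j) * ψk k g ∂θ| ≤ η := by
      rw [← Finset.sum_sub_distrib]
      refine (Finset.abs_sum_le_sum_abs _ _).trans ?_
      calc _ ≤ ∑ j ∈ t, w j * η := by
            refine Finset.sum_le_sum fun j hj => ?_
            rw [← mul_sub, abs_mul, abs_of_nonneg (hw j hj)]
            exact mul_le_mul_of_nonneg_left (abs_smear_sub_integral_smear_le hφ hφc hφ0 hφ1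
              (hψk k) (hck k) hh hh1 (fun u hu => hφU u hu k hk) (p j)) (hw j hj)
        _ = η := by rw [← Finset.sum_mul, hw1, one_mul]
    have e2 : ∑ j ∈ t, w j * ∫ g, smear θ φ h (g * p j) * ψk k g ∂θ -
        (∑ j ∈ t, w j * smear θ φ h (p j)) * ∫ g, ψ g ∂θ =
        ∫ g, (∑ j ∈ t, w j * (smear θ φ h (g * p j) - smear θ φ h (p j))) * ψk k g ∂θ := by
      have e3 : ∫ g, ψ g ∂θ = ∫ g, ψk k g ∂θ :=
        (integral_mul_left_eq_self (fun g => ψ g) k⁻¹).symm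
      rw [e3, ← integral_const_mul]
      simp only [← integral_const_mul]
      rw [← integral_finsetSum, ← integral_sub]
      · refine integral_congr_ae (ae_of_all _ fun g => ?_)
        simp only [Finset.sum_mul, ← Finset.sum_sub_distrib]
        exact Finset.sum_congr rfl fun j _ => by ring
      · exact integrable_finsetSum _ fun j _ =>
          (integrable_mul_of_hasCompactSupport (hψk k) (hck k) (hcont (p j))).const_mul _
      · exact ((hψk k).integrable_of_hasCompactSupport (hck k)).const_mul _
      · exact fun j _ =>
          (integrable_mul_of_hasCompactSupport (hψk k) (hck k) (hcont (p j))).const_mul _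
    have h2 : |∑ j ∈ t, w j * ∫ g, smear θ φ h (g * p j) * ψk k g ∂θ -
        (∑ j ∈ t, w j * smear θ φ h (p j)) * ∫ g, ψ g ∂θ| ≤ η * I₀ := by
      rw [e2, ← Real.norm_eq_abs]
      have e4 : I₀ = ∫ g, |ψk k g| ∂θ :=
        (integral_mul_left_eq_self (fun g => |ψ g|) k⁻¹).symm
      rw [e4, ← integral_const_mul]
      refine norm_integral_le_of_norm_le
        (((hψk k).abs.integrable_of_hasCompactSupport (hck k).abs).const_mul _)
        (ae_of_all _ fun g => ?_)
      by_cases hg : ψk k g = 0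
      · simp [hg]
      rw [norm_mul]
      exact mul_le_mul_of_nonneg_right (hinv g (hsupp k hk g hg) ⟨h, hh, hh1⟩) (norm_nonneg _)
    have h3 := abs_le.1 h1
    have h4 := abs_le.1 h2
    rw [abs_le]
    constructor <;> linarith [h3.1, h3.2, h4.1, h4.2]
  intro k hk
  have e1 : ∀ y, convDensity t w p ψ (k⁻¹ * y) = convDensity t w p (ψk k) y := fun y => by
    simp [convDensity, ψk, mul_assoc]
  have e0 : ψk 1 = ψ := by ext g; simp [ψk]
  simp only [e1]
  refine integral_abs_le_of_forall
    (D := fun y => convDensity t w p (ψk k) y - convDensity t w p ψ y)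
    ((continuous_convDensity (hψk k)).sub (continuous_convDensity hψ))
    ((hasCompactSupport_convDensity (hck k)).sub (hasCompactSupport_convDensity hc)) ?_
  intro h hh hh1
  simp only [mul_sub]
  rw [integral_sub, integral_mul_convDensity (hψk k) (hck k) hh, integral_mul_convDensity hψ hc hh]
  · have h1 := abs_le.1 (key k (Finset.mem_insert_of_mem hk) h hh hh1)
    have h2 := abs_le.1 (key 1 (Finset.mem_insert_self _ _) h hh hh1)
    rw [e0] at h2
    have h3 : η + η * I₀ = ε / 2 := by
      simp only [η]
      field_simp
    linarith [h1.1, h1.2, h2.1, h2.2]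
  · exact integrable_mul_of_hasCompactSupport (continuous_convDensity (hψk k))
      (hasCompactSupport_convDensity (hck k)) hh
  · exact integrable_mul_of_hasCompactSupport (continuous_convDensity hψ)
      (hasCompactSupport_convDensity hc) hh

/-- A density and a majorant of nearly the same mass have a common level at which the superlevel
sets have nearly the same measure. -/
theorem exists_level {Ω : Type*} [MeasurableSpace Ω] (μ : Measure Ω) {R M : Ω → ℝ}
    (hR : Integrable R μ) (hR0 : ∀ y, 0 ≤ R y) (hM : Integrable M μ) (hM0 : ∀ y, 0 ≤ M y)
    {a : ℝ} (ha : 0 ≤ a) (hRM : ∫ y, M y ∂μ < a * ∫ y, R y ∂μ) :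
    ∃ s > 0, μ {y | s ≤ R y} ≠ 0 ∧ μ {y | s ≤ M y} ≤ ENNReal.ofReal a * μ {y | s ≤ R y} := by
  by_contra! h
  have h1 : ∀ s ∈ Set.Ioi (0 : ℝ), ENNReal.ofReal a * μ {y | s ≤ R y} ≤ μ {y | s ≤ M y} := by
    intro s hs
    by_cases h0 : μ {y | s ≤ R y} = 0
    · simp [h0]
    · exact (h s hs h0).le
  -- Layer-cake formula: if the inequality failed at every level, integration over the levels would
  -- contradict the comparison of integrals.
  have h2 := setLIntegral_mono' (μ := volume) measurableSet_Ioi h1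
  rw [lintegral_const_mul' _ _ ENNReal.ofReal_ne_top,
    ← lintegral_eq_lintegral_meas_le μ (ae_of_all _ hR0) hR.aemeasurable,
    ← lintegral_eq_lintegral_meas_le μ (ae_of_all _ hM0) hM.aemeasurable,
    ← ofReal_integral_eq_lintegral_ofReal hR (ae_of_all _ hR0),
    ← ofReal_integral_eq_lintegral_ofReal hM (ae_of_all _ hM0), ← ENNReal.ofReal_mul ha,
    ENNReal.ofReal_le_ofReal_iff (integral_nonneg hM0)] at h2
  exact absurd hRM (not_lt.2 h2)

/-- Uniform continuity, with the error carried by a compactly supported `χ`: a constant error term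
would not be integrable on a noncompact group. -/
theorem eventually_left_translate_le_add (hψ : Continuous ψ) (hc : HasCompactSupport ψ)
    {N : Set G} (hNc : IsCompact N) (hN : N ∈ 𝓝 (1 : G)) {χ : G → ℝ} (hχ0 : ∀ x, 0 ≤ χ x)
    (hψ0 : ∀ x, 0 ≤ ψ x) (hχ1 : ∀ x ∈ N * tsupport ψ, χ x = 1) {δ : ℝ} (hδ : 0 < δ) :
    ∀ᶠ u in 𝓝 (1 : G), ∀ v, ψ (u⁻¹ * v) ≤ ψ v + δ * χ v := by
  have h1 : ∀ᶠ u in 𝓝 (1 : G), ∀ v ∈ N * tsupport ψ, ψ (u⁻¹ * v) - ψ v < δ := by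
    refine (hNc.mul hc.isCompact).eventually_forall_of_forall_eventually fun v _ => ?_
    have hcont : Continuous fun z : G × G => ψ (z.1⁻¹ * z.2) - ψ z.2 := by fun_prop
    have := hcont.tendsto (1, v)
    simp only [inv_one, one_mul, sub_self] at this
    exact this.eventually (gt_mem_nhds hδ)
  filter_upwards [h1, hN] with u hu huN v
  by_cases hv : v ∈ N * tsupport ψ
  · rw [hχ1 v hv]
    linarith [hu v hv]
  · rw [image_eq_zero_of_notMem_tsupport (f := ψ) (x := u⁻¹ * v)]
    · have := hψ0 v
      have := hχ0 v
      positivity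
    · exact fun h => hv ⟨u, huN, _, h, by simp⟩

/-- Amenable locally compact groups have compact sets that are almost invariant under
multiplication by a given compact set. -/
theorem IsAmenable.exists_isCompact_measure_mul_le (hG : IsAmenable G) (θ : Measure G)
    [θ.IsHaarMeasure] {K : Set G} (hK : IsCompact K) {ε : ℝ} (hε : 0 < ε) :
    ∃ F : Set G, IsCompact F ∧ θ F ≠ 0 ∧ θ (K * F) ≤ ENNReal.ofReal (1 + ε) * θ F := by
  classical
  obtain ⟨ψ, hψ, hc, hψ0, hψ1, -⟩ := exists_bump θ (univ_mem (f := 𝓝 (1 : G)))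
  obtain ⟨N, hNc, hN⟩ := exists_compact_mem_nhds (1 : G)
  obtain ⟨χ, hχ1, -, hχc, hχ⟩ := exists_continuous_one_zero_of_isCompact
    (hNc.mul hc.isCompact) isClosed_empty (Set.disjoint_empty _)
  have hIχ : 0 ≤ ∫ x, χ x ∂θ := integral_nonneg fun x => (hχ x).1
  let δ : ℝ := ε / (3 * (∫ x, χ x ∂θ + 1))
  have hδ : 0 < δ := by positivity
  have hδχ : δ * ∫ x, χ x ∂θ ≤ ε / 3 := by
    simp only [δ]
    rw [div_mul_eq_mul_div, div_le_div_iff₀ (by positivity) (by positivity)]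
    nlinarith
  let ψ' : G → ℝ := fun x => ψ x + δ * χ x
  have hψ' : Continuous ψ' := hψ.add (χ.continuous.const_mul δ)
  have hc' : HasCompactSupport ψ' := hc.add hχc.mul_left
  have hU := eventually_left_translate_le_add hψ hc hNc hN (fun x => (hχ x).1) hψ0
    (fun x hx => hχ1 hx) hδ
  obtain ⟨E, -, hE⟩ := hK.elim_nhds_subcover (fun k => {x | ∀ v, ψ ((k⁻¹ * x)⁻¹ * v) ≤ ψ' v})
    (fun k _ => by
      have h1 : Tendsto (fun x : G => k⁻¹ * x) (𝓝 k) (𝓝 1) := by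
        have : Continuous fun x : G => k⁻¹ * x := by fun_prop
        simpa using this.tendsto k
      exact h1.eventually hU)
  obtain ⟨ι, t, w, p, hw, hw1, hR⟩ := hG.exists_reiter (θ := θ) hψ' hc' E
    (ε := ε / (3 * (E.card + 1))) (by positivity)
  let R := convDensity t w p ψ
  let R' := convDensity t w p ψ'
  have hRc : Continuous R := continuous_convDensity hψ
  have hRs : HasCompactSupport R := hasCompactSupport_convDensity hc
  have hR'c : Continuous R' := continuous_convDensity hψ'
  have hR's : HasCompactSupport R' := hasCompactSupport_convDensity hc'
  have hdiff : ∀ k, Integrable (fun y => |R' (k⁻¹ * y) - R' y|) θ := fun k =>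
    ((hR'c.comp (continuous_const_mul k⁻¹)).sub hR'c).abs.integrable_of_hasCompactSupport
      ((hR's.comp_homeomorph (Homeomorph.mulLeft k⁻¹)).sub hR's).abs
  have hR0 : ∀ y, 0 ≤ R y := fun y => Finset.sum_nonneg fun j hj =>
    mul_nonneg (mul_nonneg (hw j hj) (NNReal.coe_nonneg _)) (hψ0 _)
  have hR'0 : ∀ y, 0 ≤ R' y := fun y => Finset.sum_nonneg fun j hj =>
    mul_nonneg (mul_nonneg (hw j hj) (NNReal.coe_nonneg _))
      (add_nonneg (hψ0 _) (mul_nonneg hδ.le (hχ _).1))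
  -- For `κ ∈ K` near `k ∈ E`, `R z ≤ R' (k⁻¹ * (κ * z)) ≤ M (κ * z)`; so `K` carries `{s ≤ R}` into
  -- `{s ≤ M}`. The integral of `M` is at most `1 + 2 * ε / 3`, one third of `ε` from the `χ`-term
  -- and one third from Reiter's property.
  let M : G → ℝ := fun y => R' y + ∑ k ∈ E, |R' (k⁻¹ * y) - R' y|
  have hM0 : ∀ y, 0 ≤ M y := fun y =>
    add_nonneg (hR'0 y) (Finset.sum_nonneg fun k _ => abs_nonneg _)
  have hR'i : Integrable R' θ := hR'c.integrable_of_hasCompactSupport hR's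
  have hMi : Integrable M θ := hR'i.add (integrable_finsetSum _ fun k _ => hdiff k)
  have hIR : ∫ y, R y ∂θ = 1 := (integral_convDensity hψ hc hw1).trans hψ1
  have hIM : ∫ y, M y ∂θ ≤ 1 + ε / 3 + ε / 3 := by
    simp only [M]
    rw [integral_add hR'i (integrable_finsetSum _ fun k _ => hdiff k),
      integral_finsetSum _ fun k _ => hdiff k]
    have h1 : ∫ y, R' y ∂θ ≤ 1 + ε / 3 := by
      rw [integral_convDensity hψ' hc' hw1, integral_add
        (hψ.integrable_of_hasCompactSupport hc)
        ((χ.continuous.integrable_of_hasCompactSupport hχc).const_mul δ), integral_const_mul, hψ1]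
      linarith
    have h2 : ∑ k ∈ E, ∫ y, |R' (k⁻¹ * y) - R' y| ∂θ ≤ ε / 3 := by
      refine (Finset.sum_le_sum fun k hk => hR k hk).trans ?_
      rw [Finset.sum_const, nsmul_eq_mul, mul_div_assoc', div_le_div_iff₀ (by positivity)
        (by positivity)]
      nlinarith
    linarith
  obtain ⟨s, hs, hF0, hle⟩ := exists_level θ (hRc.integrable_of_hasCompactSupport hRs) hR0 hMi hM0
    (a := 1 + ε) (by positivity) (by rw [hIR]; linarith)
  refine ⟨{y | s ≤ R y}, ?_, hF0, (measure_mono ?_).trans hle⟩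
  · refine hRs.isCompact.of_isClosed_subset (isClosed_le continuous_const hRc) fun y hy => ?_
    exact subset_tsupport _ (show R y ≠ 0 from (hs.trans_le hy).ne')
  · rintro _ ⟨κ, hκ, z, hz, rfl⟩
    obtain ⟨k, hk, hκk⟩ := Set.mem_iUnion₂.1 (hE hκ)
    have h1 : R z ≤ R' (k⁻¹ * (κ * z)) := by
      refine Finset.sum_le_sum fun j hj => mul_le_mul_of_nonneg_left ?_
        (mul_nonneg (hw j hj) (NNReal.coe_nonneg _))
      have := hκk (k⁻¹ * (κ * z) * (p j)⁻¹)
      simpa [mul_assoc] using this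
    have h2 : R' (k⁻¹ * (κ * z)) - R' (κ * z) ≤ ∑ k ∈ E, |R' (k⁻¹ * (κ * z)) - R' (κ * z)| :=
      (le_abs_self _).trans (Finset.single_le_sum
        (f := fun k => |R' (k⁻¹ * (κ * z)) - R' (κ * z)|) (fun k _ => abs_nonneg _) hk)
    change s ≤ R' (κ * z) + _
    have h3 : s ≤ R z := hz
    linarith

end Reiter

/-! ### Thick Følner sequences -/

section Thick

variable {G : Type*} [Group G] [TopologicalSpace G] [IsTopologicalGroup G]
  [MeasurableSpace G] [BorelSpace G]
variable {X : Type*} [MetricSpace X] [CompactSpace X] [MulAction G X] [ContinuousSMul G X]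

theorem avgOp_eq_inv_mul (θ : Measure G) (F : Set G) (f : C(X, ℝ)) (x : X) :
    avgOp X θ F f x = (θ.real F)⁻¹ * ∫ g in F, f (g • x) ∂θ := by
  rw [avgOp_apply, setAverage_eq, smul_eq_mul]

/-- Averages over right translates, for measures that are scaled by right translations. -/
theorem avgOp_image_mul_right {θ : Measure G} {c : G} {m : NNReal} (hm : m ≠ 0)
    (hθ : θ.map (fun h => h * c) = m • θ) (F : Set G) (f : C(X, ℝ)) (x : X) :
    avgOp X θ ((fun h => h * c) '' F) f x = avgOp X θ F f (c • x) := by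
  have hemb : MeasurableEmbedding fun h : G => h * c :=
    (Homeomorph.mulRight c).measurableEmbedding
  have hinj : Function.Injective fun h : G => h * c := mul_left_injective c
  have h1 : ∫ g in F, f (g • c • x) ∂θ = m * ∫ g in (fun h => h * c) '' F, f (g • x) ∂θ := by
    have h := hemb.setIntegral_map (μ := θ) (fun g => f (g • x)) ((fun h => h * c) '' F)
    rw [Set.preimage_image_eq _ hinj, hθ, Measure.restrict_smul,
      integral_smul_nnreal_measure] at h
    simp only [mul_smul] at h
    exact h.symm
  have h2 : θ.real F = m * θ.real ((fun h => h * c) '' F) := by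
    have h := hemb.map_apply θ ((fun h => h * c) '' F)
    rw [Set.preimage_image_eq _ hinj, hθ] at h
    rw [measureReal_def, ← h]
    rw [Measure.smul_apply, ENNReal.smul_def, smul_eq_mul, ENNReal.toReal_mul, ENNReal.coe_toReal,
      measureReal_def]
  rw [avgOp_eq_inv_mul, avgOp_eq_inv_mul, h1, h2]
  have : (m : ℝ) ≠ 0 := NNReal.coe_ne_zero.2 hm
  field_simp

theorem abs_setIntegral_sub_le {Ω : Type*} [MeasurableSpace Ω] {μ : Measure Ω} {A B : Set Ω}
    (hA : MeasurableSet A) (hB : MeasurableSet B) {φ : Ω → ℝ} {C : ℝ} (hC : ∀ x, |φ x| ≤ C)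
    (hφA : IntegrableOn φ A μ) (hφB : IntegrableOn φ B μ) (hfin : μ (A ∆ B) ≠ ⊤) :
    |∫ x in A, φ x ∂μ - ∫ x in B, φ x ∂μ| ≤ C * μ.real (A ∆ B) := by
  rw [← integral_indicator hA, ← integral_indicator hB, ← integral_sub
    ((integrable_indicator_iff hA).2 hφA) ((integrable_indicator_iff hB).2 hφB),
    ← Real.norm_eq_abs]
  have e : C * μ.real (A ∆ B) = ∫ x, (A ∆ B).indicator (fun _ => C) x ∂μ := by
    rw [integral_indicator (hA.symmDiff hB), setIntegral_const, smul_eq_mul, mul_comm]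
  rw [e]
  refine norm_integral_le_of_norm_le
    ((integrable_indicator_iff (hA.symmDiff hB)).2 (integrableOn_const hfin))
    (ae_of_all _ fun x => ?_)
  by_cases h1 : x ∈ A <;> by_cases h2 : x ∈ B <;>
    simp [h1, h2, Set.mem_symmDiff, Set.indicator, hC x]

theorem tendsto_toReal_div_zero {a b : ℕ → ENNReal}
    (h : Tendsto (fun n => a n / b n) atTop (𝓝 0)) :
    Tendsto (fun n => (a n).toReal / (b n).toReal) atTop (𝓝 0) := by
  have := (ENNReal.tendsto_toReal ENNReal.zero_ne_top).comp h
  simpa [Function.comp_def, ENNReal.toReal_div] using this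

theorem integrableOn_orbit_of_isCompact {θ : Measure G} [IsFiniteMeasureOnCompacts θ] {F : Set G}
    (hF : IsCompact F) (f : C(X, ℝ)) (x : X) : IntegrableOn (fun g => f (g • x)) F θ := by
  have : IsFiniteMeasure (θ.restrict F) := ⟨by simpa using hF.measure_lt_top⟩
  exact integrable_orbit _ f x

/-- Applied with `B` a translate of `A` on the side under which `θ` is invariant, where the first
term is an average at a translated function or point. -/
theorem abs_avgOp_sub_le_of_symmDiff [T2Space G] {θ : Measure G} [IsFiniteMeasureOnCompacts θ]
    {A B : Set G} (hA : IsCompact A) (hB : IsCompact B) (f : C(X, ℝ)) (x : X) :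
    |(θ.real A)⁻¹ * ∫ g in B, f (g • x) ∂θ - avgOp X θ A f x| ≤
      ‖f‖ * ((θ (A ∆ B)).toReal / (θ A).toReal) := by
  rw [avgOp_eq_inv_mul, ← mul_sub, abs_mul, abs_inv, abs_of_nonneg measureReal_nonneg, abs_sub_comm]
  have h1 := abs_setIntegral_sub_le (μ := θ) hA.isClosed.measurableSet hB.isClosed.measurableSet
    (φ := fun g => f (g • x)) (fun g => f.norm_coe_le_norm (g • x))
    (integrableOn_orbit_of_isCompact hA f x) (integrableOn_orbit_of_isCompact hB f x)
    ((measure_mono Set.symmDiff_subset_union).trans_lt (hA.union hB).measure_lt_top).ne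
  calc _ ≤ (θ.real A)⁻¹ * (‖f‖ * θ.real (A ∆ B)) :=
        mul_le_mul_of_nonneg_left h1 (inv_nonneg.2 measureReal_nonneg)
    _ = _ := by rw [measureReal_def, measureReal_def]; ring

theorem IsThickFolner.asymptoticallyInvariant [T2Space G] {θ : Measure G} [θ.IsMulLeftInvariant]
    [IsFiniteMeasureOnCompacts θ] {F : ℕ → Set G} (hF : IsThickFolner θ F) :
    AsymptoticallyInvariant X θ F := by
  intro g f
  have h1 := tendsto_toReal_div_zero (hF.tendsto {g} isCompact_singleton (Set.singleton_nonempty g))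
  have h2 := h1.const_mul ‖f‖
  rw [mul_zero] at h2
  refine squeeze_zero_norm (fun n => ?_) h2
  refine (ContinuousMap.norm_le _ (by positivity)).2 fun x => ?_
  have hgF : IsCompact ({g} * F n) := isCompact_singleton.mul (hF.isCompact n)
  refine le_trans (le_of_eq ?_) (abs_avgOp_sub_le_of_symmDiff (hF.isCompact n) hgF f x)
  rw [Real.norm_eq_abs, ContinuousMap.sub_apply]
  congr 2
  rw [avgOp_eq_inv_mul]
  congr 1
  have hemb : MeasurableEmbedding fun h : G => g * h :=
    (Homeomorph.mulLeft g).measurableEmbedding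
  have h := hemb.setIntegral_map (μ := θ) (fun h => f (h • x)) ({g} * F n)
  rw [map_mul_left_eq_self, Set.singleton_mul,
    Set.preimage_image_eq _ (mul_right_injective g)] at h
  rw [Set.singleton_mul, h]
  simp [mul_smul]

/-- Along right Følner sequences, averages do not change asymptotically under translations of
the point. -/
theorem IsRightThickFolner.tendsto_sub [T2Space G] {θ : Measure G} [θ.IsMulRightInvariant]
    [IsFiniteMeasureOnCompacts θ] {F : ℕ → Set G} (hF : IsRightThickFolner θ F) (f : C(X, ℝ))
    (g : G) (x : X) :
    Tendsto (fun n => avgOp X θ (F n) f (g • x) - avgOp X θ (F n) f x) atTop (𝓝 0) := by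
  have h1 := tendsto_toReal_div_zero (hF.tendsto {g} isCompact_singleton (Set.singleton_nonempty g))
  have h2 := h1.const_mul ‖f‖
  rw [mul_zero] at h2
  refine squeeze_zero_norm (fun n => ?_) h2
  have hgF : IsCompact (F n * {g}) := (hF.isCompact n).mul isCompact_singleton
  refine le_trans (le_of_eq ?_) (abs_avgOp_sub_le_of_symmDiff (hF.isCompact n) hgF f x)
  rw [Real.norm_eq_abs]
  congr 2
  rw [avgOp_eq_inv_mul]
  congr 1
  have hemb : MeasurableEmbedding fun h : G => h * g :=
    (Homeomorph.mulRight g).measurableEmbedding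
  have h := hemb.setIntegral_map (μ := θ) (fun h => f (h • x)) (F n * {g})
  rw [map_mul_right_eq_self, Set.mul_singleton,
    Set.preimage_image_eq _ (mul_left_injective g)] at h
  rw [Set.mul_singleton, h]
  simp [mul_smul]

variable [T2Space G] [LocallyCompactSpace G] [SigmaCompactSpace G]

/-- Right translation commutes with left multiplication by `K` and scales left Haar measure by the
modular function, which cancels in the Følner quotient. -/
theorem IsThickFolner.image_mul_right {θ : Measure G} [θ.IsHaarMeasure] [θ.Regular]
    {F : ℕ → Set G} (hF : IsThickFolner θ F) (c : ℕ → G) :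
    IsThickFolner θ fun n => (fun h => h * c n) '' F n := by
  have hscale : ∀ (a : G) (A : Set G), θ A =
      (Measure.modularCharacterFun a : ENNReal) * θ ((fun h => h * a) '' A) := by
    intro a A
    have h := (Homeomorph.mulRight a).measurableEmbedding.map_apply θ ((fun h => h * a) '' A)
    change θ.map (fun h => h * a) _ = θ ((fun h => h * a) ⁻¹' _) at h
    rw [Set.preimage_image_eq _ (mul_left_injective a),
      Measure.map_right_mul_eq_modularCharacterFun_smul] at h
    rw [← h]
    rfl
  have hne : ∀ a : G, (Measure.modularCharacterFun a : ENNReal) ≠ 0 := fun a =>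
    ENNReal.coe_ne_zero.2 (Measure.modularCharacterFun_pos a).ne'
  refine ⟨fun n => (hF.isCompact n).image (continuous_mul_const _), fun n => (hF.nonempty n).image _,
    fun n => ?_, fun K hK hKn => ?_⟩
  · have h := hF.measure_pos n
    rw [hscale (c n)] at h
    exact pos_of_mul_pos_right h bot_le
  · refine (hF.tendsto K hK hKn).congr fun n => ?_
    have e : K * (fun h => h * c n) '' F n = (fun h => h * c n) '' (K * F n) := by
      rw [← Set.mul_singleton, ← Set.mul_singleton, mul_assoc]
    rw [e, ← Set.image_symmDiff (mul_left_injective (c n)), hscale (c n) (F n ∆ (K * F n)),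
      hscale (c n) (F n), ENNReal.mul_div_mul_left _ _ (hne _) ENNReal.coe_ne_top]

/-- Existence of thick Følner sequences. -/
theorem IsAmenable.exists_isThickFolner (hG : IsAmenable G) (θ : Measure G) [θ.IsHaarMeasure] :
    ∃ F, IsThickFolner θ F := by
  let K := CompactExhaustion.choice G
  -- Adjoining `1` to the exhausting compact set gives `F n ⊆ insert 1 (K n) * F n`, so the measure
  -- bound controls the difference of the two sets.
  have hex := fun n : ℕ => hG.exists_isCompact_measure_mul_le θ ((K.isCompact n).insert 1)
    (ε := 1 / ((n : ℝ) + 1)) (by positivity)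
  choose F hFc hF0 hFK using hex
  refine ⟨F, hFc, fun n => nonempty_of_measure_ne_zero (hF0 n), fun n => (hF0 n).bot_lt,
    fun L hL hLn => ?_⟩
  obtain ⟨k, hk⟩ := hLn
  obtain ⟨N, hN⟩ := K.exists_superset_of_isCompact hL
  have hlim : Tendsto (fun n : ℕ => 2 * ENNReal.ofReal (1 / ((n : ℝ) + 1))) atTop (𝓝 0) := by
    have h1 := ENNReal.tendsto_ofReal tendsto_one_div_add_atTop_nhds_zero_nat
    rw [ENNReal.ofReal_zero] at h1
    simpa using ENNReal.Tendsto.const_mul h1 (Or.inr ENNReal.ofNat_ne_top)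
  refine tendsto_of_tendsto_of_tendsto_of_le_of_le' tendsto_const_nhds hlim
    (Eventually.of_forall fun n => bot_le) ?_
  filter_upwards [eventually_ge_atTop N] with n hn
  have hfin : θ (F n) ≠ ⊤ := (hFc n).measure_lt_top.ne
  have hLK : L ⊆ insert 1 (K n) := (hN.trans (K.subset hn)).trans (Set.subset_insert _ _)
  have hsub : F n ⊆ insert 1 (K n) * F n := fun x hx => ⟨1, Set.mem_insert _ _, x, hx, one_mul x⟩
  have hmF : MeasurableSet (F n) := (hFc n).isClosed.measurableSet
  have h1 : θ ((insert 1 (K n) * F n) \ F n) ≤ ENNReal.ofReal (1 / ((n : ℝ) + 1)) * θ (F n) := by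
    rw [measure_sdiff hsub hmF.nullMeasurableSet hfin, tsub_le_iff_right]
    refine (hFK n).trans_eq ?_
    rw [ENNReal.ofReal_add zero_le_one (by positivity), ENNReal.ofReal_one]
    ring
  have h2 : θ ((L * F n) \ F n) ≤ ENNReal.ofReal (1 / ((n : ℝ) + 1)) * θ (F n) :=
    (measure_mono (Set.sdiff_subset_sdiff_left (Set.mul_subset_mul_right hLK))).trans h1
  -- This half needs `L` nonempty: `k • F n` lies in `L * F n` and has the same measure as `F n`, so
  -- the two one-sided differences of `F n` and `k • F n` have equal measure.
  have h3 : θ (F n \ (L * F n)) ≤ ENNReal.ofReal (1 / ((n : ℝ) + 1)) * θ (F n) := by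
    have hkF : k • F n ⊆ L * F n := by
      rintro _ ⟨x, hx, rfl⟩
      exact ⟨k, hk, x, hx, rfl⟩
    have hmk : MeasurableSet (k • F n) := ((hFc n).smul k).isClosed.measurableSet
    calc θ (F n \ (L * F n)) ≤ θ (F n \ (k • F n)) := measure_mono (Set.sdiff_subset_sdiff_right hkF)
      _ = θ ((k • F n) \ F n) := measure_sdiff_symm hmF.nullMeasurableSet hmk.nullMeasurableSet
          (measure_smul k (F n) (μ := θ)).symm
          ((measure_mono Set.inter_subset_left).trans_lt hfin.lt_top).ne
      _ ≤ θ ((L * F n) \ F n) := measure_mono (Set.sdiff_subset_sdiff_left hkF)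
      _ ≤ _ := h2
  rw [ENNReal.div_le_iff (hF0 n) hfin, Set.symmDiff_def]
  refine (measure_union_le _ _).trans ((add_le_add h3 h2).trans_eq ?_)
  ring

theorem isAveragingClass_isThickFolner (hG : IsAmenable G) (θ : Measure G) [θ.IsHaarMeasure]
    [θ.Regular] : IsAveragingClass X θ (IsThickFolner θ) where
  ne_zero F hF n := (hF.measure_pos n).ne'
  ne_top F hF n := (hF.isCompact n).measure_lt_top.ne
  asymptoticallyInvariant F hF := hF.asymptoticallyInvariant
  translate F hF c := hF.image_mul_right c
  avgOp_translate F hF n c f x := avgOp_image_mul_right (Measure.modularCharacterFun_pos c).ne'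
    (Measure.map_right_mul_eq_modularCharacterFun_smul θ c) (F n) f x
  nonempty := hG.exists_isThickFolner θ

end Thick

/-! ### Matching numbers and averages over matched sets -/

section Matching

variable {G : Type*} [Group G]

theorem bddAbove_ncard_subset {F : Set G} (hF : F.Finite) (p : Set G → Prop) :
    BddAbove {k : ℕ | ∃ M : Set G, M ⊆ F ∧ M.ncard = k ∧ p M} :=
  ⟨F.ncard, by rintro _ ⟨M, hM, rfl, -⟩; exact Set.ncard_le_ncard hM hF⟩

/-- The supremum is attained: the admissible cardinalities are bounded by that of `F`, and the empty
matching is admissible. -/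
theorem exists_eq_matchingNumber {F : Set G} (hF : F.Finite) (V E : Set G) :
    ∃ M : Set G, M ⊆ F ∧ M.ncard = matchingNumber V F E ∧
      ∃ φ : G → G, Set.InjOn φ M ∧ Set.MapsTo φ M E ∧ ∀ f ∈ M, ∃ v ∈ V, φ f = v * f :=
  Nat.sSup_mem (s := {k : ℕ | ∃ M : Set G, M ⊆ F ∧ M.ncard = k ∧
    ∃ φ : G → G, Set.InjOn φ M ∧ Set.MapsTo φ M E ∧ ∀ f ∈ M, ∃ v ∈ V, φ f = v * f})
    ⟨0, ∅, Set.empty_subset F, Set.ncard_empty G, id, Set.injOn_empty _, Set.mapsTo_empty _ _, by simp⟩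
    (bddAbove_ncard_subset hF _)

theorem exists_eq_rightMatchingNumber {F : Set G} (hF : F.Finite) (V E : Set G) :
    ∃ M : Set G, M ⊆ F ∧ M.ncard = rightMatchingNumber V F E ∧
      ∃ φ : G → G, Set.InjOn φ M ∧ Set.MapsTo φ M E ∧ ∀ f ∈ M, ∃ v ∈ V, φ f = f * v :=
  Nat.sSup_mem (s := {k : ℕ | ∃ M : Set G, M ⊆ F ∧ M.ncard = k ∧
    ∃ φ : G → G, Set.InjOn φ M ∧ Set.MapsTo φ M E ∧ ∀ f ∈ M, ∃ v ∈ V, φ f = f * v})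
    ⟨0, ∅, Set.empty_subset F, Set.ncard_empty G, id, Set.injOn_empty _, Set.mapsTo_empty _ _, by simp⟩
    (bddAbove_ncard_subset hF _)

theorem ncard_le_matchingNumber {F : Set G} (hF : F.Finite) {V E M : Set G} (hM : M ⊆ F)
    {φ : G → G} (hφ : Set.InjOn φ M) (hE : Set.MapsTo φ M E)
    (hV : ∀ f ∈ M, ∃ v ∈ V, φ f = v * f) : M.ncard ≤ matchingNumber V F E :=
  le_csSup (bddAbove_ncard_subset hF _) ⟨M, hM, rfl, φ, hφ, hE, hV⟩

theorem matchingNumber_le_ncard {F : Set G} (hF : F.Finite) (V E : Set G) :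
    matchingNumber V F E ≤ F.ncard := by
  obtain ⟨M, hM, h, -⟩ := exists_eq_matchingNumber hF V E
  exact h ▸ Set.ncard_le_ncard hM hF

theorem matchingNumber_le_image_mul_right {F : Set G} (hF : F.Finite) (V E : Set G) (c : G) :
    matchingNumber V F E ≤
      matchingNumber V ((fun h => h * c) '' F) ((fun h => h * c) '' E) := by
  obtain ⟨M, hM, h, φ, hφ, hE, hV⟩ := exists_eq_matchingNumber hF V E
  rw [← h, ← Set.ncard_image_of_injective M (mul_left_injective c)]
  refine ncard_le_matchingNumber (hF.image _) (Set.image_mono hM)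
    (φ := fun y => φ (y * c⁻¹) * c) ?_ ?_ ?_
  · rintro _ ⟨a, ha, rfl⟩ _ ⟨b, hb, rfl⟩ hab
    simp only [mul_inv_cancel_right, mul_left_inj] at hab ⊢
    exact hφ ha hb hab
  · rintro _ ⟨a, ha, rfl⟩
    simp only [mul_inv_cancel_right]
    exact ⟨_, hE ha, rfl⟩
  · rintro _ ⟨a, ha, rfl⟩
    obtain ⟨v, hv, h⟩ := hV a ha
    exact ⟨v, hv, by simp [h, mul_assoc]⟩

/-- Sums over two sets with an almost perfect matching along which the summand is almost
constant. -/
theorem abs_sum_sub_sum_le_of_matching {α : Type*} {A B M : Finset α}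
    (hAB : A.card = B.card) (hM : M ⊆ A) {φ : α → α} (hφ : Set.InjOn φ M)
    (hφB : ∀ a ∈ M, φ a ∈ B) {u : α → ℝ} {C ε : ℝ} (hε : 0 ≤ ε) (hC : ∀ a, |u a| ≤ C)
    (hu : ∀ a ∈ M, |u (φ a) - u a| ≤ ε) :
    |∑ b ∈ B, u b - ∑ a ∈ A, u a| ≤ ε * A.card + 2 * C * (A.card - M.card) := by
  classical
  have himg : M.image φ ⊆ B := Finset.image_subset_iff.2 hφB
  have hcard : (M.image φ).card = M.card := Finset.card_image_of_injOn hφ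
  have bound : ∀ S : Finset α, |∑ a ∈ S, u a| ≤ C * S.card := fun S => by
    refine (Finset.abs_sum_le_sum_abs _ _).trans ((Finset.sum_le_sum fun a _ => hC a).trans_eq ?_)
    rw [Finset.sum_const, nsmul_eq_mul, mul_comm]
  have h1 : |∑ a ∈ M, (u (φ a) - u a)| ≤ ε * A.card := by
    refine (Finset.abs_sum_le_sum_abs _ _).trans ((Finset.sum_le_sum hu).trans ?_)
    rw [Finset.sum_const, nsmul_eq_mul, mul_comm]
    exact mul_le_mul_of_nonneg_left (by exact_mod_cast Finset.card_le_card hM) hε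
  have h2 := bound (B \ M.image φ)
  have h3 := bound (A \ M)
  rw [Finset.cast_card_sdiff himg, hcard, ← hAB] at h2
  rw [Finset.cast_card_sdiff hM] at h3
  have e1 := Finset.sum_sdiff (f := u) himg
  have e2 := Finset.sum_sdiff (f := u) hM
  rw [Finset.sum_image hφ] at e1
  rw [Finset.sum_sub_distrib] at h1
  rw [← e1, ← e2]
  rw [abs_le] at *
  constructor <;> linarith [h1.1, h1.2, h2.1, h2.2, h3.1, h3.2]

/-- The parameter `y` records uniformity. It is a point of `X` for ordinary thin sequences and
trivial in the mirrored case. -/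
theorem tendsto_avg_sub_avg_of_matching {α : Type*} {A B : ℕ → Finset α}
    (hA : ∀ n, (A n).Nonempty) (hAB : ∀ n, (A n).card = (B n).card) {Y : Type*}
    {u : Y → α → ℝ} {C : ℝ} (hC : ∀ y a, |u y a| ≤ C)
    (hM : ∀ ε > 0, ∃ k : ℕ → ℕ, Tendsto (fun n => (k n : ℝ) / (A n).card) atTop (𝓝 1) ∧
      ∀ n, ∃ M ⊆ A n, M.card = k n ∧ ∃ φ : α → α, Set.InjOn φ M ∧ (∀ a ∈ M, φ a ∈ B n) ∧
        ∀ y, ∀ a ∈ M, |u y (φ a) - u y a| ≤ ε) {ε : ℝ} (hε : 0 < ε) :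
    ∀ᶠ n in atTop, ∀ y,
      |((A n).card : ℝ)⁻¹ * ∑ b ∈ B n, u y b - ((A n).card : ℝ)⁻¹ * ∑ a ∈ A n, u y a| ≤ ε := by
  obtain ⟨k, hk, hmatch⟩ := hM (ε / 2) (half_pos hε)
  have hlim : Tendsto (fun n => ε / 2 + 2 * C * (1 - (k n : ℝ) / (A n).card)) atTop
      (𝓝 (ε / 2 + 2 * C * (1 - 1))) := ((hk.const_sub 1).const_mul (2 * C)).const_add (ε / 2)
  have hlt : ε / 2 + 2 * C * (1 - 1) < ε := by linarith
  filter_upwards [hlim.eventually_lt_const hlt] with n hn y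
  obtain ⟨M, hMA, hMk, φ, hφ, hφB, hu⟩ := hmatch n
  have hpos : (0 : ℝ) < (A n).card := by exact_mod_cast (hA n).card_pos
  have h := abs_sum_sub_sum_le_of_matching (hAB n) hMA hφ hφB (half_pos hε).le (hC y) (hu y)
  rw [← mul_sub, abs_mul, abs_of_nonneg (inv_nonneg.2 hpos.le)]
  refine le_trans (mul_le_mul_of_nonneg_left h (inv_nonneg.2 hpos.le)) (le_trans (le_of_eq ?_) hn.le)
  rw [hMk]
  field_simp

end Matching

/-! ### Thin Følner sequences -/

section Thin

variable {G : Type*} [Group G] [TopologicalSpace G] [IsTopologicalGroup G] [T2Space G]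
  [MeasurableSpace G] [BorelSpace G]
variable {X : Type*} [MetricSpace X] [CompactSpace X] [MulAction G X] [ContinuousSMul G X]

theorem avgOp_count (s : Finset G) (f : C(X, ℝ)) (x : X) :
    avgOp X Measure.count (s : Set G) f x = (s.card : ℝ)⁻¹ * ∑ h ∈ s, f (h • x) := by
  have hinteg : IntegrableOn (fun g => f (g • x)) (s : Set G) Measure.count := by
    have : IsFiniteMeasure ((Measure.count : Measure G).restrict (s : Set G)) := ⟨by simp⟩
    exact integrable_orbit _ f x
  rw [avgOp_eq_inv_mul, setIntegral_finset _ (hf := hinteg)]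
  simp [measureReal_def]

theorem avgOp_count_image_mul_right (F : Set G) (c : G) (f : C(X, ℝ)) (x : X) :
    avgOp X Measure.count ((fun h => h * c) '' F) f x = avgOp X Measure.count F f (c • x) := by
  refine avgOp_image_mul_right one_ne_zero ?_ F f x
  rw [one_smul]
  exact map_mul_right_eq_self _ c

/-- A matched pair differs by a small left factor `v`, and `f (v • y)` is close to `f y` uniformly
in `y`, in particular for `y = a • x`. -/
theorem abs_avgOp_count_sub_le {F E : ℕ → Set G} (hF : ∀ n, (F n).Finite)
    (hne : ∀ n, (F n).Nonempty) (hE : ∀ n, (E n).Finite) (hFE : ∀ n, (E n).ncard = (F n).ncard)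
    (h : ∀ V : Set G, IsOpen V → (1 : G) ∈ V →
      Tendsto (fun n => (matchingNumber V (F n) (E n) : ℝ) / (F n).ncard) atTop (𝓝 1))
    (f : C(X, ℝ)) {ε : ℝ} (hε : 0 < ε) :
    ∀ᶠ n in atTop, ∀ x, |avgOp X Measure.count (E n) f x - avgOp X Measure.count (F n) f x| ≤ ε := by
  classical
  have hcF : ∀ n, ((hF n).toFinset).card = (F n).ncard := fun n =>
    (Set.ncard_eq_toFinset_card _ (hF n)).symm
  have hcE : ∀ n, ((hE n).toFinset).card = (E n).ncard := fun n =>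
    (Set.ncard_eq_toFinset_card _ (hE n)).symm
  have key := tendsto_avg_sub_avg_of_matching (A := fun n => (hF n).toFinset)
    (B := fun n => (hE n).toFinset) (fun n => (hF n).toFinset_nonempty.2 (hne n))
    (fun n => by rw [hcF, hcE, hFE]) (u := fun (x : X) g => f (g • x)) (C := ‖f‖)
    (fun x g => f.norm_coe_le_norm _) (fun δ hδ => ?_) hε
  · filter_upwards [key] with n hn x
    have e1 := avgOp_count (hF n).toFinset f x
    have e2 := avgOp_count (hE n).toFinset f x
    rw [Set.Finite.coe_toFinset] at e1 e2
    rw [e1, e2, hcE, hFE, ← hcF]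
    exact hn x
  · obtain ⟨V, hVu, hVo, hV1⟩ := mem_nhds_iff.1 (eventually_forall_abs_smul_sub_lt (G := G) f hδ)
    refine ⟨_, by simpa only [hcF] using h V hVo hV1, fun n => ?_⟩
    obtain ⟨M, hM, hMk, φ, hφ, hφE, hφV⟩ := exists_eq_matchingNumber (hF n) V (E n)
    have hMf := (hF n).subset hM
    refine ⟨hMf.toFinset, by simpa using hM, ?_, φ, by simpa using hφ,
      fun a ha => by simpa using hφE (by simpa using ha), fun x a ha => ?_⟩
    · rw [← Set.ncard_eq_toFinset_card _ hMf, hMk]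
    · obtain ⟨v, hv, e⟩ := hφV a (by simpa using ha)
      rw [e, mul_smul]
      exact (hVu hv (a • x)).le

theorem IsThinFolner.asymptoticallyInvariant {F : ℕ → Set G} (hF : IsThinFolner F) :
    AsymptoticallyInvariant X Measure.count F := by
  intro g f
  refine Metric.tendsto_nhds.2 fun ε hε => ?_
  filter_upwards [abs_avgOp_count_sub_le hF.finite hF.nonempty (fun n => (hF.finite n).image _)
    (fun n => Set.ncard_image_of_injective _ (mul_right_injective g)) (hF.tendsto g) f
    (half_pos hε)] with n hn
  rw [dist_zero_right]
  refine lt_of_le_of_lt ((ContinuousMap.norm_le _ (by positivity)).2 fun x => ?_) (half_lt_self hε)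
  refine le_trans (le_of_eq ?_) (hn x)
  rw [ContinuousMap.sub_apply, Real.norm_eq_abs]
  congr 2
  have e1 := avgOp_count (hF.finite n).toFinset (translate g f) x
  have e2 := avgOp_count ((hF.finite n).image (fun h => g * h)).toFinset f x
  have e3 : ((hF.finite n).image (fun h => g * h)).toFinset.card = (hF.finite n).toFinset.card := by
    rw [← Set.ncard_eq_toFinset_card _ _, ← Set.ncard_eq_toFinset_card _ _,
      Set.ncard_image_of_injective _ (mul_right_injective g)]
  rw [Set.Finite.coe_toFinset] at e1 e2
  rw [e1, e2, e3]
  congr 1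
  symm
  refine Finset.sum_bij' (fun h _ => g⁻¹ * h) (fun h _ => g * h) ?_ ?_ ?_ ?_ ?_
  · simp
  · simp
  · simp
  · simp
  · intro h _
    simp [translate, smul_smul]

theorem IsRightThinFolner.tendsto_sub {F : ℕ → Set G} (hF : IsRightThinFolner F) (f : C(X, ℝ))
    (g : G) (x : X) :
    Tendsto (fun n => avgOp X Measure.count (F n) f (g • x) - avgOp X Measure.count (F n) f x)
      atTop (𝓝 0) := by
  refine Metric.tendsto_nhds.2 fun ε hε => ?_
  filter_upwards [abs_avgOp_count_sub_le hF.finite hF.nonempty (fun n => (hF.finite n).image _)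
    (fun n => Set.ncard_image_of_injective _ (mul_left_injective g)) (hF.tendsto g) f
    (half_pos hε)] with n hn
  rw [dist_zero_right, Real.norm_eq_abs, ← avgOp_count_image_mul_right]
  exact (hn x).trans_lt (half_lt_self hε)

/-- Left displacements commute with right translations, so a matching is carried over unchanged. -/
theorem IsThinFolner.image_mul_right {F : ℕ → Set G} (hF : IsThinFolner F) (c : ℕ → G) :
    IsThinFolner fun n => (fun h => h * c n) '' F n := by
  refine ⟨fun n => (hF.finite n).image _, fun n => (hF.nonempty n).image _, fun g V hV h1 => ?_⟩
  refine tendsto_of_tendsto_of_tendsto_of_le_of_le (hF.tendsto g V hV h1) tendsto_const_nhds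
    (fun n => ?_) (fun n => ?_)
  · have e : (fun h => g * h) '' ((fun h => h * c n) '' F n) =
        (fun h => h * c n) '' ((fun h => g * h) '' F n) := by
      simp only [Set.image_image, mul_assoc]
    simp only
    rw [e, Set.ncard_image_of_injective _ (mul_left_injective (c n))]
    gcongr
    exact matchingNumber_le_image_mul_right (hF.finite n) _ _ _
  · refine div_le_one_of_le₀ ?_ (by positivity)
    exact Nat.cast_le.2 (matchingNumber_le_ncard ((hF.finite n).image _) _ _)

theorem isAveragingClass_isThinFolner (h : ∃ F : ℕ → Set G, IsThinFolner F) :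
    IsAveragingClass X (Measure.count : Measure G) IsThinFolner where
  ne_zero F hF n := by simpa using (hF.nonempty n).ne_empty
  ne_top F hF n := (Measure.count_apply_lt_top.2 (hF.finite n)).ne
  asymptoticallyInvariant F hF := hF.asymptoticallyInvariant
  translate F hF c := hF.image_mul_right c
  avgOp_translate F hF n c f x := avgOp_count_image_mul_right (F n) c f x
  nonempty := h

end Thin

/-! ### Existence of thin Følner sequences -/

section ThinExistence

variable {G : Type*} [Group G] [TopologicalSpace G] [IsTopologicalGroup G]

/-- An equicontinuous family of functions separating sets from the complements of their
`V`-neighbourhoods. -/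
theorem exists_equicontinuous_separating [FirstCountableTopology G] {V : Set G}
    (hV : V ∈ 𝓝 (1 : G)) :
    ∃ f : {S : Set G // S.Nonempty} → G → ℝ,
      (∀ S y, 0 ≤ f S y) ∧ (∀ S y, f S y ≤ 1) ∧ (∀ S, ∀ y ∈ S.1, f S y = 1) ∧
      (∀ S y, f S y ≠ 0 → ∃ s ∈ S.1, ∃ v ∈ V, y = v * s) ∧
      ∀ ε > 0, ∀ᶠ u in 𝓝 (1 : G), ∀ S y, |f S (u * y) - f S y| < ε := by
  -- First countability makes the right uniformity pseudometrizable; the functions are truncated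
  -- distances to `S` for such a pseudometric, with `r` chosen so that `r`-balls stay within
  -- `V`-translates.
  let _ : UniformSpace G := IsTopologicalGroup.rightUniformSpace G
  have hcg : (uniformity G).IsCountablyGenerated :=
    inferInstanceAs (comap (fun p : G × G => p.2 * p.1⁻¹) (𝓝 (1 : G))).IsCountablyGenerated
  let _ : PseudoMetricSpace G := UniformSpace.pseudoMetricSpace G
  have hbasis : uniformity G = comap (fun p : G × G => p.2 * p.1⁻¹) (𝓝 (1 : G)) := rfl
  have hVu : {p : G × G | p.2 * p.1⁻¹ ∈ V} ∈ uniformity G := by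
    rw [hbasis]
    exact preimage_mem_comap hV
  obtain ⟨r, hr, hrV⟩ := Metric.mem_uniformity_dist.1 hVu
  refine ⟨fun S y => max 0 (1 - Metric.infDist y S.1 / r), fun S y => le_max_left _ _,
    fun S y => max_le zero_le_one ?_, fun S y hy => ?_, fun S y h => ?_, fun ε hε => ?_⟩
  · have : 0 ≤ Metric.infDist y S.1 / r := div_nonneg Metric.infDist_nonneg hr.le
    linarith
  · simp [Metric.infDist_zero_of_mem hy]
  · have h1 : 0 < 1 - Metric.infDist y S.1 / r := by
      by_contra h'
      exact h (max_eq_left (not_lt.1 h'))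
    have h2 : Metric.infDist y S.1 < r := by
      rw [sub_pos, div_lt_one hr] at h1
      exact h1
    obtain ⟨s, hs, hys⟩ := (Metric.infDist_lt_iff S.2).1 h2
    rw [dist_comm] at hys
    exact ⟨s, hs, y * s⁻¹, hrV hys, by group⟩
  · have hu := Metric.dist_mem_uniformity (α := G) (mul_pos hε hr)
    rw [hbasis, mem_comap] at hu
    obtain ⟨U, hU, hUd⟩ := hu
    filter_upwards [hU] with u hu S y
    have h1 : dist y (u * y) < ε * r := hUd (a := (y, u * y)) (by simpa using hu)
    have h2 := Metric.infDist_le_infDist_add_dist (s := S.1) (x := u * y) (y := y)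
    have h3 := Metric.infDist_le_infDist_add_dist (s := S.1) (x := y) (y := u * y)
    rw [dist_comm] at h2
    refine (abs_max_sub_max_le_max _ _ _ _).trans_lt ?_
    rw [sub_self, abs_zero, max_lt_iff]
    refine ⟨hε, ?_⟩
    have e : 1 - Metric.infDist (u * y) S.1 / r - (1 - Metric.infDist y S.1 / r) =
        (Metric.infDist y S.1 - Metric.infDist (u * y) S.1) / r := by ring
    rw [e, abs_div, abs_of_pos hr, div_lt_iff₀ hr, abs_lt]
    constructor <;> linarith

/-- Almost invariance for uniform distributions on finite families. -/
theorem IsAmenable.exists_almost_invariant_uniform (hG : IsAmenable G) {I : Type*} (f : I → G → ℝ)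
    (hC : ∀ i x, |f i x| ≤ 1)
    (hf : ∀ ε > 0, ∀ᶠ u in 𝓝 (1 : G), ∀ i x, |f i (u * x) - f i x| < ε)
    (E : Finset G) {ε : ℝ} (hε : 0 < ε) :
    ∃ (J : Type) (_ : Fintype J) (_ : Nonempty J) (q : J → G),
      ∀ g ∈ E, ∀ i, |∑ j, (f i (g * q j) - f i (q j))| ≤ ε * Fintype.card J := by
  obtain ⟨ι, t, w, p, hw0, hw1, hwE⟩ := hG.exists_almost_invariant f hC hf E (half_pos hε)
  let T : ℝ := t.card
  have hT : 0 ≤ T := Nat.cast_nonneg _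
  -- Each `p j` is repeated about `N * w j` times. Rounding costs at most `2 * T` in the sum and `T`
  -- in the cardinality of `J`; this `N` makes both negligible.
  obtain ⟨N, hN⟩ := exists_nat_gt ((2 * T + ε * T) / (ε / 2) + T)
  let n : ι → ℕ := fun j => ⌊N * w j⌋₊
  have hn1 : ∀ j ∈ t, (n j : ℝ) ≤ N * w j := fun j hj =>
    Nat.floor_le (mul_nonneg (Nat.cast_nonneg _) (hw0 j hj))
  have hn2 : ∀ j, N * w j < n j + 1 := fun j => Nat.lt_floor_add_one _
  let J := Σ j : t, Fin (n j)
  have hcard : (Fintype.card J : ℝ) = ∑ j ∈ t, (n j : ℝ) := by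
    rw [Fintype.card_sigma]
    simp only [Fintype.card_fin]
    rw [Finset.sum_coe_sort t n]
    push_cast
    rfl
  have hNT : N - T ≤ Fintype.card J := by
    have h : ∑ j ∈ t, N * w j ≤ ∑ j ∈ t, ((n j : ℝ) + 1) :=
      Finset.sum_le_sum fun j _ => (hn2 j).le
    rw [← Finset.mul_sum, hw1, Finset.sum_add_distrib, ← hcard] at h
    simp only [Finset.sum_const, nsmul_eq_mul, mul_one] at h
    linarith
  have hq0 : 0 ≤ (2 * T + ε * T) / (ε / 2) := by positivity
  have hne : Nonempty J := by
    rw [← Fintype.card_pos_iff]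
    have : (0 : ℝ) < Fintype.card J := by linarith
    exact_mod_cast this
  refine ⟨J, inferInstance, hne, fun j => p j.1, fun g hg i => ?_⟩
  let a : ι → ℝ := fun j => f i (g * p j) - f i (p j)
  have ha : ∀ j, |a j| ≤ 2 := fun j => by
    have h1 := abs_le.1 (hC i (g * p j))
    have h2 := abs_le.1 (hC i (p j))
    exact abs_le.2 ⟨by simp only [a]; linarith, by simp only [a]; linarith⟩
  have hsum : ∑ j : J, a j.1 = ∑ j ∈ t, n j * a j := by
    rw [Fintype.sum_sigma]
    simp only [Finset.sum_const, Finset.card_univ, Fintype.card_fin, nsmul_eq_mul]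
    exact Finset.sum_coe_sort t fun j => (n j : ℝ) * a j
  change |∑ j : J, a j.1| ≤ _
  rw [hsum]
  have h1 : |∑ j ∈ t, (n j * a j - N * (w j * a j))| ≤ 2 * T := by
    refine (Finset.abs_sum_le_sum_abs _ _).trans
      ((Finset.sum_le_sum (g := fun _ => (2 : ℝ)) fun j hj => ?_).trans_eq ?_)
    · rw [← mul_assoc, ← sub_mul, abs_mul]
      have h2 : |(n j : ℝ) - N * w j| ≤ 1 := abs_le.2 ⟨by linarith [hn2 j], by linarith [hn1 j hj]⟩
      calc _ ≤ 1 * (2 : ℝ) := mul_le_mul h2 (ha j) (abs_nonneg _) zero_le_one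
        _ = 2 := one_mul 2
    · rw [Finset.sum_const, nsmul_eq_mul, mul_comm]
  rw [Finset.sum_sub_distrib, ← Finset.mul_sum] at h1
  have h2 : |(N : ℝ) * ∑ j ∈ t, w j * a j| ≤ N * (ε / 2) := by
    rw [abs_mul, Nat.abs_cast]
    exact mul_le_mul_of_nonneg_left (hwE g hg i) (Nat.cast_nonneg _)
  have h3 : 2 * T + ε * T ≤ (N - T) * (ε / 2) := by
    have : (2 * T + ε * T) / (ε / 2) ≤ N - T := by linarith
    rwa [div_le_iff₀ (half_pos hε)] at this
  have h4 : ε * (N - T) ≤ ε * Fintype.card J := mul_le_mul_of_nonneg_left hNT hε.le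
  rw [abs_le] at *
  constructor <;> nlinarith [h1.1, h1.2, h2.1, h2.2, mul_nonneg hε.le hT]

/-- Hall's marriage theorem with deficiency. -/
theorem exists_injOn_of_card_le_add {J : Type*} [Fintype J] (r : J → J → Prop) (D : ℕ)
    (h : ∀ A : Finset J, A.Nonempty → ∃ B : Finset J, (∀ b ∈ B, ∃ a ∈ A, r a b) ∧
      A.card ≤ B.card + D) :
    ∃ (M : Finset J) (σ : J → J), Set.InjOn σ M ∧ (∀ i ∈ M, r i (σ i)) ∧
      Fintype.card J ≤ M.card + D := by
  classical
  -- Hall's condition holds after adding `D` dummy partners acceptable to everyone; those matched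
  -- with dummies, at most `D` of them, are then discarded.
  have key : ∀ A : Finset J, A.card ≤
      (A.biUnion fun a => (Finset.univ.filter (r a)).disjSum (Finset.univ : Finset (Fin D))).card := by
    intro A
    rcases A.eq_empty_or_nonempty with rfl | hA
    · simp
    obtain ⟨B, hB, hAB⟩ := h A hA
    refine hAB.trans ?_
    have : B.card + D = (B.disjSum (Finset.univ : Finset (Fin D))).card := by simp
    rw [this]
    refine Finset.card_le_card fun x hx => ?_
    rw [Finset.mem_biUnion]
    rcases x with b | d
    · obtain ⟨a, ha, hr⟩ := hB b (by simpa using hx)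
      exact ⟨a, ha, by simpa using hr⟩
    · obtain ⟨a, ha⟩ := hA
      exact ⟨a, ha, by simp⟩
  obtain ⟨φ, hφ, hφr⟩ := (Finset.all_card_le_biUnion_card_iff_exists_injective _).1 key
  refine ⟨Finset.univ.filter fun i => (φ i).isLeft, fun i => (φ i).elim id fun _ => i, ?_, ?_, ?_⟩
  · intro i hi j hj hij
    have hi' : (φ i).isLeft := by simpa using hi
    have hj' : (φ j).isLeft := by simpa using hj
    obtain ⟨a, ha⟩ := Sum.isLeft_iff.1 hi'
    obtain ⟨b, hb⟩ := Sum.isLeft_iff.1 hj'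
    refine hφ ?_
    simp only [ha, hb, Sum.elim_inl, id] at hij ⊢
    rw [hij]
  · intro i hi
    have hi' : (φ i).isLeft := by simpa using hi
    obtain ⟨a, ha⟩ := Sum.isLeft_iff.1 hi'
    have := hφr i
    simp only [ha, Sum.elim_inl, id] at this ⊢
    simpa using this
  · have h1 := Finset.card_filter_add_card_filter_not (s := (Finset.univ : Finset J))
      (fun i => (φ i).isLeft = true)
    have h2 : (Finset.univ.filter fun i => ¬ (φ i).isLeft = true).card ≤ D := by
      have : (Finset.univ.filter fun i => ¬ (φ i).isLeft = true).card ≤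
          ((Finset.univ : Finset (Fin D)).image (Sum.inr : Fin D → J ⊕ Fin D)).card := by
        refine Finset.card_le_card_of_injOn φ (fun i hi => ?_) hφ.injOn
        have hi' : ¬ (φ i).isLeft = true := by simpa using hi
        rcases hd : φ i with b | d
        · simp [hd] at hi'
        · simp
      refine this.trans (Finset.card_image_le.trans ?_)
      simp
    rw [Finset.card_univ] at h1
    omega

/-- Finite families in a non-discrete group can be made injective by small perturbations. -/
theorem exists_injective_mul_mem (hnd : ¬ DiscreteTopology G) [T1Space G] {J : Type*} [Fintype J]
    (q : J → G) {V : Set G} (hV : V ∈ 𝓝 (1 : G)) :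
    ∃ v : J → G, (∀ j, v j ∈ V) ∧ Function.Injective fun j => v j * q j := by
  classical
  have hne : (𝓝[≠] (1 : G)).NeBot := by
    refine ⟨fun h => hnd ?_⟩
    rw [discreteTopology_iff_isOpen_singleton_one, isOpen_singleton_iff_punctured_nhds]
    exact h
  have hinf : V.Infinite := infinite_of_mem_nhds 1 hV
  -- Each `j` may choose from `T * q j`, which has as many elements as `J`, so Hall's condition is
  -- automatic.
  obtain ⟨T, hTV, hTc⟩ := hinf.exists_subset_card_eq (Fintype.card J)
  have key : ∀ A : Finset J, A.card ≤ (A.biUnion fun j => T.image fun v => v * q j).card := by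
    intro A
    rcases A.eq_empty_or_nonempty with rfl | ⟨j, hj⟩
    · simp
    calc A.card ≤ T.card := hTc ▸ Finset.card_le_univ A
      _ = (T.image fun v => v * q j).card :=
        (Finset.card_image_of_injective _ (mul_left_injective (q j))).symm
      _ ≤ _ := Finset.card_le_card
        (Finset.subset_biUnion_of_mem (fun j => T.image fun v => v * q j) hj)
  obtain ⟨φ, hφ, hφT⟩ := (Finset.all_card_le_biUnion_card_iff_exists_injective _).1 key
  refine ⟨fun j => φ j * (q j)⁻¹, fun j => ?_, by simpa using hφ⟩
  obtain ⟨v, hv, e⟩ := Finset.mem_image.1 (hφT j)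
  simp only [← e]
  simpa using hTV hv

/-- Almost invariance of a uniform distribution, tested on functions separating sets from the
complements of their `U`-neighbourhoods, is Hall's condition with deficiency. The points of the
distribution may repeat, and non-discreteness allows them to be made distinct by small
perturbations. -/
theorem IsAmenable.exists_finite_matching_of_not_discrete (hG : IsAmenable G) [T1Space G]
    [FirstCountableTopology G] (hnd : ¬ DiscreteTopology G) (E : Finset G) {V : Set G}
    (hV : V ∈ 𝓝 (1 : G)) {ε : ℝ} (hε : 0 < ε) :
    ∃ F : Set G, F.Finite ∧ F.Nonempty ∧ ∀ g ∈ E,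
      (1 - ε) * F.ncard ≤ matchingNumber V F ((fun h => g * h) '' F) := by
  classical
  obtain ⟨U, hU, hUV⟩ : ∃ U ∈ 𝓝 (1 : G), ∀ a ∈ U, ∀ b ∈ U, ∀ c ∈ U, a * b * c⁻¹ ∈ V := by
    have hcont : Continuous fun z : G × G × G => z.1 * z.2.1 * z.2.2⁻¹ := by fun_prop
    have h := hcont.tendsto (1, 1, 1)
    simp only [mul_one, inv_one] at h
    have h1 := h hV
    rw [mem_map, nhds_prod_eq, nhds_prod_eq] at h1
    obtain ⟨A, hA, B, hB, hAB⟩ := mem_prod_iff.1 h1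
    obtain ⟨B₁, hB₁, B₂, hB₂, hB12⟩ := mem_prod_iff.1 hB
    exact ⟨A ∩ (B₁ ∩ B₂), inter_mem hA (inter_mem hB₁ hB₂), fun a ha b hb c hc =>
      hAB (a := (a, b, c)) ⟨ha.1, hB12 ⟨hb.2.1, hc.2.2⟩⟩⟩
  obtain ⟨f, hf0, hf1, hfS, hfV, hfu⟩ := exists_equicontinuous_separating hU
  obtain ⟨J, _, _, q, hq⟩ := hG.exists_almost_invariant_uniform f
    (fun S y => abs_le.2 ⟨by linarith [hf0 S y], hf1 S y⟩) hfu E hε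
  have hW : U ∩ ⋂ g ∈ E, {v | g * v * g⁻¹ ∈ U} ∈ 𝓝 (1 : G) := by
    refine inter_mem hU ((Filter.biInter_finset_mem E).2 fun g _ => ?_)
    have : Tendsto (fun v : G => g * v * g⁻¹) (𝓝 1) (𝓝 1) := by
      have hc : Continuous fun v : G => g * v * g⁻¹ := by fun_prop
      simpa using hc.tendsto 1
    exact this hU
  obtain ⟨v, hv, hinj⟩ := exists_injective_mul_mem hnd q hW
  let r : J → G := fun j => v j * q j
  replace hinj : Function.Injective r := hinj
  have hncard : (Set.range r).ncard = Fintype.card J := by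
    rw [← Set.image_univ, Set.ncard_image_of_injective _ hinj, Set.ncard_univ,
      Nat.card_eq_fintype_card]
  refine ⟨Set.range r, Set.finite_range r, Set.range_nonempty r, fun g hg => ?_⟩
  have hHall : ∀ A : Finset J, A.Nonempty → ∃ B : Finset J,
      (∀ b ∈ B, ∃ a ∈ A, ∃ u ∈ U, g * q b = u * q a) ∧ A.card ≤ B.card + ⌊ε * Fintype.card J⌋₊ := by
    intro A hA
    -- The function of `S` counts every index in `A`, and at `g * q j` it is at most the indicator
    -- of being close to some `q a`. Its almost invariance bounds the deficiency by `ε` times the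
    -- cardinality of `J`.
    let S : {S : Set G // S.Nonempty} := ⟨q '' A, hA.to_set.image q⟩
    refine ⟨Finset.univ.filter fun j => f S (g * q j) ≠ 0, fun j hj => ?_, ?_⟩
    · obtain ⟨_, ⟨i, hi, rfl⟩, a, ha, e⟩ := hfV S (g * q j) (by simpa using hj)
      exact ⟨i, hi, a, ha, e⟩
    · have h1 : ∑ j, f S (g * q j) ≤ (Finset.univ.filter fun j => f S (g * q j) ≠ 0).card := by
        rw [← Finset.sum_filter_ne_zero]
        refine (Finset.sum_le_sum fun j _ => hf1 S (g * q j)).trans_eq ?_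
        simp
      have h2 : (A.card : ℝ) ≤ ∑ j, f S (q j) := by
        calc (A.card : ℝ) = ∑ j ∈ A, f S (q j) := by
              rw [Finset.sum_congr rfl fun j hj => hfS S (q j) ⟨j, hj, rfl⟩]
              simp
          _ ≤ _ := Finset.sum_le_sum_of_subset_of_nonneg (Finset.subset_univ _)
              fun j _ _ => hf0 S (q j)
      have h3 := (abs_le.1 (hq g hg S)).1
      rw [Finset.sum_sub_distrib] at h3
      have h4 : (A.card : ℝ) - (Finset.univ.filter fun j => f S (g * q j) ≠ 0).card ≤
          ε * Fintype.card J := by linarith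
      rw [← Nat.sub_le_iff_le_add']
      refine Nat.le_floor ?_
      rcases le_total A.card (Finset.univ.filter fun j => f S (g * q j) ≠ 0).card with h | h
      · rw [Nat.sub_eq_zero_of_le h]
        push_cast
        positivity
      · rwa [Nat.cast_sub h]
  obtain ⟨M, σ, hσ, hσr, hM⟩ := exists_injOn_of_card_le_add _ _ hHall
  have h1 : (r '' M).ncard ≤ matchingNumber V (Set.range r) ((fun h => g * h) '' Set.range r) := by
    refine ncard_le_matchingNumber (Set.finite_range r) (Set.image_subset_range _ _)
      (φ := fun y => g * r (σ (Function.invFun r y))) ?_ ?_ ?_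
    · rintro _ ⟨i, hi, rfl⟩ _ ⟨j, hj, rfl⟩ hij
      simp only [Function.leftInverse_invFun hinj i, Function.leftInverse_invFun hinj j,
        mul_right_inj] at hij
      rw [hσ hi hj (hinj hij)]
    · rintro _ ⟨i, hi, rfl⟩
      exact ⟨_, ⟨_, rfl⟩, rfl⟩
    · rintro _ ⟨i, hi, rfl⟩
      rw [Function.leftInverse_invFun hinj i]
      obtain ⟨a, ha, e⟩ := hσr i hi
      have h2 : g * v (σ i) * g⁻¹ ∈ U := Set.mem_iInter₂.1 (hv (σ i)).2 g hg
      -- The total displacement of `r i` is `(g * v (σ i) * g⁻¹) * a * (v i)⁻¹`: the conjugated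
      -- perturbation of the image, the Hall displacement, and the inverse perturbation of the
      -- source.
      refine ⟨_, hUV _ h2 _ ha _ (hv i).1, ?_⟩
      have e' : q (σ i) = g⁻¹ * (a * q i) := by rw [← e]; group
      simp only [r, e']
      group
  rw [Set.ncard_image_of_injective _ hinj, Set.ncard_coe_finset] at h1
  have h2 : (Fintype.card J : ℝ) ≤ M.card + ⌊ε * Fintype.card J⌋₊ := by exact_mod_cast hM
  have h3 : (⌊ε * Fintype.card J⌋₊ : ℝ) ≤ ε * Fintype.card J := Nat.floor_le (by positivity)
  have h4 : (M.card : ℝ) ≤ matchingNumber V (Set.range r) ((fun h => g * h) '' Set.range r) := by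
    exact_mod_cast h1
  rw [hncard]
  linarith

/-- Absorbs a small left factor of the translating element into the displacement; this reduces all
translations to a countable dense set of them. -/
theorem matchingNumber_le_mul_left {G : Type*} [Group G] {F : Set G} (hF : F.Finite)
    {V W : Set G} (g k : G) (hkV : ∀ v ∈ V, k * v ∈ W) :
    matchingNumber V F ((fun h => g * h) '' F) ≤
      matchingNumber W F ((fun h => k * g * h) '' F) := by
  obtain ⟨M, hM, h, φ, hφ, hE, hV⟩ := exists_eq_matchingNumber hF V ((fun h => g * h) '' F)
  rw [← h]
  refine ncard_le_matchingNumber hF hM (φ := fun y => k * φ y) ?_ ?_ ?_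
  · intro a ha b hb hab
    exact hφ ha hb (mul_left_cancel hab)
  · intro a ha
    obtain ⟨b, hb, e⟩ := hE ha
    exact ⟨b, hb, by simp only [← e, mul_assoc]⟩
  · intro a ha
    obtain ⟨v, hv, e⟩ := hV a ha
    exact ⟨k * v, hkV v hv, by rw [e, mul_assoc]⟩

theorem isHaarMeasure_count [DiscreteTopology G] [MeasurableSpace G] [BorelSpace G] :
    (Measure.count : Measure G).IsHaarMeasure where
  lt_top_of_isCompact K hK := Measure.count_apply_lt_top.2 hK.finite_of_discrete
  map_mul_left_eq_self g := map_mul_left_eq_self _ g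
  open_pos U hU hne := by simpa using hne.ne_empty

/-- Repeated points cannot be perturbed here, so the set comes from
`IsAmenable.exists_isCompact_measure_mul_le` for counting measure, and the identity on the
intersection of `F` with its translate is the matching. -/
theorem IsAmenable.exists_finite_matching_of_discrete (hG : IsAmenable G) [DiscreteTopology G]
    (E : Finset G) {V : Set G} (hV : (1 : G) ∈ V) {ε : ℝ} (hε : 0 < ε) :
    ∃ F : Set G, F.Finite ∧ F.Nonempty ∧ ∀ g ∈ E,
      (1 - ε) * F.ncard ≤ matchingNumber V F ((fun h => g * h) '' F) := by
  classical
  let _ : MeasurableSpace G := borel G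
  have : BorelSpace G := ⟨rfl⟩
  have := isHaarMeasure_count (G := G)
  obtain ⟨F, hFc, hF0, hF⟩ := hG.exists_isCompact_measure_mul_le (Measure.count : Measure G)
    ((E : Set G).toFinite.insert 1).isCompact hε
  have hFf : F.Finite := hFc.finite_of_discrete
  refine ⟨F, hFf, nonempty_of_measure_ne_zero hF0, fun g hg => ?_⟩
  have hKf : (insert 1 (E : Set G) * F).Finite := ((E : Set G).toFinite.insert 1).mul hFf
  have h1 : ((insert 1 (E : Set G) * F).ncard : ℝ) ≤ (1 + ε) * F.ncard := by
    rw [Measure.count_apply_finite _ hFf, Measure.count_apply_finite _ hKf,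
      ← Set.ncard_eq_toFinset_card _ hFf, ← Set.ncard_eq_toFinset_card _ hKf,
      ← ENNReal.ofReal_natCast, ← ENNReal.ofReal_natCast, ← ENNReal.ofReal_mul (by positivity),
      ENNReal.ofReal_le_ofReal_iff (by positivity)] at hF
    exact hF
  have hsub : F ∪ (fun h => g * h) '' F ⊆ insert 1 (E : Set G) * F := by
    rintro x (hx | ⟨y, hy, rfl⟩)
    · exact ⟨1, Set.mem_insert _ _, x, hx, one_mul x⟩
    · exact ⟨g, Set.mem_insert_of_mem _ hg, y, hy, rfl⟩
  have h2 := Set.ncard_le_ncard hsub hKf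
  have h3 := Set.ncard_union_add_ncard_inter F ((fun h => g * h) '' F) hFf (hFf.image _)
  rw [Set.ncard_image_of_injective _ (mul_right_injective g)] at h3
  have h4 : (F ∩ (fun h => g * h) '' F).ncard ≤ matchingNumber V F ((fun h => g * h) '' F) :=
    ncard_le_matchingNumber hFf Set.inter_subset_left (φ := id) Function.injective_id.injOn
      (fun x hx => hx.2) fun x _ => ⟨1, hV, (one_mul x).symm⟩
  have h2' : ((F ∪ (fun h => g * h) '' F).ncard : ℝ) ≤ (insert 1 (E : Set G) * F).ncard := by
    exact_mod_cast h2
  have h3' : ((F ∪ (fun h => g * h) '' F).ncard : ℝ) + (F ∩ (fun h => g * h) '' F).ncard =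
      F.ncard + F.ncard := by exact_mod_cast h3
  have h4' : ((F ∩ (fun h => g * h) '' F).ncard : ℝ) ≤
      matchingNumber V F ((fun h => g * h) '' F) := by exact_mod_cast h4
  linarith

/-- Existence of thin Følner sequences. -/
theorem IsAmenable.exists_isThinFolner (hG : IsAmenable G) [T1Space G]
    [SecondCountableTopology G] : ∃ F : ℕ → Set G, IsThinFolner F := by
  classical
  obtain ⟨V, hV⟩ := (𝓝 (1 : G)).exists_antitone_basis
  let d := TopologicalSpace.denseSeq G
  have hex : ∀ n : ℕ, ∃ F : Set G, F.Finite ∧ F.Nonempty ∧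
      ∀ g ∈ (Finset.range (n + 1)).image d,
        (1 - 1 / ((n : ℝ) + 1)) * F.ncard ≤ matchingNumber (V n) F ((fun h => g * h) '' F) := by
    intro n
    by_cases hd : DiscreteTopology G
    · exact hG.exists_finite_matching_of_discrete _ (mem_of_mem_nhds (hV.mem n)) (by positivity)
    · exact hG.exists_finite_matching_of_not_discrete hd _ (hV.mem n) (by positivity)
  choose F hFf hFn hF using hex
  refine ⟨F, hFf, hFn, fun g W hW h1 => ?_⟩
  have hcont : Continuous fun z : G × G => z.1 * z.2 := continuous_mul
  have hW' : W ∈ 𝓝 ((1 : G) * 1) := by simpa using hW.mem_nhds h1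
  obtain ⟨U, hU, U', hU', hUU⟩ := mem_prod_iff.1 (nhds_prod_eq (x := (1 : G)) (y := (1 : G)) ▸
    hcont.tendsto (1, 1) hW')
  obtain ⟨m, hm⟩ := hV.mem_iff.1 hU'
  obtain ⟨_, ⟨j, rfl⟩, hj⟩ : ∃ y ∈ Set.range d, g * y⁻¹ ∈ U := by
    have ht : Tendsto (fun y : G => g * y⁻¹) (𝓝 g) (𝓝 1) := by
      have hc : Continuous fun y : G => g * y⁻¹ := by fun_prop
      simpa using hc.tendsto g
    obtain ⟨y, hy, hyd⟩ := (TopologicalSpace.denseRange_denseSeq G).inter_nhds_nonempty (ht hU)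
    exact ⟨y, hy, hyd⟩
  have hlim : Tendsto (fun n : ℕ => 1 - 1 / ((n : ℝ) + 1)) atTop (𝓝 1) := by
    simpa using tendsto_one_div_add_atTop_nhds_zero_nat.const_sub (1 : ℝ)
  refine tendsto_of_tendsto_of_tendsto_of_le_of_le' hlim tendsto_const_nhds ?_ ?_
  · filter_upwards [eventually_ge_atTop m, eventually_ge_atTop j] with n hnm hnj
    have hpos : (0 : ℝ) < (F n).ncard := by exact_mod_cast (Set.ncard_pos (hFf n)).2 (hFn n)
    rw [le_div_iff₀ hpos]
    refine (hF n (d j) (Finset.mem_image_of_mem d (Finset.mem_range.2 (by omega)))).trans ?_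
    have := matchingNumber_le_mul_left (hFf n) (V := V n) (W := W) (d j) (g * (d j)⁻¹)
      fun v hv => hUU (a := (g * (d j)⁻¹, v)) ⟨hj, hm (hV.antitone hnm hv)⟩
    rw [inv_mul_cancel_right] at this
    exact Nat.cast_le.2 this
  · exact Eventually.of_forall fun n => div_le_one_of_le₀
      (Nat.cast_le.2 (matchingNumber_le_ncard (hFf n) _ _)) (Nat.cast_nonneg _)

end ThinExistence

/-! ### Mirrored thin Følner sequences -/

section Mirrored

variable {G : Type*} [Group G] [TopologicalSpace G] [IsTopologicalGroup G] [T2Space G]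
  [LocallyCompactSpace G] [MeasurableSpace G] [BorelSpace G]
variable {X : Type*} [MetricSpace X] [CompactSpace X] [MulAction G X] [ContinuousSMul G X]

theorem eventually_abs_integral_mul_sub_le {θ : Measure G} [IsFiniteMeasureOnCompacts θ]
    {ψ : G → ℝ} (hψ : Continuous ψ) (hc : HasCompactSupport ψ) (hψ0 : ∀ w, 0 ≤ ψ w)
    (hψ1 : ∫ w, ψ w ∂θ = 1) {u : ℕ → G → ℝ} (hu : ∀ n, Continuous (u n)) {a : ℕ → ℝ} {C : ℝ}
    (huC : ∀ n w, |u n w| ≤ C) (haC : ∀ n, |a n| ≤ C) {ε : ℝ} (hε : 0 < ε)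
    (h : ∀ w, ψ w ≠ 0 → ∀ᶠ n in atTop, |u n w - a n| < ε) :
    ∀ᶠ n in atTop, |∫ w, u n w * ψ w ∂θ - a n| ≤ 2 * ε := by
  have hψi : Integrable ψ θ := hψ.integrable_of_hasCompactSupport hc
  -- The excess over `ε` is eventually zero at each point, so dominated convergence applies to it
  -- although the times from which the estimate holds are not uniform in `w`.
  let k : ℕ → G → ℝ := fun n w => max 0 (|u n w - a n| - ε) * ψ w
  have hkc : ∀ n, Continuous (k n) := fun n => by
    have := hu n
    simp only [k]
    fun_prop
  have hk0 : ∀ n w, 0 ≤ max 0 (|u n w - a n| - ε) := fun n w => le_max_left _ _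
  have hkb : ∀ n w, max 0 (|u n w - a n| - ε) ≤ 2 * C := fun n w => by
    have h1 := abs_sub (u n w) (a n)
    have h2 := huC n w
    have h3 := haC n
    have h4 := abs_nonneg (a n)
    exact max_le (by linarith) (by linarith)
  have hkC : ∀ n w, ‖k n w‖ ≤ 2 * C * ψ w := fun n w => by
    rw [Real.norm_eq_abs, abs_of_nonneg (mul_nonneg (hk0 n w) (hψ0 w))]
    exact mul_le_mul_of_nonneg_right (hkb n w) (hψ0 w)
  have hlim : Tendsto (fun n => ∫ w, k n w ∂θ) atTop (𝓝 0) := by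
    have := tendsto_integral_of_dominated_convergence (μ := θ) (F := k) (f := fun _ => 0)
      (fun w => 2 * C * ψ w) (fun n => (hkc n).aestronglyMeasurable) (hψi.const_mul _)
      (fun n => ae_of_all _ (hkC n)) (ae_of_all _ fun w => ?_)
    · simpa using this
    · by_cases hw : ψ w = 0
      · simp [k, hw]
      · refine tendsto_const_nhds.congr' ?_
        filter_upwards [h w hw] with n hn
        simp only [k]
        rw [max_eq_left (by linarith), zero_mul]
  filter_upwards [hlim.eventually_lt_const hε] with n hn
  have hi : Integrable (fun w => u n w * ψ w) θ :=
    ((hu n).mul hψ).integrable_of_hasCompactSupport hc.mul_left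
  have hki : Integrable (k n) θ := (hψi.const_mul (2 * C)).mono' (hkc n).aestronglyMeasurable
    (ae_of_all _ (hkC n))
  have e : ∫ w, u n w * ψ w ∂θ - a n = ∫ w, (u n w - a n) * ψ w ∂θ := by
    simp only [sub_mul]
    rw [integral_sub hi (hψi.const_mul _), integral_const_mul, hψ1, mul_one]
  rw [e, ← Real.norm_eq_abs]
  refine (norm_integral_le_of_norm_le (g := fun w => k n w + ε * ψ w)
    (hki.add (hψi.const_mul ε)) (ae_of_all _ fun w => ?_)).trans ?_
  · rw [Real.norm_eq_abs, abs_mul, abs_of_nonneg (hψ0 w)]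
    have := le_max_right 0 (|u n w - a n| - ε)
    simp only [k]
    rw [← add_mul]
    exact mul_le_mul_of_nonneg_right (by linarith) (hψ0 w)
  · rw [integral_add hki (hψi.const_mul ε), integral_const_mul, hψ1]
    linarith

/-- Left invariance moves the displacement `v` from the orbit onto `ψ`; the bound is uniform in `h`.
-/
theorem abs_integral_mul_left_sub_le {θ : Measure G} [θ.IsHaarMeasure] {ψ : G → ℝ}
    (hψ : Continuous ψ) (hc : HasCompactSupport ψ) (f : C(X, ℝ)) (x : X) (h v : G) :
    |∫ w, f ((h * v * w) • x) * ψ w ∂θ - ∫ w, f ((h * w) • x) * ψ w ∂θ| ≤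
      ‖f‖ * ∫ w, |ψ (v⁻¹ * w) - ψ w| ∂θ := by
  have hcv : HasCompactSupport fun w => ψ (v⁻¹ * w) := hc.comp_homeomorph (Homeomorph.mulLeft v⁻¹)
  have hψv : Continuous fun w => ψ (v⁻¹ * w) := by fun_prop
  have hfc : Continuous fun w : G => f ((h * w) • x) := by fun_prop
  have e : ∫ w, f ((h * v * w) • x) * ψ w ∂θ = ∫ w, f ((h * w) • x) * ψ (v⁻¹ * w) ∂θ := by
    rw [← integral_mul_left_eq_self (fun w => f ((h * w) • x) * ψ (v⁻¹ * w)) v]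
    simp [mul_assoc]
  have hi1 : Integrable (fun w => f ((h * w) • x) * ψ (v⁻¹ * w)) θ :=
    (hfc.mul hψv).integrable_of_hasCompactSupport hcv.mul_left
  have hi2 : Integrable (fun w => f ((h * w) • x) * ψ w) θ :=
    (hfc.mul hψ).integrable_of_hasCompactSupport hc.mul_left
  have hi3 : Integrable (fun w => |ψ (v⁻¹ * w) - ψ w|) θ :=
    ((hψv.integrable_of_hasCompactSupport hcv).sub (hψ.integrable_of_hasCompactSupport hc)).abs
  rw [e, ← integral_sub hi1 hi2, ← integral_const_mul, ← Real.norm_eq_abs]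
  refine norm_integral_le_of_norm_le (hi3.const_mul _) (ae_of_all _ fun w => ?_)
  rw [← mul_sub, Real.norm_eq_abs, abs_mul]
  exact mul_le_mul_of_nonneg_right (f.norm_coe_le_norm _) (abs_nonneg _)

/-- A displacement on the right of `a` acts on `x` before `a` does, and `f (a • v • x)` need not be
near `f (a • x)` uniformly in `a`. Asymptotic equicontinuity permits replacing `x` by a smooth
average of nearby points `w • x`, and the smoothed orbit function does vary little under right
displacements. -/
theorem IsMirroredThinFolner.tendsto_sub {F : ℕ → Set G} (hF : IsMirroredThinFolner F)
    (hE : AsymptoticallyEquicontinuous X Measure.count F) (f : C(X, ℝ)) (g : G) (x : X) :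
    Tendsto (fun n => avgOp X Measure.count (F n) f (g • x) - avgOp X Measure.count (F n) f x)
      atTop (𝓝 0) := by
  classical
  refine Metric.tendsto_nhds.2 fun ε' hε' => ?_
  -- Smoothing costs `2 * ε` at each of `x` and `g • x`, and the matching costs `ε`.
  obtain ⟨ε, hε, rfl⟩ : ∃ ε : ℝ, 0 < ε ∧ ε' = 6 * ε := ⟨ε' / 6, by positivity, by ring⟩
  let θ : Measure G := Measure.haar
  let S : ℕ → C(X, ℝ) := fun n => avgOp X Measure.count (F n) f
  have hSC : ∀ n y, |S n y| ≤ ‖f‖ := fun n y => abs_avgOp_le _ _ _ _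
  have hE1 : ∀ y : G → X, Continuous y → ∀ᶠ w in 𝓝 (1 : G), ∀ᶠ n in atTop,
      |S n (y w) - S n (y 1)| < ε := fun y hy => (hy.tendsto 1).eventually (hE f ε hε (y 1))
  have hc1 : Continuous fun w : G => w • x := by fun_prop
  have hc2 : Continuous fun w : G => (g * w) • x := by fun_prop
  obtain ⟨ψ, hψ, hψc, hψ0, hψ1, hψU⟩ := exists_bump θ ((hE1 _ hc1).and (hE1 _ hc2))
  have hB := eventually_abs_integral_mul_sub_le hψ hψc hψ0 hψ1 (u := fun n w => S n (w • x))
    (a := fun n => S n x) (fun n => by fun_prop) (fun n w => hSC n _) (fun n => hSC n _) hε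
    (fun w hw => by simpa using (hψU w hw).1)
  have hA := eventually_abs_integral_mul_sub_le hψ hψc hψ0 hψ1 (u := fun n w => S n ((g * w) • x))
    (a := fun n => S n (g • x)) (fun n => by fun_prop) (fun n w => hSC n _) (fun n => hSC n _) hε
    (fun w hw => by simpa using (hψU w hw).2)
  let u : G → ℝ := fun h => ∫ w, f ((h * w) • x) * ψ w ∂θ
  have hinteg : ∀ h : G, Integrable (fun w => f ((h * w) • x) * ψ w) θ := fun h =>
    Continuous.integrable_of_hasCompactSupport (by fun_prop) hψc.mul_left
  have huC : ∀ h, |u h| ≤ ‖f‖ := fun h => by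
    have hψi : Integrable ψ θ := hψ.integrable_of_hasCompactSupport hψc
    have := norm_integral_le_of_norm_le (μ := θ) (f := fun w => f ((h * w) • x) * ψ w)
      (hψi.const_mul ‖f‖) (ae_of_all _ fun w => ?_)
    · rwa [integral_const_mul, hψ1, mul_one] at this
    · rw [Real.norm_eq_abs, abs_mul, abs_of_nonneg (hψ0 w)]
      exact mul_le_mul_of_nonneg_right (f.norm_coe_le_norm _) (hψ0 w)
  have hcF : ∀ n, ((hF.finite n).toFinset).card = (F n).ncard := fun n =>
    (Set.ncard_eq_toFinset_card _ (hF.finite n)).symm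
  have hS : ∀ n y, S n y =
      ((hF.finite n).toFinset.card : ℝ)⁻¹ * ∑ h ∈ (hF.finite n).toFinset, f (h • y) := fun n y => by
    have := avgOp_count (hF.finite n).toFinset f y
    rwa [Set.Finite.coe_toFinset] at this
  have hSint : ∀ (n : ℕ) (k : G), ∫ w, S n ((k * w) • x) * ψ w ∂θ =
      ((hF.finite n).toFinset.card : ℝ)⁻¹ * ∑ h ∈ (hF.finite n).toFinset, u (h * k) := fun n k => by
    simp only [hS, u]
    rw [← integral_finsetSum _ fun h _ => hinteg (h * k), ← integral_const_mul]
    simp only [mul_assoc, Finset.sum_mul, smul_smul]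
  have hinjg : Function.Injective fun h : G => h * g := mul_left_injective g
  have key := tendsto_avg_sub_avg_of_matching (A := fun n => (hF.finite n).toFinset)
    (B := fun n => (hF.finite n).toFinset.image fun h => h * g)
    (fun n => (hF.finite n).toFinset_nonempty.2 (hF.nonempty n))
    (fun n => (Finset.card_image_of_injective _ hinjg).symm) (u := fun (_ : Unit) h => u h)
    (C := ‖f‖) (fun _ => huC) (fun δ hδ => ?_) hε
  · filter_upwards [hA, hB, key] with n h1 h2 h3
    have h4 := h3 ()
    rw [Finset.sum_image hinjg.injOn, ← hSint n g] at h4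
    have e := hSint n 1
    simp only [one_mul, mul_one] at e
    rw [← e] at h4
    rw [dist_zero_right, Real.norm_eq_abs]
    change |S n (g • x) - S n x| < 6 * ε
    rw [abs_le] at *
    rw [abs_lt]
    constructor <;> linarith [h1.1, h1.2, h2.1, h2.2, h4.1, h4.2]
  · have hlim := (tendsto_integral_abs_left_translate_sub (θ := θ) hψ hψc).const_mul ‖f‖
    rw [mul_zero] at hlim
    obtain ⟨V, hVu, hVo, hV1⟩ := mem_nhds_iff.1 (hlim.eventually_lt_const hδ)
    refine ⟨_, by simpa only [hcF] using hF.tendsto g V hVo hV1, fun n => ?_⟩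
    obtain ⟨M, hM, hMk, φ, hφ, hφE, hφV⟩ := exists_eq_rightMatchingNumber (hF.finite n) V
      ((fun h => h * g) '' F n)
    have hMf := (hF.finite n).subset hM
    refine ⟨hMf.toFinset, by simpa using hM, ?_, φ, by simpa using hφ,
      fun a ha => by simpa using hφE (by simpa using ha), fun _ a ha => ?_⟩
    · rw [← Set.ncard_eq_toFinset_card _ hMf, hMk]
    · obtain ⟨v, hv, e⟩ := hφV a (by simpa using ha)
      rw [e]
      exact (abs_integral_mul_left_sub_le hψ hψc f x a v).trans (hVu hv).le

end Mirrored

end WeakMean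

end

/-! ### The theorem for thick and thin Følner sequences -/

open WeakMean in
theorem theorem3p10 {G : Type*} [Group G] [TopologicalSpace G] [IsTopologicalGroup G] [T2Space G]
    [MeasurableSpace G] [BorelSpace G] (hG : IsAmenable G)
    {X : Type*} [MetricSpace X] [CompactSpace X] [MeasurableSpace X] [BorelSpace X]
    [MulAction G X] [ContinuousSMul G X] :
    -- thick Følner sequences in a σ-compact locally compact group
    (∀ [LocallyCompactSpace G] [SigmaCompactSpace G]
      (θ : Measure G) [θ.IsHaarMeasure] [θ.Regular]
      (θr : Measure G) [θr.IsMulRightInvariant] [θr.IsOpenPosMeasure] [θr.Regular],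
      List.TFAE [
        WeaklyMeanEquicontinuous X θ (IsThickFolner θ),
        ContinuouslyUniquelyErgodic G X,
        AveragesConverge X θ (IsThickFolner θ)] ∧
      ((∃ F, IsThickFolner θ F ∧ FolnerWeaklyMeanEquicontinuous X θ F) →
        HasFullySupportedInvariantMeasure G X →
        WeaklyMeanEquicontinuous X θ (IsThickFolner θ) ∧
        ContinuouslyUniquelyErgodic G X ∧
        AveragesConverge X θ (IsThickFolner θ)) ∧
      ((∃ F, IsRightThickFolner θr F ∧ FolnerWeaklyMeanEquicontinuous X θr F) →
        WeaklyMeanEquicontinuous X θ (IsThickFolner θ) ∧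
        ContinuouslyUniquelyErgodic G X ∧
        AveragesConverge X θ (IsThickFolner θ))) ∧
    -- thin Følner sequences in a second countable group
    (∀ [SecondCountableTopology G],
      List.TFAE [
        WeaklyMeanEquicontinuous X (Measure.count : Measure G) IsThinFolner,
        ContinuouslyUniquelyErgodic G X,
        AveragesConverge X (Measure.count : Measure G) IsThinFolner] ∧
      ((∃ F, IsThinFolner F ∧
          FolnerWeaklyMeanEquicontinuous X (Measure.count : Measure G) F) →
        HasFullySupportedInvariantMeasure G X →
        WeaklyMeanEquicontinuous X (Measure.count : Measure G) IsThinFolner ∧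
        ContinuouslyUniquelyErgodic G X ∧
        AveragesConverge X (Measure.count : Measure G) IsThinFolner) ∧
      ((∃ F, (IsRightThinFolner F ∨ (LocallyCompactSpace G ∧ IsMirroredThinFolner F)) ∧
          FolnerWeaklyMeanEquicontinuous X (Measure.count : Measure G) F) →
        WeaklyMeanEquicontinuous X (Measure.count : Measure G) IsThinFolner ∧
        ContinuouslyUniquelyErgodic G X ∧
        AveragesConverge X (Measure.count : Measure G) IsThinFolner)) := by
  refine ⟨?_, ?_⟩
  · intro _ _ θ _ _ θr _ _ _
    have hP := isAveragingClass_isThickFolner (X := X) hG θ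
    refine ⟨hP.tfae hG, ?_, ?_⟩
    · rintro ⟨F, hF, h⟩ hS
      exact (h.continuouslyUniquelyErgodic hG (hP.ne_zero F hF) (hP.ne_top F hF)
        hF.asymptoticallyInvariant hS).all hP
    · rintro ⟨F, hF, h⟩
      have h0 : ∀ n, θr (F n) ≠ 0 := fun n => (hF.measure_pos n).ne'
      have h1 : ∀ n, θr (F n) ≠ ⊤ := fun n => (hF.isCompact n).measure_lt_top.ne
      exact ((h.asymptoticallyEquicontinuous h0 h1).continuouslyUniquelyErgodic hG h0 h1
        fun f g x => hF.tendsto_sub f g x).all hP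
  · intro _
    have hP := isAveragingClass_isThinFolner (X := X) hG.exists_isThinFolner
    refine ⟨hP.tfae hG, ?_, ?_⟩
    · rintro ⟨F, hF, h⟩ hS
      exact (h.continuouslyUniquelyErgodic hG (hP.ne_zero F hF) (hP.ne_top F hF)
        hF.asymptoticallyInvariant hS).all hP
    · rintro ⟨F, hF, h⟩
      have hfin : ∀ n, (F n).Finite := hF.elim (fun hF => hF.finite) fun hF => hF.2.finite
      have hne : ∀ n, (F n).Nonempty := hF.elim (fun hF => hF.nonempty) fun hF => hF.2.nonempty
      have h0 : ∀ n, (Measure.count : Measure G) (F n) ≠ 0 := fun n => by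
        simpa using (hne n).ne_empty
      have h1 : ∀ n, (Measure.count : Measure G) (F n) ≠ ⊤ := fun n =>
        (Measure.count_apply_lt_top.2 (hfin n)).ne
      have hE := h.asymptoticallyEquicontinuous h0 h1
      refine (hE.continuouslyUniquelyErgodic hG h0 h1 fun f g x => ?_).all hP
      rcases hF with hF | ⟨_, hF⟩
      · exact hF.tendsto_sub f g x
      · exact hF.tendsto_sub hE f g x
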